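/- Let $d\ge 1$, $Q:=[0,1)^d$, $Q':=[-\pi,\pi)^d$. Let $Q_1\subset Q$ be such that the periodic set $\bigcup_{n\in\mathbb Z^d}(Q_1+n)$ is open, connected and has Lipschitz boundary, let $Q_0$ be the interior of $Q\setminus Q_1$, and assume $\overline{Q_0}\subset(0,1)^d$ ($Q_0=\emptyset$ is allowed). Let $A_0,A_1$ be $Q$-periodic symmetric real $d\times d$ matrix functions with entries in $L^\infty(Q)$, and let $\nu>0$ be such that $A_0\ge\nu I$ on $Q$, $A_1\ge\nu I$ on $Q_1$, and $A_1=0$ on $Q_0$ (almost everywhere). Put $A^\varepsilon:=A_1+\varepsilon^2A_0$. Let $H^1_\#(Q)$ be the space of $Q$-periodic complex functions in $H^1_{\rm loc}(\mathbb R^d)$, and put $\mathcal H_0:=\mathbb C\times H^1_0(Q_0)$, functions in $H^1_0(Q_0)$ being extended by zero. Let $\mathcal P_{\rm f}$ be the orthogonal projection of $L^2(Q)$ onto $\mathcal L:=\{c+\widetilde u:\ c\in\mathbb C,\ \widetilde u\in L^2(Q),\ \widetilde u|_{Q_1}=0\}$, and for $\xi\in\mathbb R^d$ let $$A^{\rm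 hom}\xi\cdot\xi:=\min_{u\in H^1_\#(Q)}\int_Q A_1(\xi+\nabla u)\cdot\overline{(\xi+\nabla u)}.$$ Then there is a constant $C>0$ (depending only on $d$, $Q_1$, $A_0$, $A_1$, $\nu$) such that the following holds for all $\varepsilon>0$, all $\theta\in\varepsilon^{-1}Q'$ and all $F\in L^2(Q)$. The fibre problem $$-\varepsilon^{-2}(\nabla+{\rm i}\varepsilon\theta)\cdot A^\varepsilon(\nabla+{\rm i}\varepsilon\theta)u^\varepsilon_\theta+u^\varepsilon_\theta=F,$$ that is, $$\int_Q(\varepsilon^{-2}A_1+A_0)(\nabla+{\rm i}\varepsilon\theta)u^\varepsilon_\theta\cdot\overline{(\nabla+{\rm i}\varepsilon\theta)w}+\int_Q u^\varepsilon_\theta\overline w=\int_Q F\overline w\qquad\forall w\in H^1_\#(Q),$$ has a unique solution $u^\varepsilon_\theta\in H^1_\#(Q)$. The homogenised fibre problem $$A^{\rm hom}\theta\cdot\theta\,c\,\overline b+\int_Q A_0(\nabla+{\rm i}\varepsilon\theta)v\cdot\overline{(\nabla+{\rm i}\varepsilon\theta)\varphi}+\int_Q(c+v)\overline{(b+\varphi)}=\int_Q\mathcal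 P_{\rm f}F\,\overline{(b+\varphi)}\qquad\forall(b,\varphi)\in\mathcal H_0$$ has a unique solution $(c,v)=(c^{(0)}_{\varepsilon,\theta},v^{(0)}_{\varepsilon,\theta})\in\mathcal H_0$. With $u^{(0)}_{\varepsilon,\theta}:=c^{(0)}_{\varepsilon,\theta}+v^{(0)}_{\varepsilon,\theta}$ one has $$\bigl\|u^\varepsilon_\theta-u^{(0)}_{\varepsilon,\theta}\bigr\|_{L^2(Q)}\le C\,\varepsilon\,\|F\|_{L^2(Q)}.$$ -/

import Mathlib

open MeasureTheory Filter Topology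
open scoped ContDiff ENNReal NNReal ComplexConjugate

noncomputable section

namespace HighContrast

/-- The Euclidean space `ℝ^d`. -/
abbrev Space (d : ℕ) : Type := EuclideanSpace ℝ (Fin d)

/-- The periodicity cell `Q = [0,1)^d`. -/
def cell (d : ℕ) : Set (Space d) := {x | ∀ j, x j ∈ Set.Ico (0 : ℝ) 1}

/-- The open cube `(0,1)^d`. -/
def openCube (d : ℕ) : Set (Space d) := {x | ∀ j, x j ∈ Set.Ioo (0 : ℝ) 1}

/-- Lebesgue measure on `Q`. -/
abbrev cellMeasure (d : ℕ) : Measure (Space d) := volume.restrict (cell d)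

/-- The dual cell `[-π,π)^d` of quasimomenta. -/
def dualCell (d : ℕ) : Set (Space d) := {x | ∀ j, x j ∈ Set.Ico (-Real.pi) Real.pi}

/-- The lattice vector in `ℝ^d` with integer coordinates `n`. -/
def latticeVec {d : ℕ} (n : Fin d → ℤ) : Space d := WithLp.toLp 2 (fun j => (n j : ℝ))

/-- `f` is `Q`-periodic. -/
def IsPeriodic {d : ℕ} {X : Type*} (f : Space d → X) : Prop :=
  ∀ (n : Fin d → ℤ) (x : Space d), f (x + latticeVec n) = f x

/-- The union of all integer translates of `S`. -/
def periodization {d : ℕ} (S : Set (Space d)) : Set (Space d) :=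
  {x | ∃ n : Fin d → ℤ, x - latticeVec n ∈ S}

/-- `Ω` has Lipschitz boundary: near each boundary point, `Ω` is, in a suitable direction `e`, the
region strictly above the graph of a Lipschitz function of the coordinates orthogonal to `e` (such
a function is given as a function `ψ` on the whole space which is constant in the direction
`e`). -/
def HasLipschitzBoundary {d : ℕ} (Ω : Set (Space d)) : Prop :=
  ∀ x ∈ frontier Ω, ∃ (e : Space d) (ψ : Space d → ℝ) (K : ℝ≥0) (r : ℝ),
    ‖e‖ = 1 ∧ LipschitzWith K ψ ∧ (∀ (y : Space d) (t : ℝ), ψ (y + t • e) = ψ y) ∧ 0 < r ∧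
    ∀ y ∈ Metric.ball x r, y ∈ Ω ↔ ψ y < inner ℝ e y

/-- The soft component `Q₀`, the interior of `Q \ Q₁`. -/
def softPart {d : ℕ} (Q₁ : Set (Space d)) : Set (Space d) := interior (cell d \ Q₁)

/-- Geometric assumptions on the stiff component `Q₁ ⊆ Q` (openness, connectedness and regularity
are those of the periodic set made of all the translates of `Q₁`). -/
structure IsStiffPart {d : ℕ} (Q₁ : Set (Space d)) : Prop where
  subset_cell : Q₁ ⊆ cell d
  isOpen : IsOpen (periodization Q₁)
  isConnected : IsConnected (periodization Q₁)
  lipschitz : HasLipschitzBoundary (periodization Q₁)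
  closure_softPart : closure (softPart Q₁) ⊆ openCube d

/-- Assumptions on a coefficient matrix: periodic, entries in `L^∞(Q)`, symmetric. -/
structure IsCoefficient {d : ℕ} (A : Space d → Matrix (Fin d) (Fin d) ℝ) : Prop where
  periodic : IsPeriodic A
  bounded : ∀ i j, MemLp (fun x => A x i j) ∞ (cellMeasure d)
  symm : ∀ᵐ x ∂(cellMeasure d), (A x).IsSymm

/-- The ellipticity bound `A ≥ ν I` (as quadratic forms) almost everywhere on `S`. -/
def IsEllipticOn {d : ℕ} (A : Space d → Matrix (Fin d) (Fin d) ℝ) (ν : ℝ)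
    (S : Set (Space d)) : Prop :=
  ∀ᵐ x ∂(volume.restrict S), ∀ ξ : Fin d → ℝ, ν * (ξ ⬝ᵥ ξ) ≤ ξ ⬝ᵥ (A x).mulVec ξ

/-- `g` is the weak gradient of `u` in `ℝ^d`. -/
def IsWeakGradient {d : ℕ} (u : Space d → ℂ) (g : Space d → Fin d → ℂ) : Prop :=
  ∀ φ : Space d → ℝ, ContDiff ℝ ∞ φ → HasCompactSupport φ → ∀ j : Fin d,
    ∫ x, (fderiv ℝ φ x (EuclideanSpace.single j 1)) • u x = -∫ x, φ x • g x j

/-- `f ∈ L²_loc(ℝ^d)`. -/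
def MemL2loc {d : ℕ} (f : Space d → ℂ) : Prop :=
  ∀ K : Set (Space d), IsCompact K → MemLp f 2 (volume.restrict K)

/-- `u ∈ H¹_#(Q)` with `∇u = g`: `u` is `Q`-periodic and belongs to `H¹_loc(ℝ^d)`. -/
structure MemH1Per {d : ℕ} (u : Space d → ℂ) (g : Space d → Fin d → ℂ) : Prop where
  periodic : IsPeriodic u
  memL2loc : MemL2loc u
  grad_memL2loc : ∀ j, MemL2loc (fun x => g x j)
  isWeakGradient : IsWeakGradient u g

/-- `v ∈ H¹_0(Ω)` with `∇v = g`, both extended by zero outside `Ω`: the pair `(v, g)` is the limit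
in `L²` of pairs `(φ, ∇φ)` with `φ ∈ C_c^∞(Ω)`. -/
structure MemH10 {d : ℕ} (Ω : Set (Space d)) (v : Space d → ℂ)
    (g : Space d → Fin d → ℂ) : Prop where
  memLp : MemLp v 2 volume
  grad_memLp : ∀ j, MemLp (fun x => g x j) 2 volume
  approx : ∃ φ : ℕ → Space d → ℂ,
    (∀ n, ContDiff ℝ ∞ (φ n) ∧ HasCompactSupport (φ n) ∧ tsupport (φ n) ⊆ Ω) ∧
    Tendsto (fun n => eLpNorm (fun x => φ n x - v x) 2 volume) atTop (𝓝 0) ∧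
    ∀ j : Fin d, Tendsto (fun n => eLpNorm
      (fun x => fderiv ℝ (φ n) x (EuclideanSpace.single j 1) - g x j) 2 volume) atTop (𝓝 0)

/-- `M p · \overline{q}` for a real matrix `M` and complex vectors `p`, `q`. -/
def matForm {d : ℕ} (M : Matrix (Fin d) (Fin d) ℝ) (p q : Fin d → ℂ) : ℂ :=
  ∑ i, ∑ j, (M i j : ℂ) * p j * conj (q i)

/-- `(∇ + iκ)u`, where `g = ∇u`. -/
def shiftGrad {d : ℕ} (κ : Space d) (u : Space d → ℂ) (g : Space d → Fin d → ℂ) :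
    Space d → Fin d → ℂ :=
  fun x j => g x j + Complex.I * (κ j : ℂ) * u x

/-- `A^hom ξ · ξ`, the minimum of `∫_Q A₁ (ξ + ∇u) · \overline{(ξ + ∇u)}` over `u ∈ H¹_#(Q)`. -/
def homQuad {d : ℕ} (A₁ : Space d → Matrix (Fin d) (Fin d) ℝ) (ξ : Space d) : ℝ :=
  sInf {r : ℝ | ∃ u g, MemH1Per u g ∧
    r = (∫ x, matForm (A₁ x) (fun j => (ξ j : ℂ) + g x j) (fun j => (ξ j : ℂ) + g x j)
      ∂(cellMeasure d)).re}

/-- The fibre form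
`𝔟_{ε,θ}(u,w) = ∫_Q (ε⁻² A₁ + A₀)(∇ + iεθ)u · \overline{(∇ + iεθ)w}`, where `g = ∇u`, `h = ∇w`. -/
def fibreForm {d : ℕ} (A₀ A₁ : Space d → Matrix (Fin d) (Fin d) ℝ) (ε : ℝ) (θ : Space d)
    (u : Space d → ℂ) (g : Space d → Fin d → ℂ) (w : Space d → ℂ) (h : Space d → Fin d → ℂ) : ℂ :=
  ∫ x, matForm ((ε ^ 2)⁻¹ • A₁ x + A₀ x) (shiftGrad (ε • θ) u g x) (shiftGrad (ε • θ) w h x)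
    ∂(cellMeasure d)

/-- The homogenised fibre form `𝔟^hom_{ε,θ}((c,v),(b,φ))` on `ℂ × H¹_0(Q₀)`, where
`g = ∇v`, `h = ∇φ`. -/
def homForm {d : ℕ} (A₀ A₁ : Space d → Matrix (Fin d) (Fin d) ℝ) (ε : ℝ) (θ : Space d)
    (c : ℂ) (v : Space d → ℂ) (g : Space d → Fin d → ℂ)
    (b : ℂ) (φ : Space d → ℂ) (h : Space d → Fin d → ℂ) : ℂ :=
  (homQuad A₁ θ : ℂ) * c * conj b +
    ∫ x, matForm (A₀ x) (shiftGrad (ε • θ) v g x) (shiftGrad (ε • θ) φ h x) ∂(cellMeasure d)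

/-- The space `L²(Q)`. -/
abbrev L2Cell (d : ℕ) : Type := Lp ℂ 2 (cellMeasure d)

/-- The subspace `ℒ` of `L²(Q)`: the functions of the form `c + ũ` with `c` a constant and
`ũ = 0` on `Q₁`, that is, the functions that are a.e. equal to a constant on `Q₁`. -/
def limitSpace {d : ℕ} (Q₁ : Set (Space d)) : Submodule ℂ (L2Cell d) where
  carrier := {f | ∃ c : ℂ, ∀ᵐ x ∂((cellMeasure d).restrict Q₁), f x = c}
  add_mem' := by
    rintro f g ⟨a, ha⟩ ⟨b, hb⟩
    refine ⟨a + b, ?_⟩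
    filter_upwards [ha, hb, ae_restrict_of_ae (Lp.coeFn_add f g)] with x h1 h2 h3
    exact h3.trans (by rw [Pi.add_apply, h1, h2])
  zero_mem' := by
    refine ⟨0, ?_⟩
    filter_upwards [ae_restrict_of_ae (Lp.coeFn_zero ℂ 2 (cellMeasure d))] with x h
    exact h
  smul_mem' := by
    rintro k f ⟨a, ha⟩
    refine ⟨k * a, ?_⟩
    filter_upwards [ha, ae_restrict_of_ae (Lp.coeFn_smul k f)] with x h1 h2
    exact h2.trans (by rw [Pi.smul_apply, h1, smul_eq_mul])

theorem measurableSet_cell (d : ℕ) : MeasurableSet (cell d) := by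
  have : cell d = ⋂ j, (fun x : Space d => x j) ⁻¹' Set.Ico (0 : ℝ) 1 := by
    ext x; simp [cell]
  rw [this]
  exact MeasurableSet.iInter fun j => measurableSet_Ico.preimage (by fun_prop)

instance isFiniteMeasure_cell (d : ℕ) : IsFiniteMeasure (cellMeasure d) := by
  refine ⟨?_⟩
  rw [Measure.restrict_apply_univ]
  refine lt_of_le_of_lt (measure_mono ?_) (Metric.isBounded_closedBall (x := (0 : Space d))
    (r := Real.sqrt d)).measure_lt_top
  intro x hx
  rw [mem_closedBall_zero_iff, EuclideanSpace.norm_eq]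
  refine Real.sqrt_le_sqrt ?_
  calc ∑ i, ‖x i‖ ^ 2 ≤ ∑ _i : Fin d, (1 : ℝ) := by
        refine Finset.sum_le_sum fun i _ => ?_
        have := hx i
        rw [Real.norm_eq_abs, sq_abs]
        nlinarith [this.1, this.2]
    _ = d := by simp

theorem isClosed_limitSpace {d : ℕ} (Q₁ : Set (Space d)) :
    IsClosed (limitSpace Q₁ : Set (L2Cell d)) := by
  let one : Lp ℂ 2 ((cellMeasure d).restrict Q₁) := (memLp_const (1 : ℂ)).toLp _
  let R := LpToLpRestrictCLM (Space d) ℂ ℂ (cellMeasure d) 2 Q₁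
  have hcl : IsClosed ((Submodule.span ℂ {one} : Submodule ℂ
      (Lp ℂ 2 ((cellMeasure d).restrict Q₁))) : Set (Lp ℂ 2 ((cellMeasure d).restrict Q₁))) :=
    Submodule.closed_of_finiteDimensional _
  have hone : (one : Space d → ℂ) =ᵐ[(cellMeasure d).restrict Q₁] fun _ => (1 : ℂ) :=
    MemLp.coeFn_toLp _
  convert hcl.preimage R.continuous
  ext f
  have hR : (R f : Space d → ℂ) =ᵐ[(cellMeasure d).restrict Q₁] f :=
    LpToLpRestrictCLM_coeFn ℂ Q₁ f
  simp only [Set.mem_preimage, SetLike.mem_coe, Submodule.mem_span_singleton]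
  constructor
  · rintro ⟨c, hc⟩
    refine ⟨c, ?_⟩
    apply Lp.ext
    filter_upwards [hR, hc, hone, Lp.coeFn_smul c one] with x h1 h2 h3 h4
    simp [h1, h2, h3, h4]
  · rintro ⟨c, hc⟩
    refine ⟨c, ?_⟩
    rw [← hc] at hR
    filter_upwards [hR, hone, Lp.coeFn_smul c one] with x h1 h3 h4
    rw [← h1, h4]
    simp [h3]

instance hasOrthogonalProjection_limitSpace {d : ℕ} (Q₁ : Set (Space d)) :
    (limitSpace Q₁).HasOrthogonalProjection :=
  haveI : CompleteSpace (limitSpace Q₁) := (isClosed_limitSpace Q₁).completeSpace_coe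
  inferInstance

/-- `𝒫_f F`, the orthogonal projection of `F ∈ L²(Q)` onto `ℒ`. -/
def fibreProj {d : ℕ} (Q₁ : Set (Space d)) (F : L2Cell d) : L2Cell d :=
  (limitSpace Q₁).starProjection F

/-- `u ∈ H¹_#(Q)` is a weak solution of
`-ε⁻² (∇ + iεθ) · A^ε (∇ + iεθ) u + u = F`, where `A^ε = A₁ + ε² A₀`. -/
def IsFibreSolution {d : ℕ} (A₀ A₁ : Space d → Matrix (Fin d) (Fin d) ℝ) (ε : ℝ) (θ : Space d)
    (F : L2Cell d) (u : Space d → ℂ) : Prop :=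
  ∃ g, MemH1Per u g ∧ ∀ w h, MemH1Per w h →
    fibreForm A₀ A₁ ε θ u g w h + ∫ x, u x * conj (w x) ∂(cellMeasure d) =
      ∫ x, F x * conj (w x) ∂(cellMeasure d)

/-- The pair `(c, v) ∈ ℂ × H¹_0(Q₀)` solves the homogenised fibre problem with right-hand side
`𝒫_f F`. -/
def IsHomSolution {d : ℕ} (A₀ A₁ : Space d → Matrix (Fin d) (Fin d) ℝ) (Q₁ : Set (Space d))
    (ε : ℝ) (θ : Space d) (F : L2Cell d) (c : ℂ) (v : Space d → ℂ) : Prop :=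
  ∃ g, MemH10 (softPart Q₁) v g ∧ ∀ (b : ℂ) φ h, MemH10 (softPart Q₁) φ h →
    homForm A₀ A₁ ε θ c v g b φ h + ∫ x, (c + v x) * conj (b + φ x) ∂(cellMeasure d) =
      ∫ x, fibreProj Q₁ F x * conj (b + φ x) ∂(cellMeasure d)

end HighContrast

end

noncomputable section

namespace HighContrast

variable {d : ℕ}

/-! ### Periodic functions and the lattice -/

/-! Write D for ∇ + iεθ. The fibre form weights the stiff energy q(u)² = ∫ A₁ Du · conj(Du) by ε⁻²,
so the question is what a function of small stiff energy looks like.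

The central fact is uniform in κ in the dual cell (`IsStiffPart.exists_soft_approx`, abstracted as
the field `approx` of `FibreModel`). For every periodic w there are a constant b and φ in H¹₀(Q₀)
such that both w - φ - b and (∇ + iκ)w - (∇ + iκ)φ are bounded in L² by a multiple of the square
root of the stiff energy of w. To see this, multiply w by exp(iκ·x): the result W is quasi-periodic,
and its plain gradient has the modulus of (∇ + iκ)w. A Poincaré inequality on the connected periodic
stiff set (`IsStiffPart.exists_poincare`) gives a constant b close to W on Q₁. A reflection across
the Lipschitz boundary (`IsStiffPart.exists_extension`) replaces W - b in the soft part by a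
function controlled from Q₁. Finally, the factor exp(iκ_j) gained by W over one period forces
|exp(iκ_j) - 1| |b|, hence |κ| |b|, to be small. This allows exp(-iκ·x) b to be replaced by b.

The same Poincaré inequality applied to iξ·x + w shows that the homogenised form α satisfies α ≥
γ|θ|². Combined with the decomposition at κ = 0 it also yields, by Lax–Milgram, a corrector N for
the direction θ with ‖N‖ ≤ C|θ|.

The error estimate compares u with the ansatz c + εcN + v. Let w be the difference, decomposed as w
= r + φ + b. Subtract the fibre equation tested with w from the homogenised equation tested with (b,
φ). By the corrector equation the terms of negative order in ε pair only with r and with M₁Dw, and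
the contribution of b cancels exactly against αc conj b (`FibreModel.energy_identity`). The a priori
bounds |c||θ|, |c||θ|² ≲ ‖F‖ then give ε⁻²q² + ν‖Dw‖² + ‖w‖² ≲ ‖F‖ (q + ε‖Dw‖ + ε‖w‖), with q² now
the stiff energy of w. Young's inequality yields ‖w‖ ≲ ε‖F‖, and the corrector term εcN has the same
order, so it can be dropped.

All this is carried out in an abstract Hilbert space model in which H¹_# and H¹₀ are closures of
graphs of smooth functions. Mollification and truncation identify these closures with the spaces of
the weak formulations. -/

@[simp] theorem latticeVec_apply (n : Fin d → ℤ) (j : Fin d) : latticeVec n j = (n j : ℝ) := rfl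

theorem latticeVec_add (m n : Fin d → ℤ) :
    latticeVec (m + n) = latticeVec m + latticeVec n := by
  ext j; simp

theorem latticeVec_neg (n : Fin d → ℤ) : latticeVec (-n) = -latticeVec n := by
  ext j; simp

theorem latticeVec_single (j : Fin d) :
    latticeVec (Pi.single j 1) = EuclideanSpace.single j (1 : ℝ) := by
  ext i
  by_cases h : i = j
  · subst h; simp
  · simp [h]

theorem IsPeriodic.sub {X : Type*} {f : Space d → X} (hf : IsPeriodic f) (n : Fin d → ℤ)
    (x : Space d) : f (x - latticeVec n) = f x := by
  rw [← hf n (x - latticeVec n), sub_add_cancel]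

theorem IsPeriodic.comp {X Y : Type*} {f : Space d → X} (hf : IsPeriodic f) (g : X → Y) :
    IsPeriodic fun x => g (f x) := fun n x => congrArg g (hf n x)

theorem IsPeriodic.fderiv {f : Space d → ℂ} (hf : IsPeriodic f) : IsPeriodic (fderiv ℝ f) := by
  intro n x
  rw [← fderiv_comp_add_right]
  congr 1
  ext y
  exact hf n y

/-- The integer part of a vector. -/
def floorVec (x : Space d) : Fin d → ℤ := fun j => ⌊x j⌋

theorem sub_floorVec_mem_cell (x : Space d) : x - latticeVec (floorVec x) ∈ cell d := by
  intro j
  simp only [PiLp.sub_apply, latticeVec_apply, floorVec]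
  exact ⟨Int.fract_nonneg (x j), Int.fract_lt_one (x j)⟩

theorem eq_floorVec {x : Space d} {n : Fin d → ℤ} (h : x - latticeVec n ∈ cell d) :
    n = floorVec x := by
  ext j
  have := h j
  simp only [PiLp.sub_apply, latticeVec_apply, Set.mem_Ico] at this
  refine (Int.floor_eq_iff.2 ⟨by linarith, by linarith⟩).symm

theorem periodization_cell : periodization (cell d) = Set.univ :=
  Set.eq_univ_of_forall fun x => ⟨_, sub_floorVec_mem_cell x⟩

theorem mem_periodization_of_mem {S : Set (Space d)} {x : Space d} (h : x ∈ S) :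
    x ∈ periodization S := ⟨0, by
  have : latticeVec (0 : Fin d → ℤ) = 0 := by ext j; simp
  rwa [this, sub_zero]⟩

theorem add_mem_periodization {S : Set (Space d)} {x : Space d} (n : Fin d → ℤ) :
    x + latticeVec n ∈ periodization S ↔ x ∈ periodization S := by
  constructor
  · rintro ⟨m, hm⟩
    refine ⟨m - n, ?_⟩
    rw [sub_eq_add_neg m n, latticeVec_add, latticeVec_neg]
    convert hm using 1
    abel
  · rintro ⟨m, hm⟩
    refine ⟨m + n, ?_⟩
    rw [latticeVec_add]
    convert hm using 1
    abel

theorem mem_of_mem_periodization {S : Set (Space d)} (hS : S ⊆ cell d) {x : Space d}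
    (hx : x ∈ cell d) (h : x ∈ periodization S) : x ∈ S := by
  obtain ⟨n, hn⟩ := h
  have h0 : latticeVec (0 : Fin d → ℤ) = 0 := by ext j; simp
  have h1 := eq_floorVec (hS hn)
  have h2 := eq_floorVec (x := x) (n := 0) (by rwa [h0, sub_zero])
  rw [h1, ← h2, h0, sub_zero] at hn
  exact hn

theorem exists_finset_floorVec {B : Set (Space d)} (hB : Bornology.IsBounded B) :
    ∃ s : Finset (Fin d → ℤ), ∀ x ∈ B, floorVec x ∈ s := by
  obtain ⟨R, hR⟩ := hB.exists_norm_le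
  refine ⟨Fintype.piFinset fun _ => Finset.Icc ⌊-R⌋ ⌊R⌋, fun x hx => ?_⟩
  rw [Fintype.mem_piFinset]
  intro j
  have h1 : |x j| ≤ R := (PiLp.norm_apply_le x j).trans (hR x hx)
  rw [abs_le] at h1
  exact Finset.mem_Icc.2 ⟨Int.floor_le_floor h1.1, Int.floor_le_floor h1.2⟩

theorem IsPeriodic.setLIntegral_translate {f : Space d → ℝ≥0∞} (hf : IsPeriodic f)
    (A : Set (Space d)) (n : Fin d → ℤ) :
    ∫⁻ x in (fun x => x - latticeVec n) ⁻¹' A, f x = ∫⁻ x in A, f x := by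
  have := (measurePreserving_sub_right (volume : Measure (Space d))
    (latticeVec n)).setLIntegral_comp_preimage_emb
    (measurableEmbedding_subRight (latticeVec n)) f A
  simpa only [hf.sub] using this

theorem lintegral_biUnion_finset_le {α ι : Type*} [MeasurableSpace α] (μ : Measure α)
    (s : Finset ι) (t : ι → Set α) (f : α → ℝ≥0∞) :
    ∫⁻ x in ⋃ i ∈ s, t i, f x ∂μ ≤ ∑ i ∈ s, ∫⁻ x in t i, f x ∂μ := by
  classical
  induction s using Finset.induction_on with
  | empty => simp
  | insert a s ha ih =>
    rw [Finset.set_biUnion_insert, Finset.sum_insert ha]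
    exact (lintegral_union_le f _ _).trans (add_le_add_right ih _)

/-- A bounded set meets finitely many cells, so that integrals of nonnegative periodic functions
over it are controlled by the integral over one cell. -/
theorem exists_lintegral_le_of_isBounded {B : Set (Space d)} (hB : Bornology.IsBounded B) :
    ∃ m : ℕ, ∀ (A : Set (Space d)), A ⊆ cell d → ∀ f : Space d → ℝ≥0∞, IsPeriodic f →
      ∫⁻ x in B ∩ periodization A, f x ≤ m * ∫⁻ x in A, f x := by
  obtain ⟨s, hs⟩ := exists_finset_floorVec hB
  refine ⟨s.card, fun A hA f hf => ?_⟩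
  have hsub : B ∩ periodization A ⊆ ⋃ n ∈ s, (fun x => x - latticeVec n) ⁻¹' A := by
    rintro x ⟨hxB, n, hn⟩
    simp only [Set.mem_iUnion, Set.mem_preimage]
    exact ⟨n, by rw [eq_floorVec (hA hn)]; exact hs x hxB, hn⟩
  calc ∫⁻ x in B ∩ periodization A, f x
      ≤ ∫⁻ x in ⋃ n ∈ s, (fun x => x - latticeVec n) ⁻¹' A, f x := lintegral_mono_set hsub
    _ ≤ ∑ n ∈ s, ∫⁻ x in (fun x => x - latticeVec n) ⁻¹' A, f x :=
        lintegral_biUnion_finset_le _ _ _ _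
    _ = s.card * ∫⁻ x in A, f x := by
        simp only [hf.setLIntegral_translate, Finset.sum_const, nsmul_eq_mul]

theorem isBounded_cell : Bornology.IsBounded (cell d) := by
  refine (Metric.isBounded_closedBall (x := (0 : Space d)) (r := Real.sqrt d)).subset ?_
  intro x hx
  rw [mem_closedBall_zero_iff, EuclideanSpace.norm_eq]
  refine Real.sqrt_le_sqrt ?_
  calc ∑ i, ‖x i‖ ^ 2 ≤ ∑ _i : Fin d, (1 : ℝ) := by
        refine Finset.sum_le_sum fun i _ => ?_
        have := hx i
        rw [Real.norm_eq_abs, sq_abs]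
        nlinarith [this.1, this.2]
    _ = d := by simp

/-! ### Geometry of the two components -/

/-- Since ψ is constant along e, translates of the graph by different multiples of e are disjoint. A
measurable set with infinitely many disjoint translates by bounded vectors is null. -/
theorem volume_graph_eq_zero {e : Space d} (he : ‖e‖ = 1) {ψ : Space d → ℝ} (hψ : Continuous ψ)
    (hinv : ∀ (y : Space d) (t : ℝ), ψ (y + t • e) = ψ y) :
    volume {y : Space d | ψ y = inner ℝ e y} = 0 := by
  refine Measure.addHaar_eq_zero_of_disjoint_translates volume
    (fun n : ℕ => (1 / ((n : ℝ) + 1)) • e) ?_ ?_ ?_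
  · refine (Metric.isBounded_closedBall (x := (0 : Space d)) (r := 1)).subset ?_
    rintro _ ⟨n, rfl⟩
    rw [mem_closedBall_zero_iff, norm_smul, he, mul_one, Real.norm_of_nonneg (by positivity)]
    rw [div_le_one (by positivity)]
    linarith [(Nat.cast_nonneg n : (0 : ℝ) ≤ n)]
  · intro m n hmn
    rw [Function.onFun, Set.disjoint_left]
    rintro z ⟨_, rfl, y, hy, rfl⟩ ⟨_, rfl, y', hy', hyy⟩
    have hyy : (1 / ((n : ℝ) + 1)) • e + y' = (1 / ((m : ℝ) + 1)) • e + y := hyy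
    apply hmn
    have hee : inner ℝ e e = (1 : ℝ) := by rw [real_inner_self_eq_norm_sq, he]; norm_num
    have h1 := congrArg ψ hyy
    have h2 := congrArg (fun z => inner ℝ e z) hyy
    rw [add_comm, hinv, add_comm, hinv] at h1
    simp only [inner_add_right, inner_smul_right, hee, mul_one] at h2
    rw [Set.mem_ofPred_eq] at hy hy'
    have h3 : 1 / ((n : ℝ) + 1) = 1 / ((m : ℝ) + 1) := by linarith
    have h4 : ((n : ℝ) + 1) = ((m : ℝ) + 1) := by
      rw [div_eq_div_iff (by positivity) (by positivity)] at h3; linarith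
    exact_mod_cast (by linarith : (m : ℝ) = n)
  · exact (isClosed_eq hψ (by fun_prop)).measurableSet

/-- A set with Lipschitz boundary has a null boundary. -/
theorem HasLipschitzBoundary.volume_frontier {Ω : Set (Space d)} (h : HasLipschitzBoundary Ω) :
    volume (frontier Ω) = 0 := by
  refine measure_null_of_locally_null _ fun x hx => ?_
  obtain ⟨e, ψ, K, r, he, hψ, hinv, hr, hΩ⟩ := h x hx
  refine ⟨Metric.ball x r ∩ frontier Ω,
    Filter.inter_mem (mem_nhdsWithin_of_mem_nhds (Metric.ball_mem_nhds x hr)) self_mem_nhdsWithin, ?_⟩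
  refine measure_mono_null ?_ (volume_graph_eq_zero he hψ.continuous hinv)
  rintro y ⟨hyb, hyf⟩
  have hψc := hψ.continuous
  have hic : Continuous fun y : Space d => inner ℝ e y := by fun_prop
  -- A frontier point off the graph is impossible: strictly above the graph it would be interior to
  -- Ω, strictly below it would have a neighbourhood missing Ω.
  by_contra hne
  rcases lt_or_gt_of_ne hne with hlt | hgt
  · refine hyf.2 (mem_interior.2 ⟨Metric.ball x r ∩ {y | ψ y < inner ℝ e y}, ?_,
      Metric.isOpen_ball.inter (isOpen_lt hψc hic), hyb, hlt⟩)
    exact fun z hz => (hΩ z hz.1).2 hz.2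
  · obtain ⟨z, ⟨hzb, hzlt⟩, hzΩ⟩ := mem_closure_iff.1 hyf.1
      (Metric.ball x r ∩ {y | inner ℝ e y < ψ y})
      (Metric.isOpen_ball.inter (isOpen_lt hic hψc)) ⟨hyb, hgt⟩
    exact lt_asymm hzlt ((hΩ z hzb).1 hzΩ)

theorem isOpen_openCube : IsOpen (openCube d) := by
  have : openCube d = ⋂ j, (fun x : Space d => x j) ⁻¹' Set.Ioo (0 : ℝ) 1 := by
    ext x; simp [openCube]
  rw [this]
  exact isOpen_iInter_of_finite fun j => isOpen_Ioo.preimage (by fun_prop)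

theorem openCube_subset_cell : openCube d ⊆ cell d := fun _ hx j => Set.Ioo_subset_Ico_self (hx j)

theorem volume_cell_diff_openCube : volume (cell d \ openCube d) = 0 := by
  refine measure_mono_null (t := ⋃ j : Fin d, {x : Space d | x j = 0}) ?_ ?_
  · rintro x ⟨hx, hx'⟩
    simp only [openCube, Set.mem_ofPred_eq, not_forall] at hx'
    obtain ⟨j, hj⟩ := hx'
    refine Set.mem_iUnion.2 ⟨j, ?_⟩
    by_contra h0
    exact hj ⟨lt_of_le_of_ne (hx j).1 (Ne.symm h0), (hx j).2⟩
  · refine measure_iUnion_null fun j => ?_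
    have := Measure.addHaar_submodule (volume : Measure (Space d))
      (LinearMap.ker (EuclideanSpace.proj j : Space d →L[ℝ] ℝ).toLinearMap) ?_
    · convert this using 2
      ext x; simp
    · intro h
      have h1 : (EuclideanSpace.single j (1 : ℝ)) ∈
          LinearMap.ker (EuclideanSpace.proj j : Space d →L[ℝ] ℝ).toLinearMap := by
        rw [h]; trivial
      simp at h1

variable {Q₁ : Set (Space d)}

theorem isOpen_softPart : IsOpen (softPart Q₁) := isOpen_interior

theorem softPart_subset_cell : softPart Q₁ ⊆ cell d := interior_subset.trans Set.sdiff_subset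

theorem isBounded_softPart : Bornology.IsBounded (softPart Q₁) :=
  isBounded_cell.subset softPart_subset_cell

namespace IsStiffPart

theorem notMem_of_mem_softPart (hQ : IsStiffPart Q₁) {x : Space d} (hx : x ∈ softPart Q₁) :
    x ∉ periodization Q₁ := fun h =>
  (interior_subset hx).2 (mem_of_mem_periodization hQ.subset_cell (softPart_subset_cell hx) h)

theorem subset_softPart {U : Set (Space d)} (hU : IsOpen U) (hUc : U ⊆ openCube d)
    (hd : ∀ x ∈ U, x ∉ periodization Q₁) : U ⊆ softPart Q₁ :=
  interior_maximal (fun x hx => ⟨openCube_subset_cell (hUc hx),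
    fun h => hd x hx (mem_periodization_of_mem h)⟩) hU

/-- If x were outside the closure of the stiff set, a neighbourhood of x in the open cube would miss
that set and so, by maximality of the interior, lie in the soft part. -/
theorem mem_frontier_of_notMem (_hQ : IsStiffPart Q₁) {x : Space d} (hx : x ∈ openCube d)
    (h1 : x ∉ periodization Q₁) (h0 : x ∉ softPart Q₁) : x ∈ frontier (periodization Q₁) := by
  refine ⟨?_, fun h => h1 (interior_subset h)⟩
  by_contra hc
  refine h0 (subset_softPart (U := openCube d ∩ (closure (periodization Q₁))ᶜ)
    (isOpen_openCube.inter isClosed_closure.isOpen_compl) Set.inter_subset_left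
    (fun y hy hy1 => hy.2 (subset_closure hy1)) ⟨hx, hc⟩)

theorem eq_inter (hQ : IsStiffPart Q₁) : Q₁ = cell d ∩ periodization Q₁ :=
  Set.Subset.antisymm (fun _ hx => ⟨hQ.subset_cell hx, mem_periodization_of_mem hx⟩)
    fun _ hx => mem_of_mem_periodization hQ.subset_cell hx.1 hx.2

theorem measurableSet (hQ : IsStiffPart Q₁) : MeasurableSet Q₁ := by
  rw [hQ.eq_inter]
  exact (measurableSet_cell d).inter hQ.isOpen.measurableSet

/-- What is left out lies in the faces of the cell or in the Lipschitz boundary, both of which are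
null. -/
theorem ae_mem (hQ : IsStiffPart Q₁) :
    ∀ᵐ x ∂(cellMeasure d), x ∈ Q₁ ∨ x ∈ softPart Q₁ := by
  rw [ae_restrict_iff' (measurableSet_cell d)]
  have h1 := measure_eq_zero_iff_ae_notMem.1 hQ.lipschitz.volume_frontier
  have h2 := measure_eq_zero_iff_ae_notMem.1 (volume_cell_diff_openCube (d := d))
  filter_upwards [h1, h2] with x hx1 hx2 hx
  by_contra! hcon
  have hxo : x ∈ openCube d := by
    by_contra h; exact hx2 ⟨hx, h⟩
  exact hx1 (hQ.mem_frontier_of_notMem hxo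
    (fun h => hcon.1 (mem_of_mem_periodization hQ.subset_cell hx h)) hcon.2)

/-- The inclusion of the closure of Q₀ in the open cube rules out boundary points of Q₀ on the faces
of the cell, so every boundary point has a Lipschitz chart. -/
theorem frontier_softPart_subset (hQ : IsStiffPart Q₁) :
    closure (softPart Q₁) \ softPart Q₁ ⊆ frontier (periodization Q₁) := by
  rintro x ⟨hx, hx0⟩
  refine hQ.mem_frontier_of_notMem (hQ.closure_softPart hx) (fun h => ?_) hx0
  obtain ⟨y, hy1, hy0⟩ := mem_closure_iff.1 hx _ hQ.isOpen h
  exact hQ.notMem_of_mem_softPart hy0 hy1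

theorem volume_frontier_softPart (hQ : IsStiffPart Q₁) : volume (frontier (softPart Q₁)) = 0 := by
  rw [isOpen_softPart.frontier_eq]
  exact measure_mono_null hQ.frontier_softPart_subset hQ.lipschitz.volume_frontier

/-- If Q₁ were null, so would be the part of its periodization in any ball, but that part is open
and nonempty for a ball centred at a stiff point. -/
theorem volume_pos (hQ : IsStiffPart Q₁) : 0 < volume Q₁ := by
  rw [pos_iff_ne_zero]
  intro h0
  obtain ⟨x, hx⟩ := hQ.isConnected.nonempty
  obtain ⟨m, hm⟩ := exists_lintegral_le_of_isBounded (Metric.isBounded_ball (x := x) (r := 1))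
  have h1 := hm Q₁ hQ.subset_cell (fun _ => 1) fun _ _ => rfl
  simp only [lintegral_const, one_mul, Measure.restrict_apply MeasurableSet.univ, Set.univ_inter,
    h0, mul_zero, nonpos_iff_eq_zero] at h1
  exact ((Metric.isOpen_ball.inter hQ.isOpen).measure_pos volume
    ⟨x, Metric.mem_ball_self one_pos, hx⟩).ne' h1

theorem volume_lt_top (hQ : IsStiffPart Q₁) : volume Q₁ < ⊤ :=
  (isBounded_cell.subset hQ.subset_cell).measure_lt_top

theorem isCompact_closure_softPart (_hQ : IsStiffPart Q₁) : IsCompact (closure (softPart Q₁)) :=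
  isBounded_softPart.isCompact_closure

end IsStiffPart

/-! ### Poincaré inequality on the stiff component -/

theorem sq_add_le_two_mul (a b : ℝ≥0∞) : (a + b) ^ 2 ≤ 2 * (a ^ 2 + b ^ 2) := by
  have := ENNReal.rpow_add_le_mul_rpow_add_rpow a b (p := 2) (by norm_num)
  norm_num at this
  exact_mod_cast this

theorem enorm_sub_sq_le (a b c : ℂ) :
    ‖a - c‖ₑ ^ 2 ≤ 2 * (‖a - b‖ₑ ^ 2 + ‖b - c‖ₑ ^ 2) := by
  refine le_trans ?_ (sq_add_le_two_mul _ _)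
  gcongr
  calc ‖a - c‖ₑ = ‖(a - b) + (b - c)‖ₑ := by congr 1; abel
    _ ≤ _ := enorm_add_le _ _

/-- Jensen's inequality for the square. -/
theorem sq_lintegral_le {α : Type*} [MeasurableSpace α] (μ : Measure α) [IsProbabilityMeasure μ]
    {f : α → ℝ≥0∞} (hf : AEMeasurable f μ) : (∫⁻ x, f x ∂μ) ^ 2 ≤ ∫⁻ x, f x ^ 2 ∂μ := by
  have h := ENNReal.lintegral_mul_le_Lp_mul_Lq μ Real.HolderConjugate.two_two hf
    (aemeasurable_const (b := (1 : ℝ≥0∞)))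
  simp only [Pi.mul_apply, mul_one, ENNReal.one_rpow, lintegral_const, measure_univ] at h
  calc (∫⁻ x, f x ∂μ) ^ 2 ≤ ((∫⁻ x, f x ^ (2 : ℝ) ∂μ) ^ (1 / 2 : ℝ)) ^ 2 := by
        gcongr
    _ = ∫⁻ x, f x ^ (2 : ℝ) ∂μ := by
        rw [← ENNReal.rpow_natCast, ← ENNReal.rpow_mul]; norm_num
    _ = _ := by simp

theorem enorm_sub_sq_le_lintegral_segment {W : Space d → ℂ} (hW : ContDiff ℝ 1 W)
    (x h : Space d) :
    ‖W (x + h) - W x‖ₑ ^ 2 ≤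
      ‖h‖ₑ ^ 2 * ∫⁻ t in Set.Ioc (0 : ℝ) 1, ‖fderiv ℝ W (x + t • h)‖ₑ ^ 2 := by
  have hc : Continuous fun t : ℝ => fderiv ℝ W (x + t • h) :=
    (hW.continuous_fderiv one_ne_zero).comp (by fun_prop)
  have hder : ∀ t : ℝ, HasDerivAt (fun t : ℝ => W (x + t • h)) (fderiv ℝ W (x + t • h) h) t := by
    intro t
    have h1 : HasDerivAt (fun t : ℝ => x + t • h) h t := by
      simpa using ((hasDerivAt_id t).smul_const h).const_add x
    exact ((hW.differentiable one_ne_zero) _).hasFDerivAt.comp_hasDerivAt t h1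
  have hFTC : W (x + h) - W x = ∫ t in (0 : ℝ)..1, fderiv ℝ W (x + t • h) h := by
    rw [intervalIntegral.integral_eq_sub_of_hasDerivAt (fun t _ => hder t)
      (Continuous.intervalIntegrable (by fun_prop) _ _)]
    simp
  have : IsProbabilityMeasure (volume.restrict (Set.Ioc (0 : ℝ) 1)) := ⟨by simp⟩
  rw [hFTC, intervalIntegral.integral_of_le zero_le_one]
  calc ‖∫ t in Set.Ioc (0 : ℝ) 1, fderiv ℝ W (x + t • h) h‖ₑ ^ 2
      ≤ (∫⁻ t in Set.Ioc (0 : ℝ) 1, ‖fderiv ℝ W (x + t • h) h‖ₑ) ^ 2 := by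
        gcongr; exact enorm_integral_le_lintegral_enorm _
    _ ≤ ∫⁻ t in Set.Ioc (0 : ℝ) 1, ‖fderiv ℝ W (x + t • h) h‖ₑ ^ 2 :=
        sq_lintegral_le _ (Continuous.aemeasurable (by fun_prop))
    _ ≤ ∫⁻ t in Set.Ioc (0 : ℝ) 1, ‖h‖ₑ ^ 2 * ‖fderiv ℝ W (x + t • h)‖ₑ ^ 2 := by
        refine lintegral_mono fun t => ?_
        rw [mul_comm, ← mul_pow]
        gcongr
        exact ContinuousLinearMap.le_opENorm _ _
    _ = _ := lintegral_const_mul' _ _ (by simp)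

/-- For fixed t the translation by th preserves the measure and carries A into D. After Tonelli,
each t therefore contributes at most the gradient integral over D. -/
theorem lintegral_translate_sub_sq_le {W : Space d → ℂ} (hW : ContDiff ℝ 1 W) (h : Space d)
    {A D : Set (Space d)} (hAD : ∀ x ∈ A, ∀ t ∈ Set.Ioc (0 : ℝ) 1, x + t • h ∈ D) :
    ∫⁻ x in A, ‖W (x + h) - W x‖ₑ ^ 2 ≤ ‖h‖ₑ ^ 2 * ∫⁻ x in D, ‖fderiv ℝ W x‖ₑ ^ 2 := by
  have hc : Continuous fun p : Space d × ℝ => ‖fderiv ℝ W (p.1 + p.2 • h)‖ₑ ^ 2 := by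
    have := hW.continuous_fderiv one_ne_zero
    fun_prop
  calc ∫⁻ x in A, ‖W (x + h) - W x‖ₑ ^ 2
      ≤ ∫⁻ x in A, ‖h‖ₑ ^ 2 * ∫⁻ t in Set.Ioc (0 : ℝ) 1, ‖fderiv ℝ W (x + t • h)‖ₑ ^ 2 :=
        lintegral_mono fun x => enorm_sub_sq_le_lintegral_segment hW x h
    _ = ‖h‖ₑ ^ 2 * ∫⁻ t in Set.Ioc (0 : ℝ) 1, ∫⁻ x in A, ‖fderiv ℝ W (x + t • h)‖ₑ ^ 2 := by
        rw [lintegral_const_mul' _ _ (by simp), lintegral_lintegral_swap hc.aemeasurable]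
    _ ≤ ‖h‖ₑ ^ 2 * ∫⁻ _t in Set.Ioc (0 : ℝ) 1, ∫⁻ x in D, ‖fderiv ℝ W x‖ₑ ^ 2 := by
        refine mul_le_mul_right ?_ _
        refine setLIntegral_mono' (measurableSet_Ioc (a := (0 : ℝ)) (b := 1)) fun t ht => ?_
        rw [← (measurePreserving_add_right (volume : Measure (Space d))
          (t • h)).setLIntegral_comp_preimage_emb (measurableEmbedding_addRight (t • h))
          (fun x => ‖fderiv ℝ W x‖ₑ ^ 2) D]
        exact lintegral_mono_set fun x hx => hAD x hx t ht
    _ = _ := by simp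

/-- The double integral of |W(x) - W(y)|² over the ball is estimated through increments of length
less than 2ρ. The segments involved start in the ball of radius ρ, hence the radius 3ρ for the
gradient. -/
theorem exists_lintegral_ball_sub_sq_le (z : Space d) {ρ : ℝ} (hρ : 0 < ρ) :
    ∃ C : ℝ≥0∞, C ≠ ⊤ ∧ ∀ W : Space d → ℂ, ContDiff ℝ 1 W → ∃ b : ℂ,
      ∫⁻ x in Metric.ball z ρ, ‖W x - b‖ₑ ^ 2 ≤
        C * ∫⁻ x in Metric.ball z (3 * ρ), ‖fderiv ℝ W x‖ₑ ^ 2 := by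
  have hpos : volume (Metric.ball z ρ) ≠ 0 := (Metric.measure_ball_pos volume z hρ).ne'
  have htop : volume (Metric.ball z ρ) ≠ ⊤ := Metric.isBounded_ball.measure_lt_top.ne
  set v := volume (Metric.ball (0 : Space d) (2 * ρ)) with hv
  have hvtop : v ≠ ⊤ := Metric.isBounded_ball.measure_lt_top.ne
  refine ⟨(ENNReal.ofReal (2 * ρ) ^ 2 * v) / volume (Metric.ball z ρ),
    (ENNReal.div_lt_top (by finiteness) hpos).ne, fun W hW => ?_⟩
  have hWc := hW.continuous
  have hmeas : AEMeasurable (fun y => ∫⁻ x in Metric.ball z ρ, ‖W x - W y‖ₑ ^ 2)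
      (volume.restrict (Metric.ball z ρ)) := by
    refine Measurable.aemeasurable ?_
    refine Measurable.lintegral_prod_right' (f := fun p : Space d × Space d =>
      ‖W p.2 - W p.1‖ₑ ^ 2) ?_
    exact Continuous.measurable (by fun_prop)
  -- Some y does no worse than the average, and b = W y serves as the constant.
  obtain ⟨y, -, hy⟩ := exists_le_setLAverage hpos htop hmeas
  refine ⟨W y, hy.trans ?_⟩
  rw [setLAverage_eq, ENNReal.mul_div_right_comm.symm]
  gcongr
  set J := ∫⁻ x in Metric.ball z (3 * ρ), ‖fderiv ℝ W x‖ₑ ^ 2 with hJ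
  have hc : Continuous fun p : Space d × Space d => ‖W (p.1 + p.2) - W p.1‖ₑ ^ 2 := by fun_prop
  calc ∫⁻ y in Metric.ball z ρ, ∫⁻ x in Metric.ball z ρ, ‖W x - W y‖ₑ ^ 2
      ≤ ∫⁻ y in Metric.ball z ρ, ∫⁻ h in Metric.ball 0 (2 * ρ), ‖W (y + h) - W y‖ₑ ^ 2 := by
        refine setLIntegral_mono' Metric.isOpen_ball.measurableSet fun y hy => ?_
        rw [← (measurePreserving_add_left (volume : Measure (Space d))
          y).setLIntegral_comp_preimage_emb (measurableEmbedding_addLeft y)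
          (fun x => ‖W x - W y‖ₑ ^ 2) (Metric.ball z ρ)]
        refine lintegral_mono_set fun h hh => ?_
        simp only [Set.mem_preimage, Metric.mem_ball, dist_eq_norm] at hh hy ⊢
        calc ‖h - 0‖ = ‖(y + h - z) - (y - z)‖ := by congr 1; abel
          _ ≤ ‖y + h - z‖ + ‖y - z‖ := norm_sub_le _ _
          _ < 2 * ρ := by linarith
    _ = ∫⁻ h in Metric.ball 0 (2 * ρ), ∫⁻ y in Metric.ball z ρ, ‖W (y + h) - W y‖ₑ ^ 2 :=
        lintegral_lintegral_swap hc.aemeasurable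
    _ ≤ ∫⁻ _h in Metric.ball (0 : Space d) (2 * ρ), ENNReal.ofReal (2 * ρ) ^ 2 * J := by
        refine setLIntegral_mono' Metric.isOpen_ball.measurableSet fun h hh => ?_
        have hh : ‖h‖ < 2 * ρ := by simpa using hh
        refine (lintegral_translate_sub_sq_le hW h (D := Metric.ball z (3 * ρ)) ?_).trans ?_
        · intro x hx t ht
          rw [Metric.mem_ball, dist_eq_norm] at hx ⊢
          calc ‖x + t • h - z‖ = ‖(x - z) + t • h‖ := by congr 1; abel
            _ ≤ ‖x - z‖ + ‖t • h‖ := norm_add_le _ _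
            _ ≤ ‖x - z‖ + 1 * ‖h‖ := by
                rw [norm_smul, Real.norm_of_nonneg ht.1.le]
                gcongr
                exact ht.2
            _ < 3 * ρ := by linarith
        · gcongr
          rw [← ofReal_norm]
          exact ENNReal.ofReal_le_ofReal hh.le
    _ = ENNReal.ofReal (2 * ρ) ^ 2 * v * J := by
        rw [setLIntegral_const]; ring

/-- `W` is of class `C¹` and `|∇W|` is periodic. -/
structure HasPeriodicGradNorm (W : Space d → ℂ) : Prop where
  contDiff : ContDiff ℝ 1 W
  periodic : IsPeriodic fun x => ‖fderiv ℝ W x‖ₑ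

/-- The part of `S` in the stiff component supports a Poincaré inequality with the gradient
measured on one cell. -/
def IsPoincareSet (Q₁ S : Set (Space d)) : Prop :=
  ∃ C : ℝ≥0∞, C ≠ ⊤ ∧ ∀ W : Space d → ℂ, HasPeriodicGradNorm W → ∃ b : ℂ,
    ∫⁻ x in S ∩ periodization Q₁, ‖W x - b‖ₑ ^ 2 ≤ C * ∫⁻ x in Q₁, ‖fderiv ℝ W x‖ₑ ^ 2


theorem IsPoincareSet.mono {S T : Set (Space d)} (h : IsPoincareSet Q₁ T)
    (hST : S ∩ periodization Q₁ ⊆ T) : IsPoincareSet Q₁ S := by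
  obtain ⟨C, hC, h⟩ := h
  refine ⟨C, hC, fun _ hW => ?_⟩
  obtain ⟨b, hb⟩ := h _ hW
  refine ⟨b, le_trans (lintegral_mono_set fun x hx => ?_) hb⟩
  exact ⟨hST hx, hx.2⟩

theorem setLIntegral_const_sub_sq_le {μ : Measure (Space d)} {W : Space d → ℂ} (b c : ℂ) :
    ∫⁻ x, ‖W x - c‖ₑ ^ 2 ∂μ ≤ 2 * (∫⁻ x, ‖W x - b‖ₑ ^ 2 ∂μ) + 2 * (‖b - c‖ₑ ^ 2 * μ Set.univ) := by
  calc ∫⁻ x, ‖W x - c‖ₑ ^ 2 ∂μ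
      ≤ ∫⁻ x, 2 * ‖W x - b‖ₑ ^ 2 + 2 * ‖b - c‖ₑ ^ 2 ∂μ := by
        refine lintegral_mono fun x => ?_
        rw [← mul_add]
        exact enorm_sub_sq_le _ _ _
    _ = _ := by
        rw [lintegral_add_right _ measurable_const, lintegral_const_mul' _ _ (by simp),
          lintegral_const, mul_assoc]

/-- Both constants approximate W on the overlap, which is open and nonempty and so has positive
measure. Their distance is thus controlled by the gradient, and the constant of S can be used on T
as well. -/
theorem IsPoincareSet.union {S T : Set (Space d)} (hS : IsPoincareSet Q₁ S)
    (hT : IsPoincareSet Q₁ T) (hSo : IsOpen S) (hTo : IsOpen T) (hTb : Bornology.IsBounded T)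
    (hΩ : IsOpen (periodization Q₁)) (hne : (S ∩ T ∩ periodization Q₁).Nonempty) :
    IsPoincareSet Q₁ (S ∪ T) := by
  obtain ⟨C, hC, hS⟩ := hS
  obtain ⟨D, hD, hT⟩ := hT
  set Ω := periodization Q₁
  set v := volume (S ∩ T ∩ Ω)
  have hv0 : v ≠ 0 := (((hSo.inter hTo).inter hΩ).measure_pos volume hne).ne'
  have hvt : v ≠ ⊤ := (hTb.subset (fun x hx => hx.1.2 : S ∩ T ∩ Ω ⊆ T)).measure_lt_top.ne
  have hwt : volume (T ∩ Ω) ≠ ⊤ := (hTb.subset Set.inter_subset_left).measure_lt_top.ne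
  set E := 2 * (C + D) / v with hE
  have hEt : E ≠ ⊤ := (ENNReal.div_lt_top (by finiteness) hv0).ne
  refine ⟨C + (2 * D + 2 * (E * volume (T ∩ Ω))), by finiteness, fun W hW => ?_⟩
  obtain ⟨b, hb⟩ := hS W hW
  obtain ⟨c, hc⟩ := hT W hW
  set I := ∫⁻ x in Q₁, ‖fderiv ℝ W x‖ₑ ^ 2
  have hWc := hW.contDiff.continuous
  have hbc : ‖c - b‖ₑ ^ 2 ≤ E * I := by
    rw [hE, ENNReal.mul_div_right_comm.symm, ENNReal.le_div_iff_mul_le (.inl hv0) (.inl hvt)]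
    calc ‖c - b‖ₑ ^ 2 * v = ∫⁻ _x in S ∩ T ∩ Ω, ‖c - b‖ₑ ^ 2 := by rw [setLIntegral_const]
      _ ≤ ∫⁻ x in S ∩ T ∩ Ω, 2 * (‖W x - b‖ₑ ^ 2 + ‖W x - c‖ₑ ^ 2) := by
          refine lintegral_mono fun x => ?_
          refine (enorm_sub_sq_le c (W x) b).trans (le_of_eq ?_)
          rw [enorm_sub_rev c, add_comm]
      _ = 2 * (∫⁻ x in S ∩ T ∩ Ω, ‖W x - b‖ₑ ^ 2) + 2 * (∫⁻ x in S ∩ T ∩ Ω, ‖W x - c‖ₑ ^ 2) := by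
          rw [lintegral_const_mul' _ _ (by simp), lintegral_add_left (by fun_prop), mul_add]
      _ ≤ 2 * (C * I) + 2 * (D * I) := by
          gcongr
          · refine le_trans (lintegral_mono_set fun x hx => ?_) hb
            exact ⟨hx.1.1, hx.2⟩
          · refine le_trans (lintegral_mono_set fun x hx => ?_) hc
            exact ⟨hx.1.2, hx.2⟩
      _ = 2 * (C + D) * I := by ring
  refine ⟨b, ?_⟩
  rw [Set.union_inter_distrib_right]
  refine (lintegral_union_le _ _ _).trans ?_
  rw [add_mul]
  gcongr
  refine (setLIntegral_const_sub_sq_le c b).trans ?_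
  rw [Measure.restrict_apply_univ, add_mul]
  calc 2 * (∫⁻ x in T ∩ Ω, ‖W x - c‖ₑ ^ 2) + 2 * (‖c - b‖ₑ ^ 2 * volume (T ∩ Ω))
      ≤ 2 * (D * I) + 2 * (E * I * volume (T ∩ Ω)) := by gcongr
    _ = _ := by ring

theorem lintegral_grad_le_of_isBounded (hQ : IsStiffPart Q₁) {B : Set (Space d)}
    (hB : Bornology.IsBounded B) :
    ∃ m : ℕ, ∀ W : Space d → ℂ, HasPeriodicGradNorm W →
      ∫⁻ x in B ∩ periodization Q₁, ‖fderiv ℝ W x‖ₑ ^ 2 ≤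
        m * ∫⁻ x in Q₁, ‖fderiv ℝ W x‖ₑ ^ 2 := by
  obtain ⟨m, hm⟩ := exists_lintegral_le_of_isBounded hB
  exact ⟨m, fun _ hW => hm Q₁ hQ.subset_cell _ (hW.periodic.comp (· ^ 2))⟩

theorem isPoincareSet_ball_interior (hQ : IsStiffPart Q₁) {z : Space d} {ρ : ℝ} (hρ : 0 < ρ)
    (hsub : Metric.ball z (3 * ρ) ⊆ periodization Q₁) : IsPoincareSet Q₁ (Metric.ball z ρ) := by
  obtain ⟨C, hC, h⟩ := exists_lintegral_ball_sub_sq_le z hρ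
  obtain ⟨m, hm⟩ := lintegral_grad_le_of_isBounded hQ (Metric.isBounded_ball (x := z) (r := 3 * ρ))
  refine ⟨C * m, by finiteness, fun W hW => ?_⟩
  obtain ⟨b, hb⟩ := h W hW.contDiff
  refine ⟨b, (lintegral_mono_set Set.inter_subset_left).trans (hb.trans ?_)⟩
  rw [mul_assoc]
  gcongr
  have := hm W hW
  rwa [Set.inter_eq_left.2 hsub] at this

theorem eq_inner_of_mem_frontier {Ω : Set (Space d)} {e x : Space d} {ψ : Space d → ℝ} {r : ℝ}
    (hψ : Continuous ψ) (hr : 0 < r) (hx : x ∈ frontier Ω)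
    (hΩ : ∀ y ∈ Metric.ball x r, y ∈ Ω ↔ ψ y < inner ℝ e y) : ψ x = inner ℝ e x := by
  have hic : Continuous fun y : Space d => inner ℝ e y := by fun_prop
  have hxb := Metric.mem_ball_self (x := x) hr
  by_contra hne
  rcases lt_or_gt_of_ne hne with hlt | hgt
  · refine hx.2 (mem_interior.2 ⟨Metric.ball x r ∩ {y | ψ y < inner ℝ e y}, ?_,
      Metric.isOpen_ball.inter (isOpen_lt hψ hic), hxb, hlt⟩)
    exact fun z hz => (hΩ z hz.1).2 hz.2
  · obtain ⟨z, ⟨hzb, hzlt⟩, hzΩ⟩ := mem_closure_iff.1 hx.1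
      (Metric.ball x r ∩ {y | inner ℝ e y < ψ y})
      (Metric.isOpen_ball.inter (isOpen_lt hic hψ)) ⟨hxb, hgt⟩
    exact lt_asymm hzlt ((hΩ z hzb).1 hzΩ)

/-- Moving up by h = (r/2)e keeps points of Ω inside Ω, because ψ is constant along e. Thus W near x
is compared with its values on a ball around x + h lying well above the graph, where the interior
inequality applies. -/
theorem exists_isPoincareSet_ball_frontier (hQ : IsStiffPart Q₁) {x : Space d}
    (hx : x ∈ frontier (periodization Q₁)) : ∃ ρ > 0, IsPoincareSet Q₁ (Metric.ball x ρ) := by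
  obtain ⟨e, ψ, K, r, he, hψ, hinv, hr, hΩ⟩ := hQ.lipschitz x hx
  set Ω := periodization Q₁
  have hx0 : ψ x = inner ℝ e x := eq_inner_of_mem_frontier hψ.continuous hr hx hΩ
  have hee : inner ℝ e e = (1 : ℝ) := by rw [real_inner_self_eq_norm_sq, he]; norm_num
  -- Over a ball of radius 3ρ the function ⟨e, ·⟩ - ψ varies by at most 3ρ(1 + K) = r/4, less than
  -- the height r/2 of x + h above the graph.
  set ρ := r / (12 * (1 + K)) with hρ
  have hK : (0 : ℝ) < 1 + K := by positivity
  have hρ0 : 0 < ρ := by positivity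
  have hρK : 3 * ρ * (1 + K) = r / 4 := by rw [hρ]; field_simp; norm_num
  have hρ3 : 3 * ρ ≤ r / 4 := by
    rw [← hρK]; nlinarith [K.coe_nonneg, mul_nonneg hρ0.le K.coe_nonneg]
  set h : Space d := (r / 2) • e with hh
  have hnh : ‖h‖ = r / 2 := by rw [hh, norm_smul, he, Real.norm_of_nonneg (by positivity)]; ring
  obtain ⟨m, hm⟩ := lintegral_grad_le_of_isBounded hQ (Metric.isBounded_ball (x := x) (r := r))
  obtain ⟨C, hC, hball⟩ := exists_lintegral_ball_sub_sq_le (x + h) hρ0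
  have hsub : Metric.ball (x + h) (3 * ρ) ⊆ Metric.ball x r ∩ Ω := by
    intro y hy
    have hy' : ‖y - (x + h)‖ < 3 * ρ := by rwa [Metric.mem_ball, dist_eq_norm] at hy
    have hyb : y ∈ Metric.ball x r := by
      rw [Metric.mem_ball, dist_eq_norm]
      calc ‖y - x‖ = ‖(y - (x + h)) + h‖ := by congr 1; abel
        _ ≤ ‖y - (x + h)‖ + ‖h‖ := norm_add_le _ _
        _ < r := by linarith
    refine ⟨hyb, (hΩ y hyb).2 ?_⟩
    have h1 : |ψ y - ψ (x + h)| ≤ K * ‖y - (x + h)‖ := by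
      have := hψ.dist_le_mul y (x + h)
      rwa [Real.dist_eq, dist_eq_norm] at this
    have h2 : |inner ℝ e (y - (x + h))| ≤ ‖y - (x + h)‖ := by
      have := abs_real_inner_le_norm e (y - (x + h))
      rwa [he, one_mul] at this
    have h3 : inner ℝ e y = inner ℝ e (y - (x + h)) + inner ℝ e x + r / 2 := by
      rw [inner_sub_right, inner_add_right, hh, inner_smul_right, hee]; ring
    rw [hh, hinv, ← hh] at h1
    have h4 := (abs_le.1 h1).2
    have h5 := (abs_le.1 h2).1
    have h6 : (K : ℝ) * ‖y - (x + h)‖ ≤ K * (3 * ρ) := by gcongr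
    rw [h3]
    nlinarith
  refine ⟨ρ, hρ0, 2 * (‖h‖ₑ ^ 2 * m) + 2 * (C * m), by finiteness, fun W hW => ?_⟩
  have hWc := hW.contDiff.continuous
  obtain ⟨b, hb⟩ := hball W hW.contDiff
  have hm := hm W hW
  set I := ∫⁻ x in Q₁, ‖fderiv ℝ W x‖ₑ ^ 2
  refine ⟨b, ?_⟩
  have hT := lintegral_translate_sub_sq_le hW.contDiff h (A := Metric.ball x ρ ∩ Ω)
    (D := Metric.ball x r ∩ Ω) (by
      rintro y ⟨hyb, hyΩ⟩ t ht
      have hyb' : ‖y - x‖ < ρ := by rwa [Metric.mem_ball, dist_eq_norm] at hyb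
      have hyr : y ∈ Metric.ball x r := by
        rw [Metric.mem_ball, dist_eq_norm]; linarith
      have hyt : y + t • h ∈ Metric.ball x r := by
        rw [Metric.mem_ball, dist_eq_norm]
        calc ‖y + t • h - x‖ = ‖(y - x) + t • h‖ := by congr 1; abel
          _ ≤ ‖y - x‖ + ‖t • h‖ := norm_add_le _ _
          _ ≤ ‖y - x‖ + 1 * ‖h‖ := by
              rw [norm_smul, Real.norm_of_nonneg ht.1.le]
              gcongr
              exact ht.2
          _ < r := by linarith
      refine ⟨hyt, (hΩ _ hyt).2 ?_⟩
      have := (hΩ y hyr).1 hyΩ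
      rw [hh, smul_smul, hinv, inner_add_right, inner_smul_right, hee]
      have : 0 ≤ t * (r / 2) := mul_nonneg ht.1.le (by positivity)
      linarith)
  have hTb : ∫⁻ y in Metric.ball x ρ ∩ Ω, ‖W (y + h) - b‖ₑ ^ 2 ≤
      ∫⁻ y in Metric.ball (x + h) ρ, ‖W y - b‖ₑ ^ 2 := by
    rw [← (measurePreserving_add_right (volume : Measure (Space d))
      h).setLIntegral_comp_preimage_emb (measurableEmbedding_addRight h)
      (fun x => ‖W x - b‖ₑ ^ 2) (Metric.ball (x + h) ρ)]
    refine lintegral_mono_set fun y hy => ?_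
    have := hy.1
    simpa [Metric.mem_ball, dist_eq_norm] using this
  have hCI : C * ∫⁻ y in Metric.ball (x + h) (3 * ρ), ‖fderiv ℝ W y‖ₑ ^ 2 ≤ C * (m * I) := by
    gcongr
    exact (lintegral_mono_set hsub).trans hm
  calc ∫⁻ y in Metric.ball x ρ ∩ Ω, ‖W y - b‖ₑ ^ 2
      ≤ ∫⁻ y in Metric.ball x ρ ∩ Ω, 2 * (‖W (y + h) - W y‖ₑ ^ 2 + ‖W (y + h) - b‖ₑ ^ 2) := by
        refine lintegral_mono fun y => ?_
        refine (enorm_sub_sq_le (W y) (W (y + h)) b).trans (le_of_eq ?_)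
        rw [enorm_sub_rev (W y)]
    _ = 2 * (∫⁻ y in Metric.ball x ρ ∩ Ω, ‖W (y + h) - W y‖ₑ ^ 2) +
          2 * ∫⁻ y in Metric.ball x ρ ∩ Ω, ‖W (y + h) - b‖ₑ ^ 2 := by
        rw [lintegral_const_mul' _ _ (by simp), lintegral_add_left (by fun_prop), mul_add]
    _ ≤ 2 * (‖h‖ₑ ^ 2 * (m * I)) + 2 * (C * (m * I)) := by
        gcongr
        · exact hT.trans (by gcongr)
        · exact hTb.trans (hb.trans hCI)
    _ = _ := by ring

theorem exists_isPoincareSet_ball (hQ : IsStiffPart Q₁) {x : Space d}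
    (hx : x ∈ closure (periodization Q₁)) : ∃ ρ > 0, IsPoincareSet Q₁ (Metric.ball x ρ) := by
  by_cases hxΩ : x ∈ periodization Q₁
  · obtain ⟨r, hr, hsub⟩ := Metric.isOpen_iff.1 hQ.isOpen x hxΩ
    exact ⟨r / 3, by positivity, isPoincareSet_ball_interior hQ (by positivity)
      (by rwa [mul_div_cancel₀ r (by norm_num : (3 : ℝ) ≠ 0)])⟩
  · exact exists_isPoincareSet_ball_frontier hQ ⟨hx, fun h => hxΩ (interior_subset h)⟩

/-- Every bounded set supports a Poincaré inequality on the connected stiff component. -/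
theorem IsStiffPart.isPoincareSet (hQ : IsStiffPart Q₁) {B : Set (Space d)}
    (hB : Bornology.IsBounded B) : IsPoincareSet Q₁ B := by
  obtain ⟨x₀, hx₀⟩ := hQ.isConnected.nonempty
  set Ω := periodization Q₁
  -- All admissible sets S contain the base point x₀ of Ω, so any two of them overlap inside Ω and
  -- can be united.
  let p : Set (Space d) → Prop := fun s => ∃ S, IsOpen S ∧ Bornology.IsBounded S ∧ x₀ ∈ S ∧
    s ⊆ S ∧ IsPoincareSet Q₁ S
  have hp0 : ∃ S, IsOpen S ∧ Bornology.IsBounded S ∧ x₀ ∈ S ∧ IsPoincareSet Q₁ S := by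
    obtain ⟨ρ, hρ, h⟩ := exists_isPoincareSet_ball hQ (subset_closure hx₀)
    exact ⟨_, Metric.isOpen_ball, Metric.isBounded_ball, Metric.mem_ball_self hρ, h⟩
  have hjoin : ∀ x ∈ closure Ω, ∀ ρ > 0, IsPoincareSet Q₁ (Metric.ball x ρ) →
      ∀ y ∈ Metric.ball x ρ ∩ Ω, p {y} → p (Metric.ball x ρ) := by
    rintro x - ρ - hPU y ⟨hyU, hyΩ⟩ ⟨S, hSo, hSb, hS0, hyS, hPS⟩
    refine ⟨S ∪ Metric.ball x ρ, hSo.union Metric.isOpen_ball, hSb.union Metric.isBounded_ball,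
      .inl hS0, Set.subset_union_right, ?_⟩
    exact hPS.union hPU hSo Metric.isOpen_ball Metric.isBounded_ball hQ.isOpen
      ⟨y, ⟨hyS rfl, hyU⟩, hyΩ⟩
  have hmono : ∀ {s t}, s ⊆ t → p t → p s := fun hst ⟨S, h1, h2, h3, h4, h5⟩ =>
    ⟨S, h1, h2, h3, hst.trans h4, h5⟩
  -- A clopen argument: the set of points reached is open by construction, and a point of Ω in its
  -- closure is reached by adjoining a Poincaré ball centred there.
  have hΩp : Ω ⊆ {x | p {x}} := by
    refine hQ.isConnected.isPreconnected.subset_of_closure_inter_subset ?_ ?_ ?_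
    · rw [isOpen_iff_forall_mem_open]
      rintro x ⟨S, h1, h2, h3, h4, h5⟩
      exact ⟨S, fun y hy => ⟨S, h1, h2, h3, Set.singleton_subset_iff.2 hy, h5⟩, h1, h4 rfl⟩
    · obtain ⟨S, h1, h2, h3, h5⟩ := hp0
      exact ⟨x₀, hx₀, S, h1, h2, h3, Set.singleton_subset_iff.2 h3, h5⟩
    · rintro x ⟨hxc, hxΩ⟩
      obtain ⟨ρ, hρ, hPU⟩ := exists_isPoincareSet_ball hQ (subset_closure hxΩ)
      obtain ⟨y, ⟨hyU, hyΩ⟩, hyp⟩ := mem_closure_iff.1 hxc (Metric.ball x ρ ∩ Ω)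
        (Metric.isOpen_ball.inter hQ.isOpen) ⟨Metric.mem_ball_self hρ, hxΩ⟩
      exact hmono (Set.singleton_subset_iff.2 (Metric.mem_ball_self hρ))
        (hjoin x (subset_closure hxΩ) ρ hρ hPU y ⟨hyU, hyΩ⟩ hyp)
  -- The closure of Ω is needed here: a finite cover of the stiff part of B must also cover a
  -- neighbourhood of its boundary, which is what the boundary balls provide.
  have hK : IsCompact (closure Ω ∩ closure B) :=
    hB.isCompact_closure.inter_left isClosed_closure
  have hpK : p (closure Ω ∩ closure B) := by
    refine hK.induction_on ?_ (fun s t => hmono) ?_ ?_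
    · obtain ⟨S, h1, h2, h3, h5⟩ := hp0
      exact ⟨S, h1, h2, h3, Set.empty_subset _, h5⟩
    · rintro s t ⟨S, h1, h2, h3, h4, h5⟩ ⟨T, k1, k2, k3, k4, k5⟩
      exact ⟨S ∪ T, h1.union k1, h2.union k2, .inl h3, Set.union_subset_union h4 k4,
        h5.union k5 h1 k1 k2 hQ.isOpen ⟨x₀, ⟨h3, k3⟩, hx₀⟩⟩
    · rintro x ⟨hxc, -⟩
      obtain ⟨ρ, hρ, hPU⟩ := exists_isPoincareSet_ball hQ hxc
      refine ⟨Metric.ball x ρ, mem_nhdsWithin_of_mem_nhds (Metric.ball_mem_nhds x hρ), ?_⟩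
      obtain ⟨y, hyU, hyΩ⟩ := mem_closure_iff.1 hxc _ Metric.isOpen_ball (Metric.mem_ball_self hρ)
      exact hjoin x hxc ρ hρ hPU y ⟨hyU, hyΩ⟩ (hΩp hyΩ)
  obtain ⟨S, -, -, -, h4, h5⟩ := hpK
  exact h5.mono fun x hx => h4 ⟨subset_closure hx.2, subset_closure hx.1⟩

/-- Poincaré inequality on the stiff part of the cell, together with the control of the
increments of an affinely quasi-periodic function. -/
theorem IsStiffPart.exists_poincare (hQ : IsStiffPart Q₁) :
    ∃ C : ℝ≥0∞, C ≠ ⊤ ∧ ∀ W : Space d → ℂ, HasPeriodicGradNorm W → ∃ b : ℂ,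
      ∫⁻ x in Q₁, ‖W x - b‖ₑ ^ 2 ≤ C * ∫⁻ x in Q₁, ‖fderiv ℝ W x‖ₑ ^ 2 ∧
      ∀ (j : Fin d) (z ξ : ℂ), ‖z‖ = 1 →
        (∀ x, W (x + EuclideanSpace.single j 1) = z * W x + ξ) →
        ‖ξ + (z - 1) * b‖ₑ ^ 2 ≤ C * ∫⁻ x in Q₁, ‖fderiv ℝ W x‖ₑ ^ 2 := by
  obtain ⟨R, hR⟩ := (isBounded_cell (d := d)).exists_norm_le
  -- The radius R + 1 accommodates the cell and its translates by unit vectors, so that W and its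
  -- shift are compared with the same constant b.
  obtain ⟨C, hC, h⟩ := hQ.isPoincareSet (Metric.isBounded_closedBall (x := (0 : Space d))
    (r := R + 1))
  set v := volume Q₁
  have hv0 : v ≠ 0 := hQ.volume_pos.ne'
  have hvt : v ≠ ⊤ := hQ.volume_lt_top.ne
  refine ⟨C + 4 * C / v, ENNReal.add_ne_top.2 ⟨hC, (ENNReal.div_lt_top (by finiteness) hv0).ne⟩,
    fun W hW => ?_⟩
  obtain ⟨b, hb⟩ := h W hW
  have hWc := hW.contDiff.continuous
  set I := ∫⁻ x in Q₁, ‖fderiv ℝ W x‖ₑ ^ 2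
  have h1 : ∫⁻ x in Q₁, ‖W x - b‖ₑ ^ 2 ≤ C * I := by
    refine le_trans (lintegral_mono_set fun x hx => ?_) hb
    refine ⟨?_, mem_periodization_of_mem hx⟩
    rw [mem_closedBall_zero_iff]
    linarith [hR x (hQ.subset_cell hx)]
  refine ⟨b, h1.trans (by gcongr; exact le_self_add), fun j z ξ hz hWj => ?_⟩
  have h2 : ∫⁻ x in Q₁, ‖W (x + EuclideanSpace.single j 1) - b‖ₑ ^ 2 ≤ C * I := by
    refine le_trans ?_ hb
    rw [← (measurePreserving_add_right (volume : Measure (Space d))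
      (EuclideanSpace.single j (1 : ℝ))).setLIntegral_comp_preimage_emb
      (measurableEmbedding_addRight _) (fun x => ‖W x - b‖ₑ ^ 2)]
    refine lintegral_mono_set fun x hx => ⟨?_, ?_⟩
    · rw [mem_closedBall_zero_iff]
      refine (norm_add_le _ _).trans ?_
      have : ‖EuclideanSpace.single j (1 : ℝ)‖ = 1 := by simp
      linarith [hR x (hQ.subset_cell hx)]
    · rw [← latticeVec_single, add_mem_periodization]
      exact mem_periodization_of_mem hx
  -- The constant ξ + (z - 1)b equals (W(x + e_j) - b) - z(W(x) - b) for every x. Integrating over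
  -- Q₁ bounds it by two Poincaré integrals.
  have h3 : ‖ξ + (z - 1) * b‖ₑ ^ 2 ≤ 4 * C / v * I := by
    rw [ENNReal.mul_div_right_comm.symm, ENNReal.le_div_iff_mul_le (.inl hv0) (.inl hvt)]
    calc ‖ξ + (z - 1) * b‖ₑ ^ 2 * v = ∫⁻ _x in Q₁, ‖ξ + (z - 1) * b‖ₑ ^ 2 := by
          rw [setLIntegral_const]
      _ ≤ ∫⁻ x in Q₁, 2 * (‖W (x + EuclideanSpace.single j 1) - b‖ₑ ^ 2 + ‖W x - b‖ₑ ^ 2) := by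
          refine lintegral_mono fun x => ?_
          refine le_trans ?_ (sq_add_le_two_mul _ _)
          gcongr
          calc ‖ξ + (z - 1) * b‖ₑ
              = ‖(W (x + EuclideanSpace.single j 1) - b) - z * (W x - b)‖ₑ := by
                rw [hWj]; congr 1; ring
            _ ≤ ‖W (x + EuclideanSpace.single j 1) - b‖ₑ + ‖z * (W x - b)‖ₑ := enorm_sub_le
            _ = _ := by
                rw [enorm_mul, ← ofReal_norm z, hz, ENNReal.ofReal_one, one_mul]
      _ = 2 * (∫⁻ x in Q₁, ‖W (x + EuclideanSpace.single j 1) - b‖ₑ ^ 2) +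
            2 * ∫⁻ x in Q₁, ‖W x - b‖ₑ ^ 2 := by
          rw [lintegral_const_mul' _ _ (by simp), lintegral_add_right _ (by fun_prop), mul_add]
      _ ≤ 2 * (C * I) + 2 * (C * I) := by gcongr
      _ = 4 * C * I := by ring
  exact h3.trans (by gcongr; exact le_add_self)

/-! ### Extension across a Lipschitz boundary -/

/-- An involutive Lipschitz map distorts the volume by at most a constant factor. -/
theorem exists_map_volume_le {S : Space d → Space d} {L : ℝ≥0} (hS : LipschitzWith L S)
    (hinv : Function.Involutive S) :
    ∃ c : ℝ≥0∞, c ≠ ⊤ ∧ (volume : Measure (Space d)).map S ≤ c • volume := by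
  -- Lebesgue measure is a multiple of the d-dimensional Hausdorff measure, which grows by at most
  -- L^d under an L-Lipschitz map. The involution turns preimages into images.
  have hfr : Module.finrank ℝ (Space d) = d := by simp
  have hH := isAddHaarMeasure_hausdorffMeasure (E := Space d)
  rw [hfr] at hH
  set H : Measure (Space d) := Measure.hausdorffMeasure (d : ℝ)
  have hvol := Measure.isAddLeftInvariant_eq_smul (volume : Measure (Space d)) H
  set k := Measure.addHaarScalarFactor (volume : Measure (Space d)) H
  refine ⟨(L : ℝ≥0∞) ^ (d : ℝ), by finiteness, Measure.le_iff.2 fun A hA => ?_⟩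
  rw [Measure.map_apply hS.continuous.measurable hA, ← Set.image_eq_preimage_of_inverse
    hinv.leftInverse hinv.rightInverse, hvol]
  have := hS.hausdorffMeasure_image_le (d := (d : ℝ)) (by positivity) A
  calc (k • H) (S '' A) = k * H (S '' A) := by
        rw [Measure.smul_apply, ENNReal.smul_def, smul_eq_mul]
    _ ≤ k * ((L : ℝ≥0∞) ^ (d : ℝ) * H A) := by gcongr
    _ = _ := by
        rw [Measure.smul_apply, Measure.smul_apply, ENNReal.smul_def, smul_eq_mul, smul_eq_mul]
        ring

theorem enorm_add_le_add {E : Type*} [SeminormedAddCommGroup E] (a b : E) :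
    ‖a + b‖ₑ ≤ ‖a‖ₑ + ‖b‖ₑ := by
  simp only [enorm_eq_nnnorm]
  exact_mod_cast nnnorm_add_le a b

theorem enorm_zero_eq {E : Type*} [SeminormedAddCommGroup E] : ‖(0 : E)‖ₑ = 0 := by
  simp [enorm_eq_nnnorm]

/-- The factor g may be unbounded: the product estimate only uses its values on the compact support
of f, and it is trivial when both points lie outside that support. -/
theorem exists_lipschitzWith_mul {f g : Space d → ℂ} {K₁ K₂ : ℝ≥0} (hf : LipschitzWith K₁ f)
    (hfc : HasCompactSupport f) (hg : LipschitzWith K₂ g) :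
    ∃ K, LipschitzWith K fun x => f x * g x := by
  obtain ⟨M, hM⟩ := hfc.exists_bound_of_continuous hf.continuous
  obtain ⟨N, hN⟩ := hfc.isCompact.exists_bound_of_continuousOn hg.continuous.continuousOn
  have hM0 : 0 ≤ M := (norm_nonneg _).trans (hM 0)
  have key : ∀ x y, y ∈ tsupport f → ‖f x * g x - f y * g y‖ ≤ (M * K₂ + K₁ * N) * ‖x - y‖ := by
    intro x y hy
    have h1 := hf.dist_le_mul x y
    have h2 := hg.dist_le_mul x y
    rw [dist_eq_norm, dist_eq_norm] at h1 h2
    calc ‖f x * g x - f y * g y‖ = ‖f x * (g x - g y) + (f x - f y) * g y‖ := by congr 1; ring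
      _ ≤ ‖f x‖ * ‖g x - g y‖ + ‖f x - f y‖ * ‖g y‖ := by
          rw [← norm_mul, ← norm_mul]; exact norm_add_le _ _
      _ ≤ M * (K₂ * ‖x - y‖) + (K₁ * ‖x - y‖) * N := by
          gcongr
          exacts [hM x, hN y hy]
      _ = _ := by ring
  refine ⟨Real.toNNReal (M * K₂ + K₁ * N), LipschitzWith.of_dist_le_mul fun x y => ?_⟩
  rw [dist_eq_norm, dist_eq_norm]
  have hle := Real.le_coe_toNNReal (M * K₂ + K₁ * N)
  by_cases hy : y ∈ tsupport f
  · exact (key x y hy).trans (by gcongr)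
  by_cases hx : x ∈ tsupport f
  · rw [norm_sub_rev, norm_sub_rev x]
    exact (key y x hx).trans (by gcongr)
  · rw [image_eq_zero_of_notMem_tsupport hx, image_eq_zero_of_notMem_tsupport hy]
    simp only [zero_mul, sub_self, norm_zero]
    positivity

theorem sq_add_sq_le_of_le {u v M p q : ℝ≥0∞} (hu : u ≤ M * p) (hv : v ≤ M * p + M * q) :
    u ^ 2 + v ^ 2 ≤ 3 * M ^ 2 * (p ^ 2 + q ^ 2) := by
  calc u ^ 2 + v ^ 2 ≤ (M * p) ^ 2 + 2 * ((M * p) ^ 2 + (M * q) ^ 2) := by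
        gcongr
        exact (pow_le_pow_left₀ zero_le hv 2).trans (sq_add_le_two_mul _ _)
    _ = 3 * M ^ 2 * p ^ 2 + 2 * (M ^ 2 * q ^ 2) := by ring
    _ ≤ 3 * M ^ 2 * p ^ 2 + 3 * (M ^ 2 * q ^ 2) := by gcongr; norm_num
    _ = _ := by ring

theorem enorm_fderiv_mul_le {f g : Space d → ℂ} {x : Space d} (hf : DifferentiableAt ℝ f x)
    (hg : DifferentiableAt ℝ g x) :
    ‖fderiv ℝ (fun y => f y * g y) x‖ₑ ≤ ‖fderiv ℝ f x‖ₑ * ‖g x‖ₑ + ‖f x‖ₑ * ‖fderiv ℝ g x‖ₑ := by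
  rw [fderiv_fun_mul hf hg, add_comm]
  refine (enorm_add_le_add _ _).trans ?_
  rw [enorm_smul, enorm_smul, mul_comm ‖g x‖ₑ]

theorem exists_enorm_bound {χ : Space d → ℂ} (hχ : ContDiff ℝ ∞ χ) (hχc : HasCompactSupport χ) :
    ∃ M : ℝ≥0∞, M ≠ ⊤ ∧ ∀ x, ‖χ x‖ₑ ≤ M ∧ ‖fderiv ℝ χ x‖ₑ ≤ M := by
  obtain ⟨M, hM⟩ := hχc.exists_bound_of_continuous hχ.continuous
  obtain ⟨N, hN⟩ := (hχc.fderiv (𝕜 := ℝ)).exists_bound_of_continuous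
    (hχ.continuous_fderiv (by simp))
  refine ⟨ENNReal.ofReal (max M N), by finiteness, fun x => ?_⟩
  rw [← ofReal_norm, ← ofReal_norm]
  exact ⟨ENNReal.ofReal_le_ofReal ((hM x).trans (le_max_left _ _)),
    ENNReal.ofReal_le_ofReal ((hN x).trans (le_max_right _ _))⟩

/-- The squared `H¹` norm of `W` on `A`. -/
def energy (A : Set (Space d)) (W : Space d → ℂ) : ℝ≥0∞ :=
  ∫⁻ x in A, (‖W x‖ₑ ^ 2 + ‖fderiv ℝ W x‖ₑ ^ 2)

theorem exists_energy_mul_le {χ : Space d → ℂ} (hχ : ContDiff ℝ ∞ χ) (hχc : HasCompactSupport χ) :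
    ∃ C : ℝ≥0∞, C ≠ ⊤ ∧ ∀ (A : Set (Space d)) (W : Space d → ℂ), ContDiff ℝ ∞ W →
      energy A (fun x => χ x * W x) ≤ C * energy A W := by
  obtain ⟨M, hMt, hM⟩ := exists_enorm_bound hχ hχc
  refine ⟨3 * M ^ 2, by finiteness, fun A W hW => ?_⟩
  rw [energy, energy, ← lintegral_const_mul' _ _ (by finiteness)]
  refine lintegral_mono fun x => sq_add_sq_le_of_le ?_ ?_
  · rw [enorm_mul]; gcongr; exact (hM x).1
  · refine (enorm_fderiv_mul_le (hχ.differentiable (by simp) x)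
      (hW.differentiable (by simp) x)).trans ?_
    gcongr
    exacts [(hM x).2, (hM x).1]

/-- Smooth functions cut off by `χ` can be modified in the soft part to have there an `H¹` norm
controlled by the one in the stiff part. -/
def IsExtensionCutoff (Q₁ : Set (Space d)) (χ : Space d → ℂ) : Prop :=
  ContDiff ℝ ∞ χ ∧ HasCompactSupport χ ∧ ∃ C : ℝ≥0∞, C ≠ ⊤ ∧ ∀ W : Space d → ℂ,
    ContDiff ℝ ∞ W → (∃ K, LipschitzWith K W) → ∃ Φ : Space d → ℂ, (∃ K, LipschitzWith K Φ) ∧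
      (∀ x ∉ softPart Q₁, Φ x = 0) ∧
      energy (softPart Q₁) (fun x => χ x * W x - Φ x) ≤ C * energy Q₁ W


namespace IsExtensionCutoff

theorem mul {χ η : Space d → ℂ} (h : IsExtensionCutoff Q₁ χ) (hη : ContDiff ℝ ∞ η)
    (hηc : HasCompactSupport η) : IsExtensionCutoff Q₁ fun x => χ x * η x := by
  obtain ⟨hχ, hχc, C, hC, h⟩ := h
  obtain ⟨D, hD, hE⟩ := exists_energy_mul_le hη hηc
  refine ⟨hχ.mul hη, hχc.mul_right, C * D, by finiteness, fun W hW _ => ?_⟩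
  have hηW : ContDiff ℝ ∞ fun x => η x * W x := hη.mul hW
  obtain ⟨K', hK'⟩ := (hηW.of_le (by simp)).lipschitzWith_of_hasCompactSupport
    (hηc.mul_right (f' := W)) one_ne_zero
  obtain ⟨Φ, hΦ, hΦ0, hΦE⟩ := h _ hηW ⟨K', hK'⟩
  refine ⟨Φ, hΦ, hΦ0, ?_⟩
  simp only [mul_assoc]
  exact hΦE.trans (by gcongr; exact hE Q₁ W hW)

/-- Together with `mul` this makes χ + η - χη admissible, which equals 1 wherever χ or η does. This
is how local cutoffs are glued. -/
theorem add_mul_const {χ η : Space d → ℂ} (h₁ : IsExtensionCutoff Q₁ χ)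
    (h₂ : IsExtensionCutoff Q₁ η) (a : ℂ) : IsExtensionCutoff Q₁ fun x => χ x + a * η x := by
  obtain ⟨hχ, hχc, C, hC, h₁⟩ := h₁
  obtain ⟨hη, hηc, D, hD, h₂⟩ := h₂
  refine ⟨hχ.add (contDiff_const.mul hη), hχc.add (hηc.mul_left (f := fun _ => a)),
    2 * C + 2 * (‖a‖ₑ ^ 2 * D), by finiteness, fun W hW hWL => ?_⟩
  obtain ⟨Φ, ⟨K, hΦ⟩, hΦ0, hΦE⟩ := h₁ W hW hWL
  obtain ⟨Ψ, ⟨L, hΨ⟩, hΨ0, hΨE⟩ := h₂ W hW hWL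
  have haΨ : LipschitzWith (‖a‖₊ * L) fun x => a * Ψ x := (lipschitzWith_smul a).comp hΨ
  refine ⟨fun x => Φ x + a * Ψ x, ⟨_, hΦ.add haΨ⟩,
    fun x hx => by simp [hΦ0 x hx, hΨ0 x hx], ?_⟩
  set f := fun x => χ x * W x - Φ x
  set g := fun x => η x * W x - Ψ x
  have hfc : Continuous f := (hχ.continuous.mul hW.continuous).sub hΦ.continuous
  have hgc : Continuous g := (hη.continuous.mul hW.continuous).sub hΨ.continuous
  have hfg : (fun x => (χ x + a * η x) * W x - (Φ x + a * Ψ x)) = fun x => f x + a * g x := by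
    ext x; simp only [f, g]; ring
  rw [hfg]
  have hae : ∀ᵐ x ∂(volume.restrict (softPart Q₁)),
      ‖f x + a * g x‖ₑ ^ 2 + ‖fderiv ℝ (fun x => f x + a * g x) x‖ₑ ^ 2 ≤
        2 * (‖f x‖ₑ ^ 2 + ‖fderiv ℝ f x‖ₑ ^ 2) +
          2 * (‖a‖ₑ ^ 2 * (‖g x‖ₑ ^ 2 + ‖fderiv ℝ g x‖ₑ ^ 2)) := by
    refine ae_restrict_of_ae ?_
    filter_upwards [hΦ.ae_differentiableAt (μ := volume), hΨ.ae_differentiableAt (μ := volume)]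
      with x hx1 hx2
    have hW' := hW.differentiable (by simp) x
    have hfd : DifferentiableAt ℝ f x := ((hχ.differentiable (by simp) x).mul hW').sub hx1
    have hgd : DifferentiableAt ℝ g x := ((hη.differentiable (by simp) x).mul hW').sub hx2
    have e1 : ‖f x + a * g x‖ₑ ^ 2 ≤ 2 * (‖f x‖ₑ ^ 2 + (‖a‖ₑ * ‖g x‖ₑ) ^ 2) := by
      refine le_trans ?_ (sq_add_le_two_mul _ _)
      gcongr
      rw [← enorm_mul]
      exact enorm_add_le_add _ _
    have e2 : ‖fderiv ℝ (fun x => f x + a * g x) x‖ₑ ^ 2 ≤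
        2 * (‖fderiv ℝ f x‖ₑ ^ 2 + (‖a‖ₑ * ‖fderiv ℝ g x‖ₑ) ^ 2) := by
      refine le_trans ?_ (sq_add_le_two_mul _ _)
      gcongr
      rw [fderiv_fun_add hfd (hgd.const_mul a), fderiv_const_mul hgd, ← enorm_smul]
      exact enorm_add_le_add _ _
    refine (add_le_add e1 e2).trans (le_of_eq ?_)
    ring
  calc energy (softPart Q₁) (fun x => f x + a * g x)
      ≤ ∫⁻ x in softPart Q₁, (2 * (‖f x‖ₑ ^ 2 + ‖fderiv ℝ f x‖ₑ ^ 2) +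
          2 * (‖a‖ₑ ^ 2 * (‖g x‖ₑ ^ 2 + ‖fderiv ℝ g x‖ₑ ^ 2))) := lintegral_mono_ae hae
    _ = 2 * energy (softPart Q₁) f + 2 * (‖a‖ₑ ^ 2 * energy (softPart Q₁) g) := by
        have hm : Measurable (fderiv ℝ f) := measurable_fderiv ℝ f
        have hm' := hfc.measurable
        rw [lintegral_add_left (by fun_prop), lintegral_const_mul' _ _ (by simp),
          lintegral_const_mul' _ _ (by simp), lintegral_const_mul' _ _ (by finiteness)]
        rfl
    _ ≤ 2 * (C * energy Q₁ W) + 2 * (‖a‖ₑ ^ 2 * (D * energy Q₁ W)) := by gcongr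
    _ = _ := by ring

/-- Inside the soft part the whole function χW may be subtracted, leaving nothing to estimate. -/
theorem of_tsupport_subset {χ : Space d → ℂ} (hχ : ContDiff ℝ ∞ χ) (hχc : HasCompactSupport χ)
    (hsub : tsupport χ ⊆ softPart Q₁) : IsExtensionCutoff Q₁ χ := by
  refine ⟨hχ, hχc, 0, by simp, fun W hW _ => ⟨fun x => χ x * W x, ?_, fun x hx => ?_, ?_⟩⟩
  · exact ((hχ.mul hW).of_le (by simp)).lipschitzWith_of_hasCompactSupport hχc.mul_right
      one_ne_zero
  · dsimp only
    rw [image_eq_zero_of_notMem_tsupport fun h => hx (hsub h), zero_mul]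
  · simp [energy, enorm_zero_eq]

/-- Near a boundary point, reflect across the Lipschitz graph. -/
theorem exists_of_mem_frontier (hQ : IsStiffPart Q₁) {x : Space d} (hx : x ∈ openCube d)
    (hxf : x ∈ frontier (periodization Q₁)) :
    ∃ ρ > 0, ∀ χ : Space d → ℂ, ContDiff ℝ ∞ χ → HasCompactSupport χ →
      tsupport χ ⊆ Metric.ball x ρ → IsExtensionCutoff Q₁ χ := by
  obtain ⟨e, ψ, K, r₀, he, hψ, hinv, hr₀, hΩ₀⟩ := hQ.lipschitz x hxf
  obtain ⟨r₁, hr₁, hcube⟩ := Metric.isOpen_iff.1 isOpen_openCube x hx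
  have hx0 : ψ x = inner ℝ e x := eq_inner_of_mem_frontier hψ.continuous hr₀ hxf hΩ₀
  set Ω := periodization Q₁
  set r := min r₀ r₁ with hrdef
  have hr : 0 < r := lt_min hr₀ hr₁
  have hrc : Metric.ball x r ⊆ openCube d :=
    (Metric.ball_subset_ball (min_le_right _ _)).trans hcube
  have hΩ : ∀ y ∈ Metric.ball x r, y ∈ Ω ↔ ψ y < inner ℝ e y := fun y hy =>
    hΩ₀ y (Metric.ball_subset_ball (min_le_left _ _) hy)
  have hee : inner ℝ e e = (1 : ℝ) := by rw [real_inner_self_eq_norm_sq, he]; norm_num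
  set g : Space d → ℝ := fun y => ψ y - inner ℝ e y with hg
  have hgL : ∀ y z, |g y - g z| ≤ (K + 1) * ‖y - z‖ := by
    intro y z
    have h1 : |ψ y - ψ z| ≤ K * ‖y - z‖ := by
      have := hψ.dist_le_mul y z
      rwa [Real.dist_eq, dist_eq_norm] at this
    have h2 : |inner ℝ e (y - z)| ≤ ‖y - z‖ := by
      have := abs_real_inner_le_norm e (y - z)
      rwa [he, one_mul] at this
    rw [inner_sub_right] at h2
    calc |g y - g z| = |(ψ y - ψ z) - (inner ℝ e y - inner ℝ e z)| := by
          congr 1; simp only [hg]; ring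
      _ ≤ |ψ y - ψ z| + |inner ℝ e y - inner ℝ e z| := abs_sub _ _
      _ ≤ _ := by linarith
  -- Both maps below displace y along e by twice a 1-Lipschitz function of g, and g is (K +
  -- 1)-Lipschitz, so the constant is 1 + 2(K + 1).
  set L : ℝ≥0 := 2 * K + 3 with hL
  have hLip : ∀ m : ℝ → ℝ, (∀ a b, |m a - m b| ≤ |a - b|) →
      LipschitzWith L fun y : Space d => y + (2 * m (g y)) • e := by
    intro m hm
    refine LipschitzWith.of_dist_le_mul fun y z => ?_
    rw [dist_eq_norm, dist_eq_norm]
    calc ‖y + (2 * m (g y)) • e - (z + (2 * m (g z)) • e)‖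
        = ‖(y - z) + (2 * (m (g y) - m (g z))) • e‖ := by
          congr 1; rw [mul_sub, sub_smul]; abel
      _ ≤ ‖y - z‖ + 2 * |m (g y) - m (g z)| := by
          refine (norm_add_le _ _).trans ?_
          rw [norm_smul, he, mul_one, Real.norm_eq_abs, abs_mul, abs_two]
      _ ≤ ‖y - z‖ + 2 * ((K + 1) * ‖y - z‖) := by
          gcongr
          exact (hm _ _).trans (hgL y z)
      _ = _ := by rw [hL]; push_cast; ring
  -- The function g is the depth below the graph. S is the reflection along e across the graph, an
  -- involution since g changes sign under it. R folds the lower side onto the upper one and fixes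
  -- the upper side.
  set R : Space d → Space d := fun y => y + (2 * max (g y) 0) • e with hR
  set S : Space d → Space d := fun y => y + (2 * g y) • e with hS
  have hRL : LipschitzWith L R := hLip (fun a => max a 0) fun a b =>
    abs_max_sub_max_le_abs a b 0
  have hSL : LipschitzWith L S := hLip id fun a b => le_rfl
  have hgS : ∀ y, g (S y) = - g y := by
    intro y
    simp only [hg, hS, hinv, inner_add_right, inner_smul_right, hee]
    ring
  have hSinv : Function.Involutive S := by
    intro y
    have : S (S y) = S y + (2 * g (S y)) • e := rfl
    rw [this, hgS]
    simp only [hS]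
    rw [mul_neg, neg_smul, add_neg_cancel_right]
  obtain ⟨c, hc, hmap⟩ := exists_map_volume_le hSL hSinv
  -- S fixes x and Lρ < r, so reflected points remain in the chart and in the open cube.
  set ρ := r / (L + 1) with hρ
  have hL1 : (1 : ℝ) ≤ L := by rw [hL]; push_cast; nlinarith [K.coe_nonneg]
  have hρ0 : 0 < ρ := by positivity
  have hρL : ρ * (L + 1) = r := by rw [hρ]; field_simp
  have hρr : ρ ≤ r := by nlinarith
  have hSx : S x = x := by simp [hS, hg, hx0]
  have hSball : ∀ y ∈ Metric.ball x ρ, S y ∈ Metric.ball x r := by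
    intro y hy
    rw [Metric.mem_ball] at hy ⊢
    calc dist (S y) x = dist (S y) (S x) := by rw [hSx]
      _ ≤ L * dist y x := hSL.dist_le_mul _ _
      _ ≤ L * ρ := by gcongr
      _ < r := by nlinarith
  have hbelow : ∀ y ∈ softPart Q₁ ∩ Metric.ball x ρ, 0 < g y ∧ S y ∈ Q₁ := by
    rintro y ⟨hy0, hyρ⟩
    have hyr : y ∈ Metric.ball x r := Metric.ball_subset_ball hρr hyρ
    have hge : 0 ≤ g y := by
      by_contra hlt
      exact hQ.notMem_of_mem_softPart hy0 ((hΩ y hyr).2 (by simp only [hg] at hlt; linarith))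
    -- A soft point cannot lie on the graph: a small move along e would stay in the open soft part
    -- and yet enter Ω.
    have hpos : 0 < g y := by
      refine lt_of_le_of_ne hge fun h0 => ?_
      have hcont : ContinuousAt (fun t : ℝ => y + t • e) 0 := by fun_prop
      have hmem : softPart Q₁ ∩ Metric.ball x r ∈ 𝓝 ((fun t : ℝ => y + t • e) 0) := by
        simpa using (isOpen_softPart.inter Metric.isOpen_ball).mem_nhds ⟨hy0, hyr⟩
      obtain ⟨δ, hδ, hsub⟩ := Metric.mem_nhds_iff.1 (hcont hmem)
      have ht := hsub (a := (δ / 2 : ℝ)) (by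
        rw [Metric.mem_ball, Real.dist_eq, sub_zero, abs_of_pos (by positivity)]; linarith)
      refine hQ.notMem_of_mem_softPart ht.1 ((hΩ _ ht.2).2 ?_)
      simp only [hinv, inner_add_right, inner_smul_right, hee]
      simp only [hg] at h0
      linarith
    refine ⟨hpos, ?_⟩
    have hSr := hSball y hyρ
    refine mem_of_mem_periodization hQ.subset_cell (openCube_subset_cell (hrc hSr))
      ((hΩ _ hSr).2 ?_)
    have := hgS y
    simp only [hg] at this hpos
    linarith
  refine ⟨ρ, hρ0, fun χ hχ hχc hχs => ?_⟩
  obtain ⟨M, hMt, hM⟩ := exists_enorm_bound hχ hχc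
  obtain ⟨Kχ, hKχ⟩ := (hχ.of_le (by simp)).lipschitzWith_of_hasCompactSupport hχc
    one_ne_zero
  have hM0 : M * L ≠ ⊤ := by finiteness
  have hL1e : (1 : ℝ≥0∞) ≤ L := by exact_mod_cast hL1
  refine ⟨hχ, hχc, 3 * (M * L) ^ 2 * c, by finiteness, fun W hW ⟨KW, hKW⟩ => ?_⟩
  -- With this choice χW - Φ = χ · (W ∘ R), which on the soft part only involves values of W in Q₁.
  -- On the stiff side R is the identity, so Φ vanishes there.
  refine ⟨fun y => χ y * (W y - W (R y)),
    exists_lipschitzWith_mul hKχ hχc (hKW.sub (hKW.comp hRL)), fun y hy => ?_, ?_⟩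
  · by_cases hyρ : y ∈ Metric.ball x ρ
    · have hyr : y ∈ Metric.ball x r := Metric.ball_subset_ball hρr hyρ
      have hle : g y ≤ 0 := by
        by_cases hyΩ : y ∈ Ω
        · have := (hΩ y hyr).1 hyΩ
          simp only [hg]; linarith
        · by_contra! hgt
          refine hy ?_
          have hgc : Continuous g := hψ.continuous.sub (by fun_prop)
          refine IsStiffPart.subset_softPart (U := Metric.ball x r ∩ {z | 0 < g z})
            (Metric.isOpen_ball.inter (isOpen_lt continuous_const hgc))
            (Set.inter_subset_left.trans hrc) ?_ ⟨hyr, hgt⟩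
          rintro z ⟨hzr, hz⟩ hzΩ
          have := (hΩ z hzr).1 hzΩ
          simp only [hg, Set.mem_ofPred_eq] at hz
          linarith
      have : R y = y := by simp [hR, max_eq_right hle]
      simp only [this, sub_self, mul_zero]
    · dsimp only
      rw [image_eq_zero_of_notMem_tsupport fun h => hyρ (hχs h), zero_mul]
  · have hf : (fun y => χ y * W y - χ y * (W y - W (R y))) = fun y => χ y * W (R y) := by
      ext y; ring
    rw [hf]
    set G : Space d → ℝ≥0∞ := fun y => ‖W y‖ₑ ^ 2 + ‖fderiv ℝ W y‖ₑ ^ 2 with hG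
    have hGm : Measurable G := by
      have h1 := hW.continuous
      have h2 := hW.continuous_fderiv (by simp)
      exact Continuous.measurable (by fun_prop)
    -- R is only Lipschitz, so the chain rule is used at the points of differentiability given by
    -- Rademacher's theorem. On the support of χ in the soft part, R agrees with S and lands in Q₁.
    have hae : ∀ᵐ y ∂volume, y ∈ softPart Q₁ →
        ‖χ y * W (R y)‖ₑ ^ 2 + ‖fderiv ℝ (fun y => χ y * W (R y)) y‖ₑ ^ 2 ≤
          (S ⁻¹' Q₁).indicator (fun y => 3 * (M * L) ^ 2 * G (S y)) y := by
      filter_upwards [hRL.ae_differentiableAt (μ := volume)] with y hRd hy0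
      by_cases hyχ : y ∈ tsupport χ
      · obtain ⟨hgpos, hSy⟩ := hbelow y ⟨hy0, hχs hyχ⟩
        have hRS : R y = S y := by simp [hR, hS, max_eq_left hgpos.le]
        rw [Set.indicator_of_mem (show y ∈ S ⁻¹' Q₁ from hSy), ← hRS]
        have hWd := hW.differentiable (by simp) (R y)
        have hcomp : ‖fderiv ℝ (fun y => W (R y)) y‖ₑ ≤ ‖fderiv ℝ W (R y)‖ₑ * L := by
          have h1 : fderiv ℝ (fun y => W (R y)) y = (fderiv ℝ W (R y)).comp (fderiv ℝ R y) :=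
            fderiv_comp y hWd hRd
          rw [h1, ← ofReal_norm, ← ofReal_norm, ← ENNReal.ofReal_coe_nnreal,
            ← ENNReal.ofReal_mul (norm_nonneg _)]
          refine ENNReal.ofReal_le_ofReal ((ContinuousLinearMap.opNorm_comp_le _ _).trans ?_)
          gcongr
          exact norm_fderiv_le_of_lipschitz ℝ hRL
        refine sq_add_sq_le_of_le ?_ ?_
        · rw [enorm_mul]
          gcongr
          exact (hM y).1.trans (le_mul_of_one_le_right zero_le hL1e)
        · refine (enorm_fderiv_mul_le (hχ.differentiable (by simp) y) (hWd.comp y hRd)).trans ?_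
          refine add_le_add ?_ ?_
          · exact mul_le_mul_left ((hM y).2.trans (le_mul_of_one_le_right zero_le hL1e)) _
          · calc ‖χ y‖ₑ * ‖fderiv ℝ (fun y => W (R y)) y‖ₑ
                ≤ M * (‖fderiv ℝ W (R y)‖ₑ * L) := by
                  gcongr
                  exact (hM y).1
              _ = M * L * ‖fderiv ℝ W (R y)‖ₑ := by ring
      · have hev : (fun y => χ y * W (R y)) =ᶠ[𝓝 y] fun _ => 0 := by
          filter_upwards [(isClosed_tsupport χ).isOpen_compl.mem_nhds hyχ] with z hz
          rw [image_eq_zero_of_notMem_tsupport hz, zero_mul]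
        rw [hev.fderiv_eq, image_eq_zero_of_notMem_tsupport hyχ]
        simp [enorm_zero_eq]
    calc energy (softPart Q₁) (fun y => χ y * W (R y))
        ≤ ∫⁻ y in softPart Q₁, (S ⁻¹' Q₁).indicator (fun y => 3 * (M * L) ^ 2 * G (S y)) y :=
          setLIntegral_mono_ae' isOpen_softPart.measurableSet hae
      _ ≤ ∫⁻ y, (S ⁻¹' Q₁).indicator (fun y => 3 * (M * L) ^ 2 * G (S y)) y :=
          setLIntegral_le_lintegral _ _
      _ = 3 * (M * L) ^ 2 * ∫⁻ y in S ⁻¹' Q₁, G (S y) := by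
          rw [lintegral_indicator (hSL.continuous.measurable hQ.measurableSet),
            lintegral_const_mul' _ _ (by finiteness)]
      _ = 3 * (M * L) ^ 2 * ∫⁻ y in Q₁, G y ∂(volume.map S) := by
          rw [setLIntegral_map hQ.measurableSet hGm hSL.continuous.measurable]
      _ ≤ 3 * (M * L) ^ 2 * ∫⁻ y in Q₁, G y ∂(c • volume) := by
          gcongr
      _ = _ := by
          rw [Measure.restrict_smul, lintegral_smul_measure, smul_eq_mul, energy]; ring

end IsExtensionCutoff

/-- Extension from the stiff part: a smooth function can be modified in the soft part so that its
`H¹` norm there is controlled by its `H¹` norm in the stiff part. -/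
theorem IsStiffPart.exists_extension (hQ : IsStiffPart Q₁) :
    ∃ C : ℝ≥0∞, C ≠ ⊤ ∧ ∀ W : Space d → ℂ, ContDiff ℝ ∞ W → (∃ K, LipschitzWith K W) →
      ∃ Φ : Space d → ℂ, (∃ K, LipschitzWith K Φ) ∧ (∀ x ∉ softPart Q₁, Φ x = 0) ∧
        energy (softPart Q₁) (fun x => W x - Φ x) ≤ C * energy Q₁ W := by
  -- Compactness induction on subsets of the closure of Q₀ takes the place of a partition of unity.
  let p : Set (Space d) → Prop := fun s => ∃ χ, (∀ x ∈ s, χ x = 1) ∧ IsExtensionCutoff Q₁ χ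
  have hp : p (closure (softPart Q₁)) := by
    refine hQ.isCompact_closure_softPart.induction_on (p := p) ?_ ?_ ?_ ?_
    · refine ⟨fun _ => 0, by simp, IsExtensionCutoff.of_tsupport_subset contDiff_const
        HasCompactSupport.zero ?_⟩
      have : tsupport (fun _ : Space d => (0 : ℂ)) = ∅ := tsupport_eq_empty_iff.2 rfl
      simp [this]
    · rintro s t hst ⟨χ, h1, h2⟩
      exact ⟨χ, fun x hx => h1 x (hst hx), h2⟩
    · rintro s t ⟨χ, h1, h2⟩ ⟨η, k1, k2⟩
      -- This is 1 - (1 - χ)(1 - η).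
      refine ⟨fun x => (χ x + 1 * η x) + (-1) * (χ x * η x), ?_,
        (h2.add_mul_const k2 1).add_mul_const (h2.mul k2.1 k2.2.1) (-1)⟩
      rintro x (hx | hx)
      · simp [h1 x hx]
      · simp [k1 x hx]
    · intro x hx
      have hloc : ∃ ρ > 0, ∀ χ : Space d → ℂ, ContDiff ℝ ∞ χ → HasCompactSupport χ →
          tsupport χ ⊆ Metric.ball x ρ → IsExtensionCutoff Q₁ χ := by
        by_cases hx0 : x ∈ softPart Q₁
        · obtain ⟨ρ, hρ, hsub⟩ := Metric.isOpen_iff.1 isOpen_softPart x hx0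
          exact ⟨ρ, hρ, fun χ h1 h2 h3 =>
            IsExtensionCutoff.of_tsupport_subset h1 h2 (h3.trans hsub)⟩
        · exact IsExtensionCutoff.exists_of_mem_frontier hQ (hQ.closure_softPart hx)
            (hQ.frontier_softPart_subset ⟨hx, hx0⟩)
      obtain ⟨ρ, hρ, h⟩ := hloc
      let f : ContDiffBump x := ⟨ρ / 4, ρ / 2, by positivity, by linarith⟩
      refine ⟨Metric.closedBall x (ρ / 4), mem_nhdsWithin_of_mem_nhds
        (Metric.closedBall_mem_nhds x (by positivity)), fun y => (f y : ℂ), ?_, h _ ?_ ?_ ?_⟩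
      · intro y hy
        simp only [f.one_of_mem_closedBall hy, Complex.ofReal_one]
      · exact Complex.ofRealCLM.contDiff.comp f.contDiff
      · exact f.hasCompactSupport.comp_left (g := fun t : ℝ => (t : ℂ)) Complex.ofReal_zero
      · refine (tsupport_comp_subset (g := fun t : ℝ => (t : ℂ)) Complex.ofReal_zero f).trans ?_
        rw [f.tsupport_eq]
        exact Metric.closedBall_subset_ball (by change ρ / 2 < ρ; linarith)
  obtain ⟨χ, hχ1, -, -, C, hC, h⟩ := hp
  refine ⟨C, hC, fun W hW hWL => ?_⟩
  obtain ⟨Φ, hΦ, hΦ0, hE⟩ := h W hW hWL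
  refine ⟨Φ, hΦ, hΦ0, le_trans (le_of_eq ?_) hE⟩
  refine setLIntegral_congr_fun isOpen_softPart.measurableSet fun x hx => ?_
  have hev : (fun x => W x - Φ x) =ᶠ[𝓝 x] fun x => χ x * W x - Φ x := by
    filter_upwards [isOpen_softPart.mem_nhds hx] with y hy
    rw [hχ1 y (subset_closure hy), one_mul]
  simp only [hev.fderiv_eq, hχ1 x (subset_closure hx), one_mul]

/-! ### Mollification -/

/-- The bump function supported in the ball of radius `r` around `0`. -/
def bump (d : ℕ) (r : ℝ) (hr : 0 < r) : ContDiffBump (0 : Space d) :=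
  ⟨r / 2, r, by positivity, by linarith⟩

/-- The mollification of `u` by a normalised bump function. -/
def mollify (ρ : ContDiffBump (0 : Space d)) (u : Space d → ℂ) : Space d → ℂ :=
  convolution (ρ.normed volume) u (ContinuousLinearMap.lsmul ℝ ℝ) volume

theorem mollify_apply (ρ : ContDiffBump (0 : Space d)) (u : Space d → ℂ) (x : Space d) :
    mollify ρ u x = ∫ t, ρ.normed volume t • u (x - t) := rfl

theorem mollify_apply' (ρ : ContDiffBump (0 : Space d)) (u : Space d → ℂ) (x : Space d) :
    mollify ρ u x = ∫ t, ρ.normed volume (x - t) • u t := by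
  rw [mollify_apply, ← integral_sub_left_eq_self _ volume x]
  simp

theorem contDiff_mollify (ρ : ContDiffBump (0 : Space d)) {u : Space d → ℂ}
    (hu : LocallyIntegrable u) : ContDiff ℝ ∞ (mollify ρ u) :=
  ρ.hasCompactSupport_normed.contDiff_convolution_left _ ρ.contDiff_normed hu

/-- Mollification commutes with weak differentiation. -/
theorem fderiv_mollify (ρ : ContDiffBump (0 : Space d)) {u : Space d → ℂ}
    {g : Space d → Fin d → ℂ} (hu : LocallyIntegrable u) (hg : IsWeakGradient u g)
    (x : Space d) (j : Fin d) :
    fderiv ℝ (mollify ρ u) x (EuclideanSpace.single j 1) = mollify ρ (fun x => g x j) x := by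
  set f := ρ.normed volume
  have hfs : ContDiff ℝ ∞ f := ρ.contDiff_normed
  have hfc : HasCompactSupport f := ρ.hasCompactSupport_normed
  have h1 := hfc.hasFDerivAt_convolution_left (ContinuousLinearMap.lsmul ℝ ℝ : ℝ →L[ℝ] ℂ →L[ℝ] ℂ)
    (hfs.of_le (by simp)) hu x
  have hint := ((hfc.fderiv (𝕜 := ℝ)).convolutionExists_left
    ((ContinuousLinearMap.lsmul ℝ ℝ : ℝ →L[ℝ] ℂ →L[ℝ] ℂ).precompL (Space d))
    (hfs.continuous_fderiv (by simp)) hu x).integrable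
  have h2 : fderiv ℝ (mollify ρ u) x (EuclideanSpace.single j 1) =
      ∫ t, (fderiv ℝ f t (EuclideanSpace.single j 1)) • u (x - t) := by
    have : HasFDerivAt (mollify ρ u) _ x := h1
    rw [this.fderiv, convolution_def, ContinuousLinearMap.integral_apply hint]
    rfl
  -- The weak gradient identity is tested with t ↦ f(x - t), whose derivative changes sign with
  -- respect to that of f.
  have hφ : ContDiff ℝ ∞ fun t => f (x - t) := hfs.comp (contDiff_const.sub contDiff_id)
  have hφc : HasCompactSupport fun t => f (x - t) :=
    hfc.comp_homeomorph (Homeomorph.subLeft x)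
  have h3 := hg _ hφ hφc j
  have h4 : ∀ t, fderiv ℝ (fun t => f (x - t)) t (EuclideanSpace.single j 1) =
      - fderiv ℝ f (x - t) (EuclideanSpace.single j 1) := by
    intro t
    have hd : HasFDerivAt (fun t => x - t) (-(ContinuousLinearMap.id ℝ (Space d))) t :=
      (hasFDerivAt_id t).const_sub x
    have := ((hfs.differentiable (by simp) (x - t)).hasFDerivAt.comp t hd).fderiv
    have h5 : fderiv ℝ (fun t => f (x - t)) t = _ := this
    rw [h5]
    simp
  rw [h2, mollify_apply', ← integral_sub_left_eq_self _ volume x]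
  simp only [h4, neg_smul, integral_neg, neg_inj] at h3
  simpa using h3

/-- A Lipschitz function is weakly differentiable, its weak gradient being the pointwise one. -/
theorem isWeakGradient_of_lipschitzWith {f : Space d → ℂ} {K : ℝ≥0} (hf : LipschitzWith K f) :
    IsWeakGradient f fun x j => fderiv ℝ f x (EuclideanSpace.single j 1) := by
  intro φ hφ hφc j
  obtain ⟨Kφ, hKφ⟩ := (hφ.of_le (by simp)).lipschitzWith_of_hasCompactSupport hφc
    (one_ne_zero : (1 : ℕ∞ω) ≠ 0)
  set v : Space d := EuclideanSpace.single j 1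
  have hI1 : Integrable fun x => (fderiv ℝ φ x v) • f x := by
    refine Continuous.integrable_of_hasCompactSupport ?_ ?_
    · have := hφ.continuous_fderiv (by simp)
      exact (this.clm_apply continuous_const).smul hf.continuous
    · exact (hφc.fderiv_apply (𝕜 := ℝ) v).smul_right
  have hI2 : Integrable fun x => φ x • fderiv ℝ f x v := by
    have h1 : Integrable φ := hφ.continuous.integrable_of_hasCompactSupport hφc
    refine Integrable.smul_of_top_left h1 (memLp_top_of_bound
      (measurable_fderiv_apply_const ℝ f v).aestronglyMeasurable (K * ‖v‖) (.of_forall fun x => ?_))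
    exact ((fderiv ℝ f x).le_opNorm v).trans (by
      gcongr; exact norm_fderiv_le_of_lipschitz ℝ hf)
  -- Integration by parts for real Lipschitz functions is applied to the real and imaginary parts
  -- separately.
  have key : ∀ L : ℂ →L[ℝ] ℝ,
      L (∫ x, (fderiv ℝ φ x v) • f x) = L (-∫ x, φ x • fderiv ℝ f x v) := by
    intro L
    have hLf : LipschitzWith (‖L‖₊ * K) fun x => L (f x) := L.lipschitz.comp hf
    have h := hLf.integral_lineDeriv_mul_eq (μ := volume) hKφ hφc v
    rw [map_neg, ← L.integral_comp_comm hI1, ← L.integral_comp_comm hI2]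
    have e1 : ∫ x, lineDeriv ℝ (fun x => L (f x)) x v * φ x = ∫ x, L (φ x • fderiv ℝ f x v) := by
      refine integral_congr_ae ?_
      filter_upwards [hf.ae_differentiableAt (μ := volume)] with x hx
      have : HasFDerivAt (fun x => L (f x)) (L.comp (fderiv ℝ f x)) x :=
        L.hasFDerivAt.comp x hx.hasFDerivAt
      rw [(this.hasLineDerivAt v).lineDeriv, map_smul, smul_eq_mul, mul_comm]
      rfl
    have e2 : ∫ x, lineDeriv ℝ φ x (-v) * L (f x) = -∫ x, L ((fderiv ℝ φ x v) • f x) := by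
      rw [← integral_neg]
      refine integral_congr_ae (.of_forall fun x => ?_)
      have hd := hφ.differentiable (by simp) x
      simp only [hd.lineDeriv_eq_fderiv, map_neg, map_smul, smul_eq_mul, neg_mul]
    rw [e1, e2] at h
    rw [h, neg_neg]
  exact Complex.ext (key Complex.reCLM) (key Complex.imCLM)

theorem norm_mollify_le (ρ : ContDiffBump (0 : Space d)) {u : Space d → ℂ} {M : ℝ}
    (hM : ∀ x, ‖u x‖ ≤ M) (x : Space d) : ‖mollify ρ u x‖ ≤ M := by
  rw [mollify_apply]
  calc ‖∫ t, ρ.normed volume t • u (x - t)‖ ≤ ∫ t, ρ.normed volume t * M := by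
        refine norm_integral_le_of_norm_le (ρ.integrable_normed.mul_const M) (.of_forall fun t => ?_)
        rw [norm_smul, Real.norm_of_nonneg (ρ.nonneg_normed t)]
        exact mul_le_mul_of_nonneg_left (hM _) (ρ.nonneg_normed t)
    _ = M := by rw [integral_mul_const, ρ.integral_normed, one_mul]

theorem mollify_eq_zero {r : ℝ} (hr : 0 < r) {u : Space d → ℂ} {x : Space d}
    (hx : x ∉ Metric.cthickening r (tsupport u)) : mollify (bump d r hr) u x = 0 := by
  rw [mollify_apply]
  refine integral_eq_zero_of_ae (.of_forall fun t => ?_)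
  by_cases ht : t ∈ Metric.ball (0 : Space d) r
  · have : x - t ∉ tsupport u := fun h => hx (by
      refine Metric.mem_cthickening_of_dist_le x (x - t) r _ h ?_
      rw [dist_eq_norm, sub_sub_cancel]
      exact (mem_ball_zero_iff.1 ht).le)
    simp only [image_eq_zero_of_notMem_tsupport this, smul_zero, Pi.zero_apply]
  · have : (bump d r hr).normed volume t = 0 := by
      rw [← Function.notMem_support, (bump d r hr).support_normed_eq]
      exact ht
    simp only [this, zero_smul, Pi.zero_apply]

theorem mollify_congr_tsupport_subset {r : ℝ} (hr : 0 < r) (u : Space d → ℂ) :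
    tsupport (mollify (bump d r hr) u) ⊆ Metric.cthickening r (tsupport u) := by
  refine closure_minimal (fun x hx => ?_) Metric.isClosed_cthickening
  by_contra h
  exact hx (mollify_eq_zero hr h)

theorem ae_tendsto_mollify {r : ℕ → ℝ} (hr : ∀ n, 0 < r n) (hr0 : Tendsto r atTop (𝓝 0))
    {u : Space d → ℂ} (hu : LocallyIntegrable u) :
    ∀ᵐ x, Tendsto (fun n => mollify (bump d (r n) (hr n)) u x) atTop (𝓝 (u x)) :=
  ContDiffBump.ae_convolution_tendsto_right_of_locallyIntegrable (K := 2) hr0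
    (.of_forall fun n => (by change r n ≤ 2 * (r n / 2); linarith)) hu

/-- Bounded convergence in `L²` for functions with support in a common set of finite measure. -/
theorem tendsto_eLpNorm_two_zero {α : Type*} [MeasurableSpace α] {μ : Measure α}
    {F : ℕ → α → ℂ} {B : Set α} (hB : MeasurableSet B) (hBf : μ B ≠ ⊤) {M : ℝ}
    (hm : ∀ n, AEStronglyMeasurable (F n) μ) (hb : ∀ n, ∀ᵐ x ∂μ, ‖F n x‖ ≤ M)
    (h0 : ∀ n, ∀ᵐ x ∂μ, x ∉ B → F n x = 0)
    (hlim : ∀ᵐ x ∂μ, Tendsto (fun n => F n x) atTop (𝓝 0)) :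
    Tendsto (fun n => eLpNorm (F n) 2 μ) atTop (𝓝 0) := by
  have hL : Tendsto (fun n => ∫⁻ x, ‖F n x‖ₑ ^ (2 : ℝ) ∂μ) atTop (𝓝 (∫⁻ _, 0 ∂μ)) := by
    refine tendsto_lintegral_of_dominated_convergence'
      (B.indicator fun _ => ENNReal.ofReal M ^ (2 : ℝ)) ?_ ?_ ?_ ?_
    · intro n
      exact (hm n).enorm.pow_const _
    · intro n
      filter_upwards [hb n, h0 n] with x h1 h2
      by_cases hx : x ∈ B
      · rw [Set.indicator_of_mem hx, ← ofReal_norm]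
        gcongr
      · rw [h2 hx]; simp
    · rw [lintegral_indicator hB, setLIntegral_const]
      finiteness
    · filter_upwards [hlim] with x hx
      have h1 : Tendsto (fun n => ‖F n x‖ₑ) atTop (𝓝 0) := by simpa using hx.enorm
      have := ((ENNReal.continuous_rpow_const (y := 2)).tendsto 0).comp h1
      simpa [Function.comp_def] using this
  rw [lintegral_zero] at hL
  have h2 := ((ENNReal.continuous_rpow_const (y := 1 / 2)).tendsto 0).comp hL
  simp only [ENNReal.zero_rpow_of_pos (by norm_num : (0 : ℝ) < 1 / 2), Function.comp_def] at h2
  refine h2.congr fun n => ?_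
  rw [eLpNorm_eq_lintegral_rpow_enorm_toReal (by simp) (by simp)]
  simp

/-! ### Lipschitz functions vanishing outside a set belong to `H¹₀` -/

/-- The `j`-th partial derivative. -/
def pderiv (j : Fin d) (f : Space d → ℂ) (x : Space d) : ℂ :=
  fderiv ℝ f x (EuclideanSpace.single j 1)

theorem norm_pderiv_le {f : Space d → ℂ} {K : ℝ≥0} (hf : LipschitzWith K f) (j : Fin d)
    (x : Space d) : ‖pderiv j f x‖ ≤ K := by
  refine ((fderiv ℝ f x).le_opNorm _).trans ?_
  have : ‖EuclideanSpace.single j (1 : ℝ)‖ = 1 := by simp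
  rw [this, mul_one]
  exact norm_fderiv_le_of_lipschitz ℝ hf

theorem measurable_pderiv (j : Fin d) (f : Space d → ℂ) : Measurable (pderiv j f) :=
  measurable_fderiv_apply_const ℝ f _

theorem pderiv_eq_zero_of_notMem_tsupport {f : Space d → ℂ} {x : Space d} (hx : x ∉ tsupport f)
    (j : Fin d) : pderiv j f x = 0 := by
  rw [pderiv, image_eq_zero_of_notMem_tsupport fun h => hx (tsupport_fderiv_subset ℝ h),
    zero_apply]

/-- The test functions in `O` approximating the pair `(v, g)` up to `δ` in `L²`. -/
def IsApprox (O : Set (Space d)) (v : Space d → ℂ) (g : Space d → Fin d → ℂ) (δ : ℝ≥0∞)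
    (φ : Space d → ℂ) : Prop :=
  (ContDiff ℝ ∞ φ ∧ HasCompactSupport φ ∧ tsupport φ ⊆ O) ∧
    eLpNorm (fun x => φ x - v x) 2 volume ≤ δ ∧
    ∀ j, eLpNorm (fun x => pderiv j φ x - g x j) 2 volume ≤ δ

theorem memH10_of_isApprox {O : Set (Space d)} {v : Space d → ℂ} {g : Space d → Fin d → ℂ}
    (hv : MemLp v 2 volume) (hg : ∀ j, MemLp (fun x => g x j) 2 volume)
    (h : ∀ δ : ℝ≥0∞, 0 < δ → ∃ φ, IsApprox O v g δ φ) : MemH10 O v g := by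
  have hδ : ∀ n : ℕ, (0 : ℝ≥0∞) < ((n : ℝ≥0∞) + 1)⁻¹ := fun n => by
    rw [ENNReal.inv_pos]; finiteness
  choose φ hφ using fun n : ℕ => h _ (hδ n)
  have hlim : Tendsto (fun n : ℕ => ((n : ℝ≥0∞) + 1)⁻¹) atTop (𝓝 0) := by
    have := (tendsto_add_atTop_iff_nat 1).2 ENNReal.tendsto_inv_nat_nhds_zero
    simpa using this
  exact ⟨hv, hg, φ, fun n => (hφ n).1,
    tendsto_of_tendsto_of_tendsto_of_le_of_le tendsto_const_nhds hlim (fun _ => zero_le)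
      fun n => (hφ n).2.1,
    fun j => tendsto_of_tendsto_of_tendsto_of_le_of_le tendsto_const_nhds hlim
      (fun _ => zero_le) fun n => (hφ n).2.2 j⟩

/-- Mollification at scales below the distance to the complement of O stays inside O and commutes
with differentiation. Values and gradients are uniformly bounded with supports in one compact set,
so bounded convergence gives convergence in L². -/
theorem exists_isApprox_of_tsupport_subset {O : Set (Space d)} (hO : IsOpen O)
    {f : Space d → ℂ} {K : ℝ≥0} (hf : LipschitzWith K f) (hfc : HasCompactSupport f)
    (hsub : tsupport f ⊆ O) {δ : ℝ≥0∞} (hδ : 0 < δ) :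
    ∃ φ, IsApprox O f (fun x j => pderiv j f x) δ φ := by
  obtain ⟨r₀, hr₀, hth⟩ := hfc.isCompact.exists_cthickening_subset_open hO hsub
  set r : ℕ → ℝ := fun n => r₀ / (n + 1) with hrdef
  have hr : ∀ n, 0 < r n := fun n => by positivity
  have hrle : ∀ n, r n ≤ r₀ := fun n => by
    rw [hrdef]
    exact div_le_self hr₀.le (by linarith [(Nat.cast_nonneg n : (0 : ℝ) ≤ n)])
  have hr0 : Tendsto r atTop (𝓝 0) := by
    have := (tendsto_one_div_add_atTop_nhds_zero_nat (𝕜 := ℝ)).const_mul r₀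
    simpa [hrdef, div_eq_mul_inv] using this
  set φ : ℕ → Space d → ℂ := fun n => mollify (bump d (r n) (hr n)) f with hφ
  set B := Metric.cthickening r₀ (tsupport f) with hB
  have hBm : MeasurableSet B := Metric.isClosed_cthickening.measurableSet
  have hBc : IsCompact B := hfc.isCompact.cthickening
  have hBf : volume B ≠ ⊤ := hBc.measure_lt_top.ne
  have hfl : LocallyIntegrable f := hf.continuous.locallyIntegrable
  have hsupp : ∀ n, tsupport (φ n) ⊆ B := fun n =>
    (mollify_congr_tsupport_subset (hr n) f).trans (Metric.cthickening_mono (hrle n) _)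
  have hfB : tsupport f ⊆ B := Metric.self_subset_cthickening _
  have hsm : ∀ n, ContDiff ℝ ∞ (φ n) := fun n => contDiff_mollify _ hfl
  obtain ⟨M, hM⟩ := hfc.exists_bound_of_continuous hf.continuous
  have h1 : Tendsto (fun n => eLpNorm (fun x => φ n x - f x) 2 volume) atTop (𝓝 0) := by
    refine tendsto_eLpNorm_two_zero hBm hBf (M := M + M) (fun n => ?_) (fun n => .of_forall fun x => ?_)
      (fun n => .of_forall fun x hx => ?_) ?_
    · exact ((hsm n).continuous.sub hf.continuous).aestronglyMeasurable
    · exact (norm_sub_le _ _).trans (add_le_add (norm_mollify_le _ hM x) (hM x))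
    · simp only [image_eq_zero_of_notMem_tsupport fun h => hx (hsupp n h),
        image_eq_zero_of_notMem_tsupport fun h => hx (hfB h), sub_self]
    · filter_upwards [ae_tendsto_mollify hr hr0 hfl] with x hx
      simpa using hx.sub_const (f x)
  have h2 : ∀ j, Tendsto (fun n => eLpNorm (fun x => pderiv j (φ n) x - pderiv j f x) 2 volume)
      atTop (𝓝 0) := by
    intro j
    have hgl : LocallyIntegrable (pderiv j f) :=
      (memLp_top_of_bound (measurable_pderiv j f).aestronglyMeasurable K
        (.of_forall (norm_pderiv_le hf j))).locallyIntegrable le_top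
    have hgm : ∀ n, pderiv j (φ n) = mollify (bump d (r n) (hr n)) (pderiv j f) := fun n => by
      ext x
      exact fderiv_mollify _ hfl (isWeakGradient_of_lipschitzWith hf) x j
    refine tendsto_eLpNorm_two_zero hBm hBf (M := K + K) (fun n => ?_) (fun n => .of_forall fun x => ?_)
      (fun n => .of_forall fun x hx => ?_) ?_
    · exact ((measurable_pderiv j _).sub (measurable_pderiv j _)).aestronglyMeasurable
    · refine (norm_sub_le _ _).trans (add_le_add ?_ (norm_pderiv_le hf j x))
      rw [hgm]
      exact norm_mollify_le _ (norm_pderiv_le hf j) x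
    · simp only [pderiv_eq_zero_of_notMem_tsupport fun h => hx (hsupp n h),
        pderiv_eq_zero_of_notMem_tsupport fun h => hx (hfB h), sub_self]
    · filter_upwards [ae_tendsto_mollify hr hr0 hgl] with x hx
      simp only [hgm]
      simpa using hx.sub_const (pderiv j f x)
  have hev := (h1.eventually_le_const hδ).and
    (eventually_all.2 fun j => (h2 j).eventually_le_const hδ)
  obtain ⟨n, hn1, hn2⟩ := hev.exists
  exact ⟨φ n, ⟨hsm n, hBc.of_isClosed_subset (isClosed_tsupport _) (hsupp n),
    (hsupp n).trans hth⟩, hn1, hn2⟩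

/-- A Lipschitz function vanishing outside `O` is close in `H¹` to Lipschitz functions with compact
support in `O`. -/
theorem exists_lipschitz_cutoff {O : Set (Space d)} (hO : IsOpen O) (hOb : Bornology.IsBounded O)
    (hOc : Oᶜ.Nonempty) (hOf : volume (frontier O) = 0) {f : Space d → ℂ} {L : ℝ≥0}
    (hf : LipschitzWith L f) (h0 : ∀ x ∉ O, f x = 0) {δ : ℝ≥0∞} (hδ : 0 < δ) :
    ∃ h : Space d → ℂ, (∃ K, LipschitzWith K h) ∧ HasCompactSupport h ∧ tsupport h ⊆ O ∧
      eLpNorm (fun x => h x - f x) 2 volume ≤ δ ∧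
      ∀ j, eLpNorm (fun x => pderiv j h x - pderiv j f x) 2 volume ≤ δ := by
  set D : Space d → ℝ := fun x => Metric.infDist x Oᶜ with hD
  have hDc : Continuous D := Metric.continuous_infDist_pt _
  have hDL : ∀ x y, |D x - D y| ≤ ‖x - y‖ := by
    intro x y
    have := (Metric.lipschitz_infDist_pt Oᶜ).dist_le_mul x y
    simpa [Real.dist_eq, dist_eq_norm] using this
  have hD0 : ∀ x, 0 ≤ D x := fun x => Metric.infDist_nonneg
  have hDpos : ∀ x, x ∈ O ↔ 0 < D x := fun x => by
    have := hO.isClosed_compl.notMem_iff_infDist_pos (x := x) hOc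
    simpa using this
  -- Vanishing off O makes f at most L times the distance to the complement. This compensates for
  -- the steep slope of the cutoff.
  have hfD : ∀ x, ‖f x‖ ≤ L * D x := by
    intro x
    obtain ⟨y, hy, hxy⟩ := hO.isClosed_compl.exists_infDist_eq_dist hOc x
    have := hf.dist_le_mul x y
    rw [h0 y hy, dist_zero_right] at this
    simp only [hD]
    rwa [hxy]
  set s : ℕ → ℝ := fun n => 1 / ((n : ℝ) + 1) with hs
  have hs0 : ∀ n, 0 < s n := fun n => by positivity
  have hs1 : ∀ n, s n ≤ 1 := fun n => by
    rw [hs]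
    exact (div_le_one (by positivity)).2 (by linarith [(Nat.cast_nonneg n : (0 : ℝ) ≤ n)])
  have hslim : Tendsto s atTop (𝓝 0) := tendsto_one_div_add_atTop_nhds_zero_nat
  -- the cut-off function of the distance to the complement
  set m : ℕ → ℝ → ℝ := fun n t => min 1 (max 0 ((t - s n) / s n)) with hm
  have hm01 : ∀ n t, 0 ≤ m n t ∧ m n t ≤ 1 := fun n t =>
    ⟨le_min zero_le_one (le_max_left _ _), min_le_left _ _⟩
  have hmL : ∀ n a b, |m n a - m n b| ≤ |a - b| / s n := by
    intro n a b
    refine (abs_min_sub_min_le_max _ _ _ _).trans ?_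
    rw [sub_self, abs_zero, max_eq_right (abs_nonneg _), max_comm, max_comm (0 : ℝ)]
    refine (abs_max_sub_max_le_abs _ _ _).trans (le_of_eq ?_)
    rw [← sub_div, sub_sub_sub_cancel_right, abs_div, abs_of_pos (hs0 n)]
  have hm1 : ∀ n t, 2 * s n ≤ t → m n t = 1 := by
    intro n t ht
    refine min_eq_left (le_max_of_le_right ?_)
    rw [le_div_iff₀ (hs0 n)]; linarith
  have hm0 : ∀ n t, t ≤ s n → m n t = 0 := by
    intro n t ht
    simp only [hm]
    rw [max_eq_left (div_nonpos_of_nonpos_of_nonneg (by linarith) (hs0 n).le)]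
    simp
  -- This is the part to be removed; it lives in the boundary layer D ≤ 2 s_n.
  set e : ℕ → Space d → ℂ := fun n x => ((1 - m n (D x) : ℝ) : ℂ) * f x with he
  have hnorm : ∀ n x, ‖((1 - m n (D x) : ℝ) : ℂ)‖ ≤ 1 := fun n x => by
    rw [Complex.norm_real, Real.norm_of_nonneg (by linarith [(hm01 n (D x)).2])]
    linarith [(hm01 n (D x)).1]
  -- The slope 1/s_n of the cutoff is multiplied by values |f| ≤ 2L s_n, so the Lipschitz constants
  -- do not blow up with n.
  have heL : ∀ n, LipschitzWith (3 * L) (e n) := by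
    intro n
    have key : ∀ x y, D y ≤ 2 * s n → ‖e n x - e n y‖ ≤ 3 * L * ‖x - y‖ := by
      intro x y hy
      have h1 : ‖f x - f y‖ ≤ L * ‖x - y‖ := by
        have := hf.dist_le_mul x y
        rwa [dist_eq_norm, dist_eq_norm] at this
      have h2 : ‖((m n (D y) - m n (D x) : ℝ) : ℂ)‖ ≤ ‖x - y‖ / s n := by
        rw [Complex.norm_real, Real.norm_eq_abs, abs_sub_comm]
        exact (hmL n _ _).trans (div_le_div_of_nonneg_right (hDL x y) (hs0 n).le)
      have h3 : ‖f y‖ ≤ L * (2 * s n) := (hfD y).trans (by gcongr)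
      calc ‖e n x - e n y‖ = ‖((1 - m n (D x) : ℝ) : ℂ) * (f x - f y) +
            ((m n (D y) - m n (D x) : ℝ) : ℂ) * f y‖ := by
            congr 1; simp only [he]; push_cast; ring
        _ ≤ 1 * (L * ‖x - y‖) + ‖x - y‖ / s n * (L * (2 * s n)) := by
            refine (norm_add_le _ _).trans ?_
            rw [norm_mul, norm_mul]
            gcongr
            exact hnorm n x
        _ = 3 * L * ‖x - y‖ := by field_simp [(hs0 n).ne']; ring
    refine LipschitzWith.of_dist_le_mul fun x y => ?_
    rw [dist_eq_norm, dist_eq_norm]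
    push_cast
    by_cases hy : D y ≤ 2 * s n
    · exact key x y hy
    by_cases hx : D x ≤ 2 * s n
    · rw [norm_sub_rev, norm_sub_rev x]
      exact key y x hx
    · simp only [he, hm1 n _ (not_le.1 hy).le, hm1 n _ (not_le.1 hx).le]
      simp only [sub_self, Complex.ofReal_zero, zero_mul, norm_zero]
      positivity
  have heO : ∀ n, ∀ x ∉ O, e n x = 0 := fun n x hx => by simp only [he, h0 x hx, mul_zero]
  have hOm := hO.measurableSet
  have hOt : volume O ≠ ⊤ := hOb.measure_lt_top.ne
  -- Near each fixed point of O the removed part is eventually zero. Since the frontier is null,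
  -- bounded convergence then applies to both the function and its derivatives.
  have hev : ∀ x ∈ O, ∀ᶠ n in atTop, ∀ᶠ y in 𝓝 x, e n y = 0 := by
    intro x hx
    have hx' := (hDpos x).1 hx
    have : ∀ᶠ n in atTop, 2 * s n < D x := by
      have h := hslim.const_mul 2
      rw [mul_zero] at h
      exact h.eventually_lt_const hx'
    filter_upwards [this] with n hn
    filter_upwards [hDc.continuousAt.eventually_const_lt hn] with y hy
    simp [he, hm1 n _ hy.le]
  have hle : ∀ n x, ‖e n x‖ ≤ 2 * L := by
    intro n x
    by_cases hx : D x ≤ 2 * s n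
    · calc ‖e n x‖ ≤ 1 * (L * D x) := by
            simp only [he, norm_mul]
            gcongr
            exacts [hnorm n x, hfD x]
        _ ≤ 1 * (L * 2) := by
            gcongr
            linarith [hs1 n]
        _ = 2 * L := by ring
    · simp [he, hm1 n _ (not_le.1 hx).le]
  have hfr := measure_eq_zero_iff_ae_notMem.1 hOf
  have h1 : Tendsto (fun n => eLpNorm (e n) 2 volume) atTop (𝓝 0) := by
    refine tendsto_eLpNorm_two_zero hOm hOt (fun n => (heL n).continuous.aestronglyMeasurable)
      (fun n => .of_forall (hle n)) (fun n => .of_forall (heO n)) (.of_forall fun x => ?_)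
    by_cases hx : x ∈ O
    · refine tendsto_const_nhds.congr' ?_
      filter_upwards [hev x hx] with n hn
      exact hn.self_of_nhds.symm
    · simp only [heO _ x hx]; exact tendsto_const_nhds
  have h2 : ∀ j, Tendsto (fun n => eLpNorm (pderiv j (e n)) 2 volume) atTop (𝓝 0) := by
    intro j
    have hout : ∀ n, ∀ x, x ∉ frontier O → x ∉ O → pderiv j (e n) x = 0 := by
      intro n x hxf hx
      refine pderiv_eq_zero_of_notMem_tsupport (fun h => ?_) j
      have hsub : tsupport (e n) ⊆ closure O := closure_mono fun y hy => by
        by_contra hyO; exact hy (heO n y hyO)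
      rw [hO.frontier_eq] at hxf
      exact hxf ⟨hsub h, hx⟩
    refine tendsto_eLpNorm_two_zero hOm hOt
      (fun n => (measurable_pderiv j _).aestronglyMeasurable)
      (fun n => .of_forall (norm_pderiv_le (heL n) j)) (fun n => ?_) ?_
    · filter_upwards [hfr] with x hxf hx
      exact hout n x hxf hx
    · filter_upwards [hfr] with x hxf
      by_cases hx : x ∈ O
      · refine tendsto_const_nhds.congr' ?_
        filter_upwards [hev x hx] with n hn
        have : e n =ᶠ[𝓝 x] fun _ => 0 := hn
        rw [pderiv, this.fderiv_eq]
        simp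
      · simp only [hout _ x hxf hx]; exact tendsto_const_nhds
  have hboth := (h1.eventually_le_const hδ).and
    (eventually_all.2 fun j => (h2 j).eventually_le_const hδ)
  obtain ⟨n, hn1, hn2⟩ := hboth.exists
  have hLh : LipschitzWith (L + 3 * L) fun x => f x - e n x := hf.sub (heL n)
  have hsubO : tsupport (fun x => f x - e n x) ⊆ {x | s n ≤ D x} := by
    refine closure_minimal (fun x hx => ?_) (isClosed_le continuous_const hDc)
    by_contra hlt
    refine hx ?_
    simp only [Set.mem_ofPred_eq, not_le] at hlt
    simp [he, hm0 n _ hlt.le]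
  have hsubO' : {x | s n ≤ D x} ⊆ O := fun x hx => (hDpos x).2 ((hs0 n).trans_le hx)
  refine ⟨fun x => f x - e n x, ⟨_, hLh⟩, ?_, hsubO.trans hsubO', ?_, fun j => ?_⟩
  · exact hOb.isCompact_closure.of_isClosed_subset (isClosed_tsupport _)
      ((hsubO.trans hsubO').trans subset_closure)
  · refine le_trans (le_of_eq ?_) hn1
    rw [← eLpNorm_neg]
    congr 1
    ext x
    simp
  · refine le_trans (le_of_eq ?_) (hn2 j)
    rw [← eLpNorm_neg]
    refine eLpNorm_congr_ae ?_
    filter_upwards [hf.ae_differentiableAt (μ := volume), (heL n).ae_differentiableAt (μ := volume)]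
      with x hx1 hx2
    simp only [pderiv, Pi.neg_apply]
    rw [fderiv_fun_sub hx1 hx2]
    simp

/-- Cut off near the boundary, then mollify, spending δ/2 on each. The functions coming from the
reflection are only Lipschitz, hence the need for this. -/
theorem memH10_of_lipschitzWith {O : Set (Space d)} (hO : IsOpen O) (hOb : Bornology.IsBounded O)
    (hOc : Oᶜ.Nonempty) (hOf : volume (frontier O) = 0) {f : Space d → ℂ} {L : ℝ≥0}
    (hf : LipschitzWith L f) (h0 : ∀ x ∉ O, f x = 0) : MemH10 O f fun x j => pderiv j f x := by
  have hcs : HasCompactSupport f := HasCompactSupport.intro hOb.isCompact_closure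
    fun x hx => h0 x fun h => hx (subset_closure h)
  refine memH10_of_isApprox (hf.continuous.memLp_of_hasCompactSupport hcs) (fun j => ?_)
    fun δ hδ => ?_
  · have hc : volume (tsupport f) ≠ ⊤ := hcs.isCompact.measure_lt_top.ne
    have : MemLp ((tsupport f).indicator (pderiv j f)) 2 volume := by
      rw [memLp_indicator_iff_restrict (isClosed_tsupport f).measurableSet]
      have : IsFiniteMeasure (volume.restrict (tsupport f)) := ⟨by simpa using hc.lt_top⟩
      exact MemLp.of_bound (measurable_pderiv j f).aestronglyMeasurable L
        (.of_forall (norm_pderiv_le hf j))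
    rwa [Set.indicator_eq_self.2] at this
    intro x hx
    by_contra h
    exact hx (pderiv_eq_zero_of_notMem_tsupport h j)
  · have hδ2 : 0 < δ / 2 := ENNReal.half_pos hδ.ne'
    obtain ⟨h, ⟨K, hK⟩, hc, hsub, h1, h2⟩ := exists_lipschitz_cutoff hO hOb hOc hOf hf h0 hδ2
    obtain ⟨φ, hφ, k1, k2⟩ := exists_isApprox_of_tsupport_subset hO hK hc hsub hδ2
    have key : ∀ a b c : Space d → ℂ, AEStronglyMeasurable a volume →
        AEStronglyMeasurable b volume → AEStronglyMeasurable c volume →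
        eLpNorm (fun x => a x - b x) 2 volume ≤ δ / 2 →
        eLpNorm (fun x => b x - c x) 2 volume ≤ δ / 2 →
        eLpNorm (fun x => a x - c x) 2 volume ≤ δ := by
      intro a b c ha hb hc hab hbc
      have : (fun x => a x - c x) = (fun x => a x - b x) + fun x => b x - c x := by
        ext x; simp
      rw [this]
      refine (eLpNorm_add_le (ha.sub hb) (hb.sub hc) (by norm_num)).trans ?_
      exact (add_le_add hab hbc).trans_eq (ENNReal.add_halves δ)
    refine ⟨φ, hφ, ?_, fun j => ?_⟩
    · exact key _ h _ hφ.1.continuous.aestronglyMeasurable hK.continuous.aestronglyMeasurable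
        hf.continuous.aestronglyMeasurable k1 h1
    · exact key _ (pderiv j h) _ (measurable_pderiv j φ).aestronglyMeasurable
        (measurable_pderiv j h).aestronglyMeasurable (measurable_pderiv j f).aestronglyMeasurable
        (k2 j) (h2 j)

/-! ### The abstract two-scale resolvent estimate -/

/-- The Lax–Milgram lemma in operator form. -/
theorem surjective_of_coercive {V : Type*} [NormedAddCommGroup V] [InnerProductSpace ℂ V]
    [CompleteSpace V] (B : V →L[ℂ] V) {c : ℝ} (hc : 0 < c)
    (h : ∀ x, c * ‖x‖ ^ 2 ≤ (inner ℂ x (B x)).re) : Function.Surjective B := by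
  have hu := ContinuousLinearMap.isUnit_of_forall_le_norm_inner_map B (c := ⟨c, hc.le⟩) hc
    fun x => by
      calc ‖x‖ ^ 2 * c = c * ‖x‖ ^ 2 := mul_comm _ _
        _ ≤ (inner ℂ x (B x)).re := h x
        _ ≤ ‖inner ℂ x (B x)‖ := Complex.re_le_norm _
        _ = ‖inner ℂ (B x) x‖ := norm_inner_symm _ _
  exact (ContinuousLinearMap.isUnit_iff_bijective.1 hu).2

/-- Removes the slack δ left by the field `approx`. -/
theorem le_of_forall_pos_le_add_mul {a b c : ℝ} (hc : 0 ≤ c)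
    (h : ∀ δ > 0, a ≤ b + c * δ) : a ≤ b := by
  refine le_of_forall_pos_le_add fun η hη => ?_
  refine (h (η / (c + 1)) (by positivity)).trans ?_
  gcongr
  rw [mul_div_assoc', div_le_iff₀ (by positivity)]
  nlinarith

/-- The data of a family of fibre problems: `X` and `Y` stand for the scalar and the vector valued
`L²` spaces of the cell, `H` for the graph of the gradient on periodic functions, `H₀` for its
restriction to functions supported in the soft part, `shift κ` for the multiplication by `iκ`. -/
structure FibreModel (d : ℕ) (X Y : Type*) [NormedAddCommGroup X] [InnerProductSpace ℂ X]
    [NormedAddCommGroup Y] [InnerProductSpace ℂ Y] where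
  one : X
  H : Submodule ℂ (WithLp 2 (X × Y))
  H₀ : Submodule ℂ (WithLp 2 (X × Y))
  shift : Space d → X →L[ℂ] Y
  M₀ : Y →L[ℂ] Y
  M₁ : Y →L[ℂ] Y
  dual : Set (Space d)
  ν : ℝ
  μ : ℝ
  β : ℝ
  K : ℝ
  R : ℝ
  γ : ℝ
  ν_pos : 0 < ν
  β_pos : 0 < β
  γ_pos : 0 < γ
  K_nonneg : 0 ≤ K
  μ_nonneg : 0 ≤ μ
  norm_one_le : ‖one‖ ≤ 1
  isClosed_H : IsClosed (H : Set (WithLp 2 (X × Y)))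
  isClosed_H₀ : IsClosed (H₀ : Set (WithLp 2 (X × Y)))
  le : H₀ ≤ H
  one_mem : WithLp.toLp 2 (one, (0 : Y)) ∈ H
  shift_smul : ∀ (a : ℝ) κ x, shift (a • κ) x = (a : ℂ) • shift κ x
  norm_shift_le : ∀ κ x, ‖shift κ x‖ ≤ ‖κ‖ * ‖x‖
  zero_mem_dual : 0 ∈ dual
  norm_le_of_mem_dual : ∀ κ ∈ dual, ‖κ‖ ≤ R
  coercive₀ : ∀ y, ν * ‖y‖ ^ 2 ≤ (inner ℂ y (M₀ y)).re
  symm₁ : ∀ y z, inner ℂ (M₁ y) z = inner ℂ y (M₁ z)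
  bound₁ : ∀ y, ‖M₁ y‖ ^ 2 ≤ μ * (inner ℂ y (M₁ y)).re
  nonneg₁ : ∀ y, 0 ≤ (inner ℂ y (M₁ y)).re
  M₁_grad : ∀ φ ∈ H₀, M₁ φ.snd = 0
  M₁_shift : ∀ κ, ∀ φ ∈ H₀, M₁ (shift κ φ.fst) = 0
  const_le : ∀ (c : ℂ), ∀ φ ∈ H₀, β * ‖c‖ ^ 2 ≤ ‖c • one + φ.fst‖ ^ 2
  -- The slack δ lets this property pass from smooth functions to their closure. The second bound
  -- does not subtract the shifted gradient of b: after multiplication by a plane wave the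
  -- approximating constant has zero gradient.
  approx : ∀ κ ∈ dual, ∀ p ∈ H, ∀ δ > 0, ∃ (b : ℂ), ∃ φ ∈ H₀,
    ‖p.fst - φ.fst - b • one‖ ≤
      K * √((inner ℂ (p.snd + shift κ p.fst) (M₁ (p.snd + shift κ p.fst))).re) + δ ∧
    ‖(p.snd + shift κ p.fst) - (φ.snd + shift κ φ.fst)‖ ≤
      K * √((inner ℂ (p.snd + shift κ p.fst) (M₁ (p.snd + shift κ p.fst))).re) + δ
  cell_coercive : ∀ ξ, ∀ p ∈ H,
    γ * ‖ξ‖ ^ 2 ≤ (inner ℂ (shift ξ one + p.snd) (M₁ (shift ξ one + p.snd))).re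

namespace FibreModel

variable {X Y : Type*} [NormedAddCommGroup X] [InnerProductSpace ℂ X]
    [NormedAddCommGroup Y] [InnerProductSpace ℂ Y] (S : FibreModel d X Y)

/-- The shifted gradient `∇ + iκ`. -/
def grad (κ : Space d) : WithLp 2 (X × Y) →L[ℂ] Y :=
  WithLp.sndL 2 ℂ X Y + (S.shift κ).comp (WithLp.fstL 2 ℂ X Y)

theorem grad_apply (κ : Space d) (p : WithLp 2 (X × Y)) :
    S.grad κ p = p.snd + S.shift κ p.fst := rfl

/-- The square root of the stiff quadratic form. -/
def stiffNorm (y : Y) : ℝ := √((inner ℂ y (S.M₁ y)).re)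

theorem stiffNorm_nonneg (y : Y) : 0 ≤ S.stiffNorm y := Real.sqrt_nonneg _

theorem sq_stiffNorm (y : Y) : S.stiffNorm y ^ 2 = (inner ℂ y (S.M₁ y)).re :=
  Real.sq_sqrt (S.nonneg₁ y)

theorem norm_M₁_le (y : Y) : ‖S.M₁ y‖ ≤ √S.μ * S.stiffNorm y := by
  rw [stiffNorm, ← Real.sqrt_mul S.μ_nonneg]
  exact Real.le_sqrt_of_sq_le (S.bound₁ y)

/-- The constant function `1` as an element of `H`. -/
def unit : WithLp 2 (X × Y) := WithLp.toLp 2 (S.one, (0 : Y))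

theorem unit_fst : S.unit.fst = S.one := rfl

theorem unit_snd : S.unit.snd = 0 := rfl

theorem norm_sq_le_of_grad (κ : Space d) (p : WithLp 2 (X × Y)) :
    ‖p‖ ^ 2 ≤ (1 + 2 * ‖κ‖ ^ 2) * ‖p.fst‖ ^ 2 + 2 * ‖S.grad κ p‖ ^ 2 := by
  rw [WithLp.prod_norm_sq_eq_of_L2]
  have h1 : ‖p.snd‖ ≤ ‖S.grad κ p‖ + ‖κ‖ * ‖p.fst‖ := by
    calc ‖p.snd‖ = ‖S.grad κ p - S.shift κ p.fst‖ := by rw [grad_apply, add_sub_cancel_right]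
      _ ≤ ‖S.grad κ p‖ + ‖S.shift κ p.fst‖ := norm_sub_le _ _
      _ ≤ _ := by gcongr; exact S.norm_shift_le _ _
  have h2 : ‖p.snd‖ ^ 2 ≤ (‖S.grad κ p‖ + ‖κ‖ * ‖p.fst‖) ^ 2 := by gcongr
  nlinarith [sq_nonneg (‖S.grad κ p‖ - ‖κ‖ * ‖p.fst‖)]

/-- The weak form of the fibre problem. -/
def IsFibre (ε : ℝ) (θ : Space d) (F : X) (u : WithLp 2 (X × Y)) : Prop :=
  u ∈ S.H ∧ ∀ w ∈ S.H,
    ((ε ^ 2)⁻¹ : ℝ) * inner ℂ (S.grad (ε • θ) w) (S.M₁ (S.grad (ε • θ) u)) +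
      inner ℂ (S.grad (ε • θ) w) (S.M₀ (S.grad (ε • θ) u)) + inner ℂ w.fst u.fst =
        inner ℂ w.fst F

/-- The weak form of the homogenised problem, with homogenised coefficient `α`. -/
def IsHom (α : ℝ) (κ : Space d) (F : X) (c : ℂ) (v : WithLp 2 (X × Y)) : Prop :=
  v ∈ S.H₀ ∧ ∀ (b : ℂ), ∀ φ ∈ S.H₀,
    (α : ℂ) * c * conj b + inner ℂ (S.grad κ φ) (S.M₀ (S.grad κ v)) +
      inner ℂ (b • S.one + φ.fst) (c • S.one + v.fst) = inner ℂ (b • S.one + φ.fst) F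

/-- `N` is the corrector for the direction `ξ`. -/
def IsCorrector (ξ : Space d) (N : WithLp 2 (X × Y)) : Prop :=
  N ∈ S.H ∧ ∀ w ∈ S.H, inner ℂ w.snd (S.M₁ (S.shift ξ S.one + N.snd)) = 0

/-- The homogenised quadratic form computed with a corrector. -/
def homCoeff (ξ : Space d) (N : WithLp 2 (X × Y)) : ℝ :=
  (inner ℂ (S.shift ξ S.one + N.snd) (S.M₁ (S.shift ξ S.one + N.snd))).re

theorem inner_M₁_self_eq (y : Y) : inner ℂ y (S.M₁ y) = ((inner ℂ y (S.M₁ y)).re : ℂ) := by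
  have h : conj (inner ℂ y (S.M₁ y)) = inner ℂ y (S.M₁ y) := by
    rw [inner_conj_symm, S.symm₁]
  exact (Complex.conj_eq_iff_re.1 h).symm

variable [CompleteSpace X] [CompleteSpace Y]

/-- Lax–Milgram on H: the mass term controls the function, and M₀ controls the shifted gradient,
which together control the graph norm. The stiff term is nonnegative and is discarded. -/
theorem exists_isFibre {ε : ℝ} (hε : 0 < ε) (θ : Space d) (F : X) :
    ∃ u, S.IsFibre ε θ F u := by
  have : CompleteSpace S.H := S.isClosed_H.completeSpace_coe
  set κ := ε • θ
  let T : S.H →L[ℂ] Y := (S.grad κ).comp S.H.subtypeL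
  let J : S.H →L[ℂ] X := (WithLp.fstL 2 ℂ X Y).comp S.H.subtypeL
  let M : Y →L[ℂ] Y := (((ε ^ 2)⁻¹ : ℝ) : ℂ) • S.M₁ + S.M₀
  let B : S.H →L[ℂ] S.H := T.adjoint.comp (M.comp T) + J.adjoint.comp J
  have hB : ∀ w u : S.H, inner ℂ w (B u) =
      ((ε ^ 2)⁻¹ : ℝ) * inner ℂ (S.grad κ w) (S.M₁ (S.grad κ u)) +
      inner ℂ (S.grad κ w) (S.M₀ (S.grad κ u)) + inner ℂ w.1.fst u.1.fst := by
    intro w u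
    have h1 : B u = T.adjoint (M (T u)) + J.adjoint (J u) := rfl
    rw [h1, inner_add_right, ContinuousLinearMap.adjoint_inner_right,
      ContinuousLinearMap.adjoint_inner_right]
    have h2 : M (T u) = (((ε ^ 2)⁻¹ : ℝ) : ℂ) • S.M₁ (S.grad κ u) + S.M₀ (S.grad κ u) := rfl
    rw [h2, inner_add_right, inner_smul_right]
    rfl
  have hν := S.ν_pos
  set A := (1 + 2 * ‖κ‖ ^ 2) + 2 / S.ν with hA
  have hA0 : 0 < A := by positivity
  have hsurj := surjective_of_coercive B (c := A⁻¹) (by positivity) fun p => by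
    have h1 := S.norm_sq_le_of_grad κ p.1
    have h2 := S.coercive₀ (S.grad κ p)
    have h3 := S.nonneg₁ (S.grad κ p)
    rw [hB, Complex.add_re, Complex.add_re, Complex.re_ofReal_mul]
    have h4 : (inner ℂ p.1.fst p.1.fst).re = ‖p.1.fst‖ ^ 2 := by
      rw [inner_self_eq_norm_sq_to_K]; norm_cast
    rw [h4, inv_mul_le_iff₀ hA0]
    have h5 : 0 ≤ (ε ^ 2)⁻¹ * (inner ℂ (S.grad κ p) (S.M₁ (S.grad κ p))).re := by positivity
    set g := (inner ℂ (S.grad κ p) (S.M₀ (S.grad κ p))).re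
    set q := (ε ^ 2)⁻¹ * (inner ℂ (S.grad κ p) (S.M₁ (S.grad κ p))).re
    have h6 : ‖p‖ = ‖p.1‖ := rfl
    rw [h6]
    have h7 : 2 * ‖S.grad κ p‖ ^ 2 ≤ 2 / S.ν * g := by
      rw [div_mul_eq_mul_div, le_div_iff₀ hν]; linarith
    have hg : 0 ≤ g := le_trans (by positivity) h2
    have h8 : 2 / S.ν * g ≤ A * g := by gcongr; rw [hA]; linarith [show 0 ≤ 1 + 2 * ‖κ‖ ^ 2 by positivity]
    have h9 : (1 + 2 * ‖κ‖ ^ 2) * ‖p.1.fst‖ ^ 2 ≤ A * ‖p.1.fst‖ ^ 2 := by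
      gcongr; rw [hA]; linarith [show 0 ≤ 2 / S.ν by positivity]
    have h10 : 0 ≤ A * q := by positivity
    nlinarith
  obtain ⟨u, hu⟩ := hsurj (J.adjoint F)
  refine ⟨u.1, u.2, fun w hw => ?_⟩
  have := hB ⟨w, hw⟩ u
  rw [hu, ContinuousLinearMap.adjoint_inner_right] at this
  exact this.symm

/-- Lax–Milgram on ℂ × H₀. Since α may vanish, |c| is recovered from the norm of c + v by
`const_le`, that is, from its value on the stiff part. -/
theorem exists_isHom {α : ℝ} (hα : 0 ≤ α) (κ : Space d) (F : X) :
    ∃ c v, S.IsHom α κ F c v := by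
  have : CompleteSpace S.H₀ := S.isClosed_H₀.completeSpace_coe
  let P : WithLp 2 (ℂ × S.H₀) →L[ℂ] ℂ := WithLp.fstL 2 ℂ ℂ S.H₀
  let T : WithLp 2 (ℂ × S.H₀) →L[ℂ] Y :=
    (S.grad κ).comp (S.H₀.subtypeL.comp (WithLp.sndL 2 ℂ ℂ S.H₀))
  let J : WithLp 2 (ℂ × S.H₀) →L[ℂ] X := P.smulRight S.one +
    (WithLp.fstL 2 ℂ X Y).comp (S.H₀.subtypeL.comp (WithLp.sndL 2 ℂ ℂ S.H₀))
  let B : WithLp 2 (ℂ × S.H₀) →L[ℂ] WithLp 2 (ℂ × S.H₀) :=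
    (α : ℂ) • P.adjoint.comp P + T.adjoint.comp (S.M₀.comp T) + J.adjoint.comp J
  have hJ : ∀ w : WithLp 2 (ℂ × S.H₀), J w = w.fst • S.one + w.snd.1.fst := fun _ => rfl
  have hB : ∀ w u : WithLp 2 (ℂ × S.H₀), inner ℂ w (B u) =
      (α : ℂ) * u.fst * conj w.fst + inner ℂ (S.grad κ w.snd) (S.M₀ (S.grad κ u.snd)) +
        inner ℂ (w.fst • S.one + w.snd.1.fst) (u.fst • S.one + u.snd.1.fst) := by
    intro w u
    have h1 : B u = (α : ℂ) • P.adjoint (P u) + T.adjoint (S.M₀ (T u)) + J.adjoint (J u) := rfl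
    rw [h1, inner_add_right (𝕜 := ℂ) w, inner_add_right (𝕜 := ℂ) w, inner_smul_right (𝕜 := ℂ) w,
      ContinuousLinearMap.adjoint_inner_right,
      ContinuousLinearMap.adjoint_inner_right, ContinuousLinearMap.adjoint_inner_right, mul_assoc]
    rfl
  have hν := S.ν_pos
  have hβ := S.β_pos
  set A := S.β⁻¹ + (1 + 2 * ‖κ‖ ^ 2) * (2 + 2 * S.β⁻¹) with hA
  have hA0 : 0 < A := by positivity
  have hsurj := surjective_of_coercive B (c := (A + 2 / S.ν)⁻¹) (by positivity) fun p => by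
    have h1 := S.norm_sq_le_of_grad κ p.snd.1
    have h2 := S.coercive₀ (S.grad κ p.snd)
    have h3 := S.const_le p.fst p.snd.1 p.snd.2
    rw [hB, Complex.add_re, Complex.add_re]
    have h4 : (inner ℂ (p.fst • S.one + p.snd.1.fst) (p.fst • S.one + p.snd.1.fst)).re =
        ‖p.fst • S.one + p.snd.1.fst‖ ^ 2 := by
      rw [inner_self_eq_norm_sq_to_K]; norm_cast
    have h5 : ((α : ℂ) * p.fst * conj p.fst).re = α * ‖p.fst‖ ^ 2 := by
      rw [mul_assoc, Complex.mul_conj, Complex.re_ofReal_mul, Complex.ofReal_re,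
        Complex.normSq_eq_norm_sq]
    rw [h4, h5, inv_mul_le_iff₀ (by positivity)]
    set g := (inner ℂ (S.grad κ p.snd) (S.M₀ (S.grad κ p.snd))).re
    set j := ‖p.fst • S.one + p.snd.1.fst‖
    have h6 : ‖p‖ ^ 2 = ‖p.fst‖ ^ 2 + ‖p.snd.1‖ ^ 2 := by
      rw [WithLp.prod_norm_sq_eq_of_L2]; rfl
    have h7 : ‖p.fst‖ ^ 2 ≤ S.β⁻¹ * j ^ 2 := by
      rw [inv_mul_eq_div, le_div_iff₀ hβ]; linarith
    have h8 : ‖p.snd.1.fst‖ ≤ j + ‖p.fst‖ := by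
      calc ‖p.snd.1.fst‖ = ‖(p.fst • S.one + p.snd.1.fst) - p.fst • S.one‖ := by
            rw [add_sub_cancel_left]
        _ ≤ j + ‖p.fst • S.one‖ := norm_sub_le _ _
        _ ≤ j + ‖p.fst‖ := by
            rw [norm_smul]
            gcongr
            exact mul_le_of_le_one_right (norm_nonneg _) S.norm_one_le
    have h9 : ‖p.snd.1.fst‖ ^ 2 ≤ (2 + 2 * S.β⁻¹) * j ^ 2 := by
      have : ‖p.snd.1.fst‖ ^ 2 ≤ (j + ‖p.fst‖) ^ 2 := by gcongr
      nlinarith [sq_nonneg (j - ‖p.fst‖)]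
    have h10 : 2 * ‖S.grad κ p.snd‖ ^ 2 ≤ 2 / S.ν * g := by
      rw [div_mul_eq_mul_div, le_div_iff₀ hν]; linarith
    have hg : 0 ≤ g := le_trans (by positivity) h2
    have h11 : (1 + 2 * ‖κ‖ ^ 2) * ‖p.snd.1.fst‖ ^ 2 ≤
        (1 + 2 * ‖κ‖ ^ 2) * ((2 + 2 * S.β⁻¹) * j ^ 2) := by gcongr
    have h12 : 0 ≤ (A + 2 / S.ν) * (α * ‖p.fst‖ ^ 2) := by positivity
    have h13 : 0 ≤ A * g := by positivity
    have h14 : 0 ≤ 2 / S.ν * j ^ 2 := by positivity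
    have h15 : A * j ^ 2 = S.β⁻¹ * j ^ 2 + (1 + 2 * ‖κ‖ ^ 2) * ((2 + 2 * S.β⁻¹) * j ^ 2) := by
      rw [hA]; ring
    rw [h6]
    linarith [mul_add (A + 2 / S.ν) (α * ‖p.fst‖ ^ 2 + g) (j ^ 2),
      mul_add (A + 2 / S.ν) (α * ‖p.fst‖ ^ 2) g, add_mul A (2 / S.ν) g,
      add_mul A (2 / S.ν) (j ^ 2)]
  obtain ⟨u, hu⟩ := hsurj (J.adjoint F)
  refine ⟨u.fst, u.snd.1, u.snd.2, fun b φ hφ => ?_⟩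
  have := hB (WithLp.toLp 2 (b, ⟨φ, hφ⟩)) u
  rw [hu, ContinuousLinearMap.adjoint_inner_right] at this
  exact this.symm

/-- The form ⟨∇p, M₁∇p⟩ degenerates on the closure W of H₀ + constants. On the orthogonal complement
of W in H it is coercive by `approx` at κ = 0, so Lax–Milgram applies there. -/
theorem exists_isCorrector :
    ∃ C, 0 ≤ C ∧ ∀ ξ : Space d, ∃ N, S.IsCorrector ξ N ∧ ‖N‖ ≤ C * ‖ξ‖ := by
  set V : Submodule ℂ (WithLp 2 (X × Y)) := S.H₀ ⊔ Submodule.span ℂ {S.unit} with hV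
  set W := V.topologicalClosure with hW
  have : CompleteSpace W := V.isClosed_topologicalClosure.completeSpace_coe
  have hVH : V ≤ S.H := sup_le S.le (by
    rw [Submodule.span_le, Set.singleton_subset_iff]; exact S.one_mem)
  have hWH : W ≤ S.H := Submodule.topologicalClosure_minimal _ hVH S.isClosed_H
  have hVW : V ≤ W := Submodule.le_topologicalClosure _
  have hM₁W : ∀ w ∈ W, S.M₁ w.snd = 0 := by
    let L : WithLp 2 (X × Y) →L[ℂ] Y := S.M₁.comp (WithLp.sndL 2 ℂ X Y)
    have hVL : V ≤ LinearMap.ker L.toLinearMap := by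
      refine sup_le (fun φ hφ => S.M₁_grad φ hφ) ?_
      rw [Submodule.span_le, Set.singleton_subset_iff]
      change S.M₁ S.unit.snd = 0
      rw [unit_snd, map_zero]
    exact fun w hw => Submodule.topologicalClosure_minimal _ hVL L.isClosed_ker hw
  set Z : Submodule ℂ (WithLp 2 (X × Y)) := S.H ⊓ Wᗮ with hZ
  have : CompleteSpace Z :=
    (S.isClosed_H.inter (Submodule.isClosed_orthogonal W)).completeSpace_coe
  -- An element orthogonal to W is no longer than its difference from any element of W, in
  -- particular from the approximation φ + b.
  have hcoer : ∀ p ∈ Z, ‖p‖ ≤ 2 * S.K * S.stiffNorm p.snd := by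
    rintro p ⟨hpH, hpW⟩
    refine le_of_forall_pos_le_add_mul (c := 2) (by norm_num) fun δ hδ => ?_
    obtain ⟨b, φ, hφ, h1, h2⟩ := S.approx 0 S.zero_mem_dual p hpH δ hδ
    have h0 : ∀ x, S.shift 0 x = 0 := fun x => by
      have := S.shift_smul 0 0 x
      simpa using this
    simp only [h0, add_zero] at h1 h2
    set r := p - (φ + b • S.unit) with hr
    have hmem : φ + b • S.unit ∈ W := hVW (Submodule.add_mem _ (Submodule.mem_sup_left hφ)
      (Submodule.mem_sup_right (Submodule.smul_mem _ _ (Submodule.mem_span_singleton_self _))))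
    have hrp : inner ℂ p r = inner ℂ p p := by
      rw [hr, inner_sub_right, Submodule.inner_left_of_mem_orthogonal hmem hpW, sub_zero]
    have hle : ‖p‖ ≤ ‖r‖ := by
      by_cases hp0 : ‖p‖ = 0
      · rw [hp0]; positivity
      have h3 : ‖p‖ * ‖p‖ ≤ ‖p‖ * ‖r‖ := by
        have := norm_inner_le_norm (𝕜 := ℂ) p r
        rwa [hrp, inner_self_eq_norm_sq_to_K, norm_pow, RCLike.norm_ofReal, abs_norm, sq] at this
      exact le_of_mul_le_mul_left h3 (lt_of_le_of_ne (norm_nonneg _) (Ne.symm hp0))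
    have hr1 : ‖r.fst‖ ≤ S.K * S.stiffNorm p.snd + δ := by
      have : r.fst = p.fst - φ.fst - b • S.one := by
        simp only [hr, WithLp.sub_fst, WithLp.add_fst, WithLp.smul_fst, unit_fst]; abel
      rw [this]; exact h1
    have hr2 : ‖r.snd‖ ≤ S.K * S.stiffNorm p.snd + δ := by
      have : r.snd = p.snd - φ.snd := by
        simp only [hr, WithLp.sub_snd, WithLp.add_snd, WithLp.smul_snd, unit_snd]; simp
      rw [this]; exact h2
    have hrs : ‖r‖ ≤ ‖r.fst‖ + ‖r.snd‖ := by
      refine abs_le_of_sq_le_sq' ?_ (by positivity) |>.2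
      rw [WithLp.prod_norm_sq_eq_of_L2]
      nlinarith [mul_nonneg (norm_nonneg r.fst) (norm_nonneg r.snd)]
    linarith
  let T : Z →L[ℂ] Y := (WithLp.sndL 2 ℂ X Y).comp Z.subtypeL
  let B : Z →L[ℂ] Z := T.adjoint.comp (S.M₁.comp T)
  have hB : ∀ w u : Z, inner ℂ w (B u) = inner ℂ w.1.snd (S.M₁ u.1.snd) := by
    intro w u
    have h1 : B u = T.adjoint (S.M₁ (T u)) := rfl
    rw [h1, ContinuousLinearMap.adjoint_inner_right]
    rfl
  have hK := S.K_nonneg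
  have hKpos : 0 < 4 * S.K ^ 2 + 1 := by positivity
  have hcoer2 : ∀ p : Z, ‖p‖ ^ 2 ≤ (4 * S.K ^ 2 + 1) * (inner ℂ p.1.snd (S.M₁ p.1.snd)).re := by
    intro p
    have h1 := hcoer p.1 p.2
    have h2 : ‖p.1‖ ^ 2 ≤ (2 * S.K * S.stiffNorm p.1.snd) ^ 2 := by gcongr
    rw [mul_pow, S.sq_stiffNorm] at h2
    have h3 := S.nonneg₁ p.1.snd
    calc ‖p‖ ^ 2 = ‖p.1‖ ^ 2 := rfl
      _ ≤ _ := by nlinarith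
  have hsurj := surjective_of_coercive B (c := (4 * S.K ^ 2 + 1)⁻¹) (by positivity) fun p => by
    rw [hB, inv_mul_le_iff₀ hKpos]
    exact hcoer2 p
  refine ⟨(4 * S.K ^ 2 + 1) * (‖S.M₁‖ * 1), by positivity, fun ξ => ?_⟩
  obtain ⟨N, hN⟩ := hsurj (T.adjoint (-(S.M₁ (S.shift ξ S.one))))
  have hEL : ∀ w : Z, inner ℂ w.1.snd (S.M₁ (S.shift ξ S.one + N.1.snd)) = 0 := by
    intro w
    have h1 := hB w N
    rw [hN, ContinuousLinearMap.adjoint_inner_right] at h1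
    have h2 : inner ℂ w.1.snd (-(S.M₁ (S.shift ξ S.one))) = inner ℂ w.1.snd (S.M₁ N.1.snd) := h1
    rw [map_add, inner_add_right, ← h2, inner_neg_right, add_neg_cancel]
  refine ⟨N.1, ⟨N.2.1, fun w hw => ?_⟩, ?_⟩
  -- The component of a test function in W contributes nothing, because M₁ annihilates its gradient.
  -- The equation thus extends from Z to all of H.
  · set w₁ := W.starProjection w
    have hw₁ : w₁ ∈ W := Submodule.starProjection_apply_mem W w
    have hz : w - w₁ ∈ Z := ⟨S.H.sub_mem hw (hWH hw₁), Submodule.sub_starProjection_mem_orthogonal w⟩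
    have h1 := hEL ⟨w - w₁, hz⟩
    rw [← S.symm₁]
    rw [← S.symm₁] at h1
    simpa only [WithLp.sub_snd, map_sub, hM₁W w₁ hw₁, sub_zero] using h1
  -- Testing with N itself and using coercivity gives ‖N‖² ≤ C‖N‖‖ξ‖, hence linear growth in ξ.
  · have h1 := hEL N
    rw [map_add, inner_add_right] at h1
    have h2 : (inner ℂ N.1.snd (S.M₁ N.1.snd)).re = -(inner ℂ N.1.snd (S.M₁ (S.shift ξ S.one))).re := by
      have := congrArg Complex.re h1
      rw [Complex.add_re, Complex.zero_re] at this
      linarith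
    have h3 : -(inner ℂ N.1.snd (S.M₁ (S.shift ξ S.one))).re ≤ ‖N.1‖ * (‖S.M₁‖ * (‖ξ‖ * 1)) := by
      calc -(inner ℂ N.1.snd (S.M₁ (S.shift ξ S.one))).re
          ≤ ‖inner ℂ N.1.snd (S.M₁ (S.shift ξ S.one))‖ :=
            (neg_le_abs _).trans (Complex.abs_re_le_norm _)
        _ ≤ ‖N.1.snd‖ * ‖S.M₁ (S.shift ξ S.one)‖ := norm_inner_le_norm _ _
        _ ≤ ‖N.1‖ * (‖S.M₁‖ * (‖ξ‖ * 1)) := by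
            gcongr
            · exact WithLp.norm_snd_le _ N.1
            · refine (S.M₁.le_opNorm _).trans ?_
              gcongr
              refine (S.norm_shift_le _ _).trans ?_
              gcongr
              exact S.norm_one_le
    have h4 := hcoer2 N
    rw [h2] at h4
    have h5 : ‖N.1‖ * ‖N.1‖ ≤ ‖N.1‖ * ((4 * S.K ^ 2 + 1) * (‖S.M₁‖ * 1) * ‖ξ‖) := by
      calc ‖N.1‖ * ‖N.1‖ = ‖N‖ ^ 2 := by rw [sq]; rfl
        _ ≤ (4 * S.K ^ 2 + 1) * (‖N.1‖ * (‖S.M₁‖ * (‖ξ‖ * 1))) := h4.trans (by gcongr)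
        _ = _ := by ring
    by_cases hN0 : ‖N.1‖ = 0
    · rw [hN0]; positivity
    · exact le_of_mul_le_mul_left h5 (lt_of_le_of_ne (norm_nonneg _) (Ne.symm hN0))

end FibreModel

/-! ### Uniqueness, a priori bounds and the error estimate in the abstract model -/

namespace FibreModel

variable {X Y : Type*} [NormedAddCommGroup X] [InnerProductSpace ℂ X]
    [NormedAddCommGroup Y] [InnerProductSpace ℂ Y] {S : FibreModel d X Y}

theorem re_inner_self_eq {E : Type*} [NormedAddCommGroup E] [InnerProductSpace ℂ E] (x : E) :
    (inner ℂ x x).re = ‖x‖ ^ 2 := by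
  rw [inner_self_eq_norm_sq_to_K]; norm_cast

theorem IsFibre.sub {ε : ℝ} {θ : Space d} {F F' : X} {u u' : WithLp 2 (X × Y)}
    (h : S.IsFibre ε θ F u) (h' : S.IsFibre ε θ F' u') : S.IsFibre ε θ (F - F') (u - u') := by
  refine ⟨S.H.sub_mem h.1 h'.1, fun w hw => ?_⟩
  have h1 := h.2 w hw
  have h2 := h'.2 w hw
  simp only [map_sub, inner_sub_right, WithLp.sub_fst]
  linear_combination h1 - h2

theorem IsFibre.energy {ε : ℝ} {θ : Space d} {F : X} {u : WithLp 2 (X × Y)}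
    (h : S.IsFibre ε θ F u) : ‖u.fst‖ ^ 2 ≤ (inner ℂ u.fst F).re := by
  have h1 := congrArg Complex.re (h.2 u h.1)
  have h2 := S.coercive₀ (S.grad (ε • θ) u)
  have h3 := S.nonneg₁ (S.grad (ε • θ) u)
  have hν := S.ν_pos
  rw [Complex.add_re, Complex.add_re, Complex.re_ofReal_mul, re_inner_self_eq] at h1
  have h4 : 0 ≤ (ε ^ 2)⁻¹ * (inner ℂ (S.grad (ε • θ) u) (S.M₁ (S.grad (ε • θ) u))).re := by
    positivity
  have h5 : 0 ≤ S.ν * ‖S.grad (ε • θ) u‖ ^ 2 := by positivity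
  linarith

theorem IsFibre.fst_unique {ε : ℝ} {θ : Space d} {F : X} {u u' : WithLp 2 (X × Y)}
    (h : S.IsFibre ε θ F u) (h' : S.IsFibre ε θ F u') : u.fst = u'.fst := by
  have h1 := (h.sub h').energy
  rw [sub_self, inner_zero_right, Complex.zero_re] at h1
  have h2 : ‖(u - u').fst‖ = 0 := pow_eq_zero_iff two_ne_zero |>.1 (le_antisymm h1 (sq_nonneg _))
  rw [norm_eq_zero, WithLp.sub_fst] at h2
  exact sub_eq_zero.1 h2

theorem IsHom.sub {α : ℝ} {κ : Space d} {F F' : X} {c c' : ℂ} {v v' : WithLp 2 (X × Y)}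
    (h : S.IsHom α κ F c v) (h' : S.IsHom α κ F' c' v') :
    S.IsHom α κ (F - F') (c - c') (v - v') := by
  refine ⟨S.H₀.sub_mem h.1 h'.1, fun b φ hφ => ?_⟩
  have h1 := h.2 b φ hφ
  have h2 := h'.2 b φ hφ
  have h3 : (c - c') • S.one + (v - v').fst = (c • S.one + v.fst) - (c' • S.one + v'.fst) := by
    rw [WithLp.sub_fst, sub_smul]; abel
  rw [h3]
  simp only [map_sub, inner_sub_right]
  linear_combination h1 - h2

theorem IsHom.energy {α : ℝ} {κ : Space d} {F : X} {c : ℂ} {v : WithLp 2 (X × Y)}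
    (h : S.IsHom α κ F c v) :
    α * ‖c‖ ^ 2 + S.ν * ‖S.grad κ v‖ ^ 2 + ‖c • S.one + v.fst‖ ^ 2 ≤
      ‖c • S.one + v.fst‖ * ‖F‖ := by
  have h1 := congrArg Complex.re (h.2 c v h.1)
  have h2 := S.coercive₀ (S.grad κ v)
  have h3 : ((α : ℂ) * c * conj c).re = α * ‖c‖ ^ 2 := by
    rw [mul_assoc, Complex.mul_conj, Complex.re_ofReal_mul, Complex.ofReal_re,
      Complex.normSq_eq_norm_sq]
  rw [Complex.add_re, Complex.add_re, re_inner_self_eq, h3] at h1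
  have h4 : (inner ℂ (c • S.one + v.fst) F).re ≤ ‖c • S.one + v.fst‖ * ‖F‖ :=
    (Complex.re_le_norm _).trans (norm_inner_le_norm _ _)
  linarith

theorem IsHom.unique {α : ℝ} (hα : 0 ≤ α) {κ : Space d} {F : X} {c c' : ℂ}
    {v v' : WithLp 2 (X × Y)} (h : S.IsHom α κ F c v) (h' : S.IsHom α κ F c' v') :
    c = c' ∧ v.fst = v'.fst := by
  have h1 := (h.sub h').energy
  have hν := S.ν_pos
  have hβ := S.β_pos
  rw [sub_self, norm_zero, mul_zero] at h1
  have h2 : 0 ≤ α * ‖c - c'‖ ^ 2 := by positivity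
  have h3 : 0 ≤ S.ν * ‖S.grad κ (v - v')‖ ^ 2 := by positivity
  have h4 : ‖(c - c') • S.one + (v - v').fst‖ = 0 :=
    pow_eq_zero_iff two_ne_zero |>.1 (le_antisymm (by linarith) (sq_nonneg _))
  have h5 := S.const_le (c - c') (v - v') (S.H₀.sub_mem h.1 h'.1)
  rw [h4] at h5
  have h6 : ‖c - c'‖ = 0 := by
    refine pow_eq_zero_iff two_ne_zero |>.1 (le_antisymm ?_ (sq_nonneg _))
    exact nonpos_of_mul_nonpos_right (by simpa using h5) hβ
  rw [norm_eq_zero] at h6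
  refine ⟨sub_eq_zero.1 h6, ?_⟩
  rw [h6, zero_smul, zero_add, norm_eq_zero, WithLp.sub_fst] at h4
  exact sub_eq_zero.1 h4

/-- The first three bounds come from the energy inequality. The last one, linear in |c|, comes from
testing with b = 1, φ = 0. With α ≥ γ|θ|², the bounds on α|c|² and α|c| control |c||θ| and |c||θ|²
respectively. -/
theorem IsHom.norm_le {α : ℝ} (hα : 0 ≤ α) {κ : Space d} {F : X} {c : ℂ} {v : WithLp 2 (X × Y)}
    (h : S.IsHom α κ F c v) : ‖c • S.one + v.fst‖ ≤ ‖F‖ ∧ α * ‖c‖ ^ 2 ≤ ‖F‖ ^ 2 ∧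
      S.ν * ‖S.grad κ v‖ ^ 2 ≤ ‖F‖ ^ 2 ∧ α * ‖c‖ ≤ 2 * ‖F‖ := by
  have h1 := h.energy
  have hν := S.ν_pos
  have h2 : 0 ≤ α * ‖c‖ ^ 2 := by positivity
  have h3 : 0 ≤ S.ν * ‖S.grad κ v‖ ^ 2 := by positivity
  set m := ‖c • S.one + v.fst‖ with hm
  have hm0 : 0 ≤ m := norm_nonneg _
  have hF := norm_nonneg F
  have h4 : m ≤ ‖F‖ := by
    by_contra! h5
    nlinarith
  refine ⟨h4, by nlinarith, by nlinarith, ?_⟩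
  have h5 := h.2 1 0 S.H₀.zero_mem
  simp only [map_zero, inner_zero_left, one_smul, WithLp.zero_fst, add_zero, map_one,
    mul_one] at h5
  have h6 : (α : ℂ) * c = inner ℂ S.one (F - (c • S.one + v.fst)) := by
    rw [inner_sub_right, ← h5]; ring
  calc α * ‖c‖ = ‖(α : ℂ) * c‖ := by
        rw [norm_mul, Complex.norm_real, Real.norm_of_nonneg hα]
    _ ≤ ‖S.one‖ * ‖F - (c • S.one + v.fst)‖ := by rw [h6]; exact norm_inner_le_norm _ _
    _ ≤ 1 * (‖F‖ + m) := by
        gcongr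
        · exact S.norm_one_le
        · exact norm_sub_le _ _
    _ ≤ 2 * ‖F‖ := by linarith

theorem IsCorrector.le_homCoeff {ξ : Space d} {N : WithLp 2 (X × Y)} (hN : S.IsCorrector ξ N) :
    S.γ * ‖ξ‖ ^ 2 ≤ S.homCoeff ξ N := S.cell_coercive ξ N hN.1

theorem IsCorrector.inner_shift_one {ξ : Space d} {N : WithLp 2 (X × Y)}
    (hN : S.IsCorrector ξ N) :
    inner ℂ (S.shift ξ S.one) (S.M₁ (S.shift ξ S.one + N.snd)) = (S.homCoeff ξ N : ℂ) := by
  rw [homCoeff, ← inner_M₁_self_eq, inner_add_left, hN.2 N hN.1, add_zero]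

/-- The corrector equation kills the cross terms, so that a competitor exceeds the corrector by the
nonnegative form of the difference. This identifies `homCoeff` with the minimum defining A^hom. -/
theorem IsCorrector.homCoeff_le {ξ : Space d} {N w : WithLp 2 (X × Y)} (hN : S.IsCorrector ξ N)
    (hw : w ∈ S.H) : S.homCoeff ξ N ≤ S.homCoeff ξ w := by
  have h1 : S.shift ξ S.one + w.snd = (S.shift ξ S.one + N.snd) + (w - N).snd := by
    rw [WithLp.sub_snd]; abel
  rw [homCoeff, homCoeff, h1]
  have h2 := hN.2 (w - N) (S.H.sub_mem hw hN.1)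
  have h3 : inner ℂ (S.shift ξ S.one + N.snd) (S.M₁ (w - N).snd) = 0 := by
    rw [← S.symm₁, ← inner_conj_symm, h2, map_zero]
  set z := S.shift ξ S.one + N.snd
  rw [map_add S.M₁ z, inner_add_left z, inner_add_right z, inner_add_right, h2, h3,
    add_zero, zero_add, Complex.add_re]
  linarith [S.nonneg₁ (w - N).snd]

/-- Put z = iθ + ∇N. The corrector equation removes ∇w from the pairing of Dw with M₁z and leaves
iεθw. In the splitting w = r + φ + b, the part φ drops out since M₁ vanishes on soft fields, and b
yields ε α conj b, which cancels the term αc conj b of the homogenised equation. Every term left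
carries r, Dw - Dφ, M₁Dw or an explicit factor ε. -/
theorem energy_identity {ε : ℝ} (hε : 0 < ε) {θ : Space d} {F : X} {u v N φ : WithLp 2 (X × Y)}
    {c : ℂ} (hN : S.IsCorrector θ N) (hu : S.IsFibre ε θ F u)
    (hv : S.IsHom (S.homCoeff θ N) (ε • θ) F c v) (b : ℂ) (hφ : φ ∈ S.H₀)
    {w : WithLp 2 (X × Y)} {r : X} (hw : w = c • S.unit + ((ε : ℂ) * c) • N + v - u)
    (hr : r = w.fst - φ.fst - b • S.one) :
    (((ε ^ 2)⁻¹ : ℝ) : ℂ) * inner ℂ (S.grad (ε • θ) w) (S.M₁ (S.grad (ε • θ) w)) +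
      inner ℂ (S.grad (ε • θ) w) (S.M₀ (S.grad (ε • θ) w)) + inner ℂ w.fst w.fst =
    (ε : ℂ)⁻¹ * c * inner ℂ (S.shift (ε • θ) r) (S.M₁ (S.shift θ S.one + N.snd)) +
      (ε : ℂ)⁻¹ * c * inner ℂ (S.M₁ (S.grad (ε • θ) w)) (S.shift (ε • θ) N.fst) +
      ((ε : ℂ) * c) * inner ℂ (S.grad (ε • θ) w)
        (S.M₀ ((S.shift θ S.one + N.snd) + S.shift (ε • θ) N.fst)) +
      inner ℂ (S.grad (ε • θ) w - S.grad (ε • θ) φ) (S.M₀ (S.grad (ε • θ) v)) +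
      ((ε : ℂ) * c) * inner ℂ w.fst N.fst + inner ℂ r (c • S.one + v.fst) - inner ℂ r F := by
  have hε' : (ε : ℂ) ≠ 0 := by exact_mod_cast hε.ne'
  have hwH : w ∈ S.H := by
    rw [hw]
    exact S.H.sub_mem (S.H.add_mem (S.H.add_mem (S.H.smul_mem _ S.one_mem)
      (S.H.smul_mem _ hN.1)) (S.le hv.1)) hu.1
  have e1 := hu.2 w hwH
  have e2 := hv.2 b φ hφ
  have e3 := hN.2 w hwH
  have e4 := hN.inner_shift_one
  set z := S.shift θ S.one + N.snd with hz
  set k := S.shift (ε • θ) N.fst with hk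
  set D := S.grad (ε • θ) with hD
  have hDw : D w = ((ε : ℂ) * c) • (z + k) + D v - D u := by
    have h1 : D S.unit = (ε : ℂ) • S.shift θ S.one := by
      rw [hD, grad_apply, unit_snd, unit_fst, zero_add, S.shift_smul]
    have h2 : D N = N.snd + k := rfl
    rw [hw, map_sub, map_add, map_add, map_smul, map_smul, h1, h2, hz]
    module
  have hwf : w.fst = c • S.one + ((ε : ℂ) * c) • N.fst + v.fst - u.fst := by
    rw [hw]; rfl
  -- Hence v does not appear in the stiff part of the identity, although it is of order one in the
  -- ansatz.
  have hM₁v : S.M₁ (D v) = 0 := by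
    rw [hD, grad_apply, map_add, S.M₁_grad v hv.1, S.M₁_shift _ v hv.1, add_zero]
  have h1 : inner ℂ (D w) (S.M₁ z) =
      inner ℂ (S.shift (ε • θ) r) (S.M₁ z) + conj b * (ε * S.homCoeff θ N) := by
    have h2 : D w = w.snd + (S.shift (ε • θ) r + S.shift (ε • θ) φ.fst +
        b • ((ε : ℂ) • S.shift θ S.one)) := by
      rw [← S.shift_smul, ← map_smul, ← map_add, ← map_add, hr, hD, grad_apply]
      congr 2
      abel
    have h3 : inner ℂ (S.shift (ε • θ) φ.fst) (S.M₁ z) = 0 := by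
      rw [← S.symm₁, S.M₁_shift _ φ hφ, inner_zero_left]
    rw [h2, inner_add_left, inner_add_left, inner_add_left, e3, h3, inner_smul_left,
      inner_smul_left, e4, Complex.conj_ofReal]
    ring
  have h4 : inner ℂ (D w) (S.M₁ (D w)) = ((ε : ℂ) * c) * (inner ℂ (D w) (S.M₁ z) +
      inner ℂ (S.M₁ (D w)) k) - inner ℂ (D w) (S.M₁ (D u)) := by
    conv_lhs => rw [hDw, map_sub, map_add, map_smul, hM₁v, add_zero, ← hDw]
    rw [inner_sub_right, inner_smul_right, map_add, inner_add_right, S.symm₁ _ k]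
  have h5 : inner ℂ (D w) (S.M₀ (D w)) = ((ε : ℂ) * c) * inner ℂ (D w) (S.M₀ (z + k)) +
      inner ℂ (D w) (S.M₀ (D v)) - inner ℂ (D w) (S.M₀ (D u)) := by
    conv_lhs => rw [hDw, map_sub, map_add, map_smul, ← hDw]
    rw [inner_sub_right, inner_add_right, inner_smul_right]
  have h6 : inner ℂ w.fst w.fst = inner ℂ w.fst (c • S.one + v.fst) +
      ((ε : ℂ) * c) * inner ℂ w.fst N.fst - inner ℂ w.fst u.fst := by
    rw [← inner_smul_right, ← inner_add_right, ← inner_sub_right, hwf]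
    congr 1
    abel
  have h7 : ∀ x : X, inner ℂ w.fst x = inner ℂ r x + inner ℂ (b • S.one + φ.fst) x := fun x => by
    rw [← inner_add_left, hr]
    congr 1
    abel
  have h8 := h7 (c • S.one + v.fst)
  have h9 := h7 F
  have hinv : (((ε ^ 2)⁻¹ : ℝ) : ℂ) = (ε : ℂ)⁻¹ * (ε : ℂ)⁻¹ := by
    push_cast; rw [sq, mul_inv]
  have hi : (ε : ℂ)⁻¹ * ε = 1 := inv_mul_cancel₀ hε'
  rw [hinv] at e1 ⊢
  rw [h1] at h4
  rw [h4, h5, h6, inner_sub_left]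
  set I1 := inner ℂ (S.shift (ε • θ) r) (S.M₁ z)
  set I2 := inner ℂ (S.M₁ (D w)) k
  linear_combination e2 - e1 + h8 - h9 + ((ε : ℂ)⁻¹ * c * (I1 + conj b * (ε * S.homCoeff θ N) + I2)
    + c * conj b * S.homCoeff θ N) * hi

/-- Young's inequality: the q term is absorbed with weight ε⁻², the D term with weight ν, and half
of w² absorbs the last. Each leaves a remainder of order (Afε)². -/
theorem sq_le_of_energy_le {ε ν A f q D w δ : ℝ} (hε : 0 < ε) (hν : 0 < ν)
    (h : (ε ^ 2)⁻¹ * q ^ 2 + ν * D ^ 2 + w ^ 2 ≤ A * f * (q + ε * D + ε * w + δ)) :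
    w ^ 2 ≤ (A * f * ε) ^ 2 * (2 + ν⁻¹) + 2 * (A * f) * δ := by
  have h1 : A * f * q ≤ (ε ^ 2)⁻¹ * q ^ 2 / 2 + (A * f * ε) ^ 2 / 2 := by
    have h2 : (ε ^ 2)⁻¹ * q ^ 2 = (ε⁻¹ * q) ^ 2 := by rw [mul_pow, inv_pow]
    have h3 : A * f * q = (A * f * ε) * (ε⁻¹ * q) := by
      field_simp
    rw [h2, h3]
    nlinarith [sq_nonneg (A * f * ε - ε⁻¹ * q)]
  have h2 : A * f * (ε * D) ≤ ν * D ^ 2 + (A * f * ε) ^ 2 * ν⁻¹ / 4 := by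
    have h3 : ν * D ^ 2 + (A * f * ε) ^ 2 * ν⁻¹ / 4 - A * f * (ε * D) =
        ν * (D - A * f * ε * ν⁻¹ / 2) ^ 2 := by field_simp; ring
    nlinarith [mul_nonneg hν.le (sq_nonneg (D - A * f * ε * ν⁻¹ / 2))]
  have h3 : A * f * (ε * w) ≤ w ^ 2 / 2 + (A * f * ε) ^ 2 / 2 := by
    nlinarith [sq_nonneg (A * f * ε - w)]
  have h4 : 0 ≤ (A * f * ε) ^ 2 * ν⁻¹ := by positivity
  have h5 : 0 ≤ (ε ^ 2)⁻¹ * q ^ 2 := by positivity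
  nlinarith

theorem mul_add_le_mul_add {a₁ a₂ a₃ a₄ K q x y δ : ℝ} (h₁ : 0 ≤ a₁) (h₂ : 0 ≤ a₂) (h₃ : 0 ≤ a₃)
    (h₄ : 0 ≤ a₄) (hK : 0 ≤ K) (hq : 0 ≤ q) (hx : 0 ≤ x) (hy : 0 ≤ y) (hδ : 0 ≤ δ) :
    a₁ * (K * q + δ) + a₂ * q + a₃ * x + a₄ * y ≤
      (a₁ * (K + 1) + a₂ + a₃ + a₄) * (q + x + y + δ) := by
  have h : K * q + δ ≤ (K + 1) * (q + x + y + δ) := by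
    nlinarith [mul_nonneg hK hδ, mul_nonneg hK hx, mul_nonneg hK hy]
  calc _ ≤ a₁ * ((K + 1) * (q + x + y + δ)) + a₂ * (q + x + y + δ) + a₃ * (q + x + y + δ) +
        a₄ * (q + x + y + δ) := by gcongr <;> linarith
    _ = _ := by ring

variable (S)

/-- The seven terms of `energy_identity` are bounded one by one. The factors ε⁻¹ are offset by the
factor ε|θ| of the shift by εθ, and the powers of |θ| that appear are absorbed by |c|. -/
theorem exists_energy_le {C : ℝ} (hC : 0 ≤ C) : ∃ A, 0 ≤ A ∧ ∀ (ε : ℝ), 0 < ε → ∀ θ : Space d,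
    ε • θ ∈ S.dual → ∀ (F : X) (u v N : WithLp 2 (X × Y)) (c : ℂ), S.IsCorrector θ N →
    ‖N‖ ≤ C * ‖θ‖ → S.IsFibre ε θ F u → S.IsHom (S.homCoeff θ N) (ε • θ) F c v →
    ∀ w, w = c • S.unit + ((ε : ℂ) * c) • N + v - u → ∀ δ > 0,
      (ε ^ 2)⁻¹ * S.stiffNorm (S.grad (ε • θ) w) ^ 2 + S.ν * ‖S.grad (ε • θ) w‖ ^ 2 +
        ‖w.fst‖ ^ 2 ≤ A * ‖F‖ * (S.stiffNorm (S.grad (ε • θ) w) + ε * ‖S.grad (ε • θ) w‖ +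
          ε * ‖w.fst‖ + δ) := by
  have hK := S.K_nonneg
  have hγ := S.γ_pos
  have hν := S.ν_pos
  have hR : 0 ≤ S.R := (norm_nonneg _).trans (S.norm_le_of_mem_dual 0 S.zero_mem_dual)
  set G := √(S.γ⁻¹)
  set V := √(S.ν⁻¹)
  set A₁ := ‖S.M₁‖ * (1 + C) * (2 / S.γ) + ‖S.M₀‖ * V + 2 with hA₁
  set A₂ := √S.μ * C * (2 / S.γ)
  set A₃ := ‖S.M₀‖ * ((1 + C) + S.R * C) * G
  set A₄ := C * G
  refine ⟨A₁ * (S.K + 1) + A₂ + A₃ + A₄, by positivity, ?_⟩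
  intro ε hε θ hθ F u v N c hN hNC hu hv w hw δ hδ
  have hwH : w ∈ S.H := by
    rw [hw]
    exact S.H.sub_mem (S.H.add_mem (S.H.add_mem (S.H.smul_mem _ S.one_mem)
      (S.H.smul_mem _ hN.1)) (S.le hv.1)) hu.1
  obtain ⟨b, φ, hφ, hb1, hb2⟩ := S.approx _ hθ w hwH δ hδ
  have hid := energy_identity hε hN hu hv b hφ hw rfl
  set r := w.fst - φ.fst - b • S.one
  set D := S.grad (ε • θ) with hD
  change ‖r‖ ≤ S.K * S.stiffNorm (D w) + δ at hb1
  change ‖D w - D φ‖ ≤ S.K * S.stiffNorm (D w) + δ at hb2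
  set z := S.shift θ S.one + N.snd
  set k := S.shift (ε • θ) N.fst
  set q := S.stiffNorm (D w) with hq
  have hq0 : 0 ≤ q := S.stiffNorm_nonneg _
  set s := S.K * q + δ with hs
  set f := ‖F‖
  have hf : 0 ≤ f := norm_nonneg F
  have hα : 0 ≤ S.homCoeff θ N := S.nonneg₁ _
  obtain ⟨n1, n2, n3, n4⟩ := hv.norm_le hα
  have hγα := hN.le_homCoeff
  -- From α|c| ≤ 2‖F‖ and α ≥ γ|θ|²; the next bound uses α|c|² ≤ ‖F‖² instead.
  have c1 : ‖c‖ * ‖θ‖ ^ 2 ≤ (2 / S.γ) * f := by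
    rw [div_mul_eq_mul_div, le_div_iff₀ hγ]
    nlinarith [norm_nonneg c]
  have c2 : ‖c‖ * ‖θ‖ ≤ G * f := by
    refine abs_le_of_sq_le_sq' ?_ (by positivity) |>.2
    rw [mul_pow, mul_pow, Real.sq_sqrt (by positivity), inv_mul_eq_div, le_div_iff₀ hγ]
    nlinarith [sq_nonneg ‖c‖]
  have c3 : ‖D v‖ ≤ V * f := by
    refine abs_le_of_sq_le_sq' ?_ (by positivity) |>.2
    rw [mul_pow, Real.sq_sqrt (by positivity), inv_mul_eq_div, le_div_iff₀ hν]
    linarith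
  have hNf : ‖N.fst‖ ≤ C * ‖θ‖ := (WithLp.norm_fst_le _ N).trans hNC
  have hNs : ‖N.snd‖ ≤ C * ‖θ‖ := (WithLp.norm_snd_le _ N).trans hNC
  have hz : ‖z‖ ≤ (1 + C) * ‖θ‖ := by
    calc ‖z‖ ≤ ‖S.shift θ S.one‖ + ‖N.snd‖ := norm_add_le _ _
      _ ≤ ‖θ‖ * 1 + C * ‖θ‖ := by
          gcongr
          refine (S.norm_shift_le _ _).trans ?_
          gcongr
          exact S.norm_one_le
      _ = _ := by ring
  have hκ : ‖ε • θ‖ = ε * ‖θ‖ := by rw [norm_smul, Real.norm_of_nonneg hε.le]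
  have hk : ‖k‖ ≤ ε * ‖θ‖ * (C * ‖θ‖) := by
    rw [← hκ]
    refine (S.norm_shift_le _ _).trans ?_
    gcongr
  -- A second bound of k, linear in |θ|: it uses that εθ ranges over a bounded set. The term
  -- containing M₀k already has a factor ε and only |c||θ| available.
  have hk' : ‖k‖ ≤ S.R * (C * ‖θ‖) := by
    refine (S.norm_shift_le _ _).trans ?_
    gcongr
    exact S.norm_le_of_mem_dual _ hθ
  have t1 : ‖(ε : ℂ)⁻¹ * c * inner ℂ (S.shift (ε • θ) r) (S.M₁ z)‖ ≤
      ‖S.M₁‖ * (1 + C) * ((2 / S.γ) * f) * s := by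
    calc _ = ε⁻¹ * ‖c‖ * ‖inner ℂ (S.shift (ε • θ) r) (S.M₁ z)‖ := by
          rw [norm_mul, norm_mul, norm_inv, Complex.norm_real, Real.norm_of_nonneg hε.le]
      _ ≤ ε⁻¹ * ‖c‖ * (((ε * ‖θ‖) * s) * (‖S.M₁‖ * ((1 + C) * ‖θ‖))) := by
          gcongr
          refine (norm_inner_le_norm _ _).trans ?_
          gcongr
          · rw [← hκ]
            refine (S.norm_shift_le _ _).trans ?_
            gcongr
          · refine (S.M₁.le_opNorm _).trans ?_
            gcongr
      _ = ‖S.M₁‖ * (1 + C) * (‖c‖ * ‖θ‖ ^ 2) * s := by field_simp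
      _ ≤ _ := by gcongr
  have t2 : ‖(ε : ℂ)⁻¹ * c * inner ℂ (S.M₁ (D w)) k‖ ≤ √S.μ * C * ((2 / S.γ) * f) * q := by
    calc _ = ε⁻¹ * ‖c‖ * ‖inner ℂ (S.M₁ (D w)) k‖ := by
          rw [norm_mul, norm_mul, norm_inv, Complex.norm_real, Real.norm_of_nonneg hε.le]
      _ ≤ ε⁻¹ * ‖c‖ * ((√S.μ * q) * (ε * ‖θ‖ * (C * ‖θ‖))) := by
          gcongr
          refine (norm_inner_le_norm _ _).trans ?_
          gcongr
          exact S.norm_M₁_le _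
      _ = √S.μ * C * (‖c‖ * ‖θ‖ ^ 2) * q := by field_simp
      _ ≤ _ := by gcongr
  have t3 : ‖((ε : ℂ) * c) * inner ℂ (D w) (S.M₀ (z + k))‖ ≤
      ‖S.M₀‖ * ((1 + C) + S.R * C) * (G * f) * (ε * ‖D w‖) := by
    calc _ = ε * ‖c‖ * ‖inner ℂ (D w) (S.M₀ (z + k))‖ := by
          rw [norm_mul, norm_mul, Complex.norm_real, Real.norm_of_nonneg hε.le]
      _ ≤ ε * ‖c‖ * (‖D w‖ * (‖S.M₀‖ * ((1 + C) * ‖θ‖ + S.R * (C * ‖θ‖)))) := by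
          gcongr
          refine (norm_inner_le_norm _ _).trans ?_
          gcongr
          refine (S.M₀.le_opNorm _).trans ?_
          gcongr
          exact (norm_add_le _ _).trans (add_le_add hz hk')
      _ = ‖S.M₀‖ * ((1 + C) + S.R * C) * (‖c‖ * ‖θ‖) * (ε * ‖D w‖) := by ring
      _ ≤ _ := by gcongr
  have t4 : ‖inner ℂ (D w - D φ) (S.M₀ (D v))‖ ≤ ‖S.M₀‖ * (V * f) * s := by
    calc _ ≤ s * (‖S.M₀‖ * (V * f)) := by
          refine (norm_inner_le_norm _ _).trans ?_
          gcongr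
          refine (S.M₀.le_opNorm _).trans ?_
          gcongr
      _ = _ := by ring
  have t5 : ‖((ε : ℂ) * c) * inner ℂ w.fst N.fst‖ ≤ C * (G * f) * (ε * ‖w.fst‖) := by
    calc _ = ε * ‖c‖ * ‖inner ℂ w.fst N.fst‖ := by
          rw [norm_mul, norm_mul, Complex.norm_real, Real.norm_of_nonneg hε.le]
      _ ≤ ε * ‖c‖ * (‖w.fst‖ * (C * ‖θ‖)) := by
          gcongr
          refine (norm_inner_le_norm _ _).trans ?_
          gcongr
      _ = C * (‖c‖ * ‖θ‖) * (ε * ‖w.fst‖) := by ring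
      _ ≤ _ := by gcongr
  have t6 : ‖inner ℂ r (c • S.one + v.fst)‖ ≤ s * f := by
    refine (norm_inner_le_norm _ _).trans ?_
    gcongr
  have t7 : ‖inner ℂ r F‖ ≤ s * f := by
    refine (norm_inner_le_norm _ _).trans ?_
    gcongr
  have hre := congrArg Complex.re hid
  rw [Complex.add_re, Complex.add_re, Complex.re_ofReal_mul, re_inner_self_eq,
    ← S.sq_stiffNorm, ← hq] at hre
  have hco := S.coercive₀ (D w)
  have hsum : (ε ^ 2)⁻¹ * q ^ 2 + S.ν * ‖D w‖ ^ 2 + ‖w.fst‖ ^ 2 ≤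
      ‖S.M₁‖ * (1 + C) * ((2 / S.γ) * f) * s + √S.μ * C * ((2 / S.γ) * f) * q +
      ‖S.M₀‖ * ((1 + C) + S.R * C) * (G * f) * (ε * ‖D w‖) + ‖S.M₀‖ * (V * f) * s +
      C * (G * f) * (ε * ‖w.fst‖) + s * f + s * f := by
    refine (show _ ≤ _ from ?_).trans (add_le_add (add_le_add (add_le_add (add_le_add
      (add_le_add (add_le_add t1 t2) t3) t4) t5) t6) t7)
    refine (show _ ≤ _ from ?_).trans ((norm_sub_le _ _).trans (add_le_add_left
      ((norm_add_le _ _).trans (add_le_add_left ((norm_add_le _ _).trans (add_le_add_left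
      ((norm_add_le _ _).trans (add_le_add_left ((norm_add_le _ _).trans (add_le_add_left
      (norm_add_le _ _) _)) _)) _)) _)) _))
    refine (show _ ≤ _ from ?_).trans (Complex.re_le_norm _)
    linarith
  refine hsum.trans ?_
  have hA₁0 : 0 ≤ A₁ := by positivity
  have hA₂0 : 0 ≤ A₂ := by positivity
  have hA₃0 : 0 ≤ A₃ := by positivity
  have hA₄0 : 0 ≤ A₄ := by positivity
  have e1 : ‖S.M₁‖ * (1 + C) * ((2 / S.γ) * f) * s + √S.μ * C * ((2 / S.γ) * f) * q +
      ‖S.M₀‖ * ((1 + C) + S.R * C) * (G * f) * (ε * ‖D w‖) + ‖S.M₀‖ * (V * f) * s +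
      C * (G * f) * (ε * ‖w.fst‖) + s * f + s * f =
      f * (A₁ * s + A₂ * q + A₃ * (ε * ‖D w‖) + A₄ * (ε * ‖w.fst‖)) := by
    simp only [A₁, A₂, A₃, A₄]; ring
  rw [e1, mul_comm (A₁ * (S.K + 1) + A₂ + A₃ + A₄) f, mul_assoc f]
  exact mul_le_mul_of_nonneg_left (mul_add_le_mul_add hA₁0 hA₂0 hA₃0 hA₄0 hK hq0
    (by positivity) (by positivity) hδ.le) hf

/-- The abstract order-sharp error estimate. -/
theorem exists_norm_sub_le [CompleteSpace X] [CompleteSpace Y] :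
    ∃ C, 0 < C ∧ ∀ θ : Space d, ∃ N, S.IsCorrector θ N ∧ ∀ (ε : ℝ), 0 < ε → ε • θ ∈ S.dual →
      ∀ (F : X) (u v : WithLp 2 (X × Y)) (c : ℂ), S.IsFibre ε θ F u →
        S.IsHom (S.homCoeff θ N) (ε • θ) F c v →
          ‖u.fst - (c • S.one + v.fst)‖ ≤ C * ε * ‖F‖ := by
  obtain ⟨C, hC, hN⟩ := S.exists_isCorrector
  obtain ⟨A, hA, hA'⟩ := S.exists_energy_le hC
  have hγ := S.γ_pos
  have hν := S.ν_pos
  refine ⟨A * √(2 + S.ν⁻¹) + C * √(S.γ⁻¹) + 1, by positivity, fun θ => ?_⟩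
  obtain ⟨N, hN, hNC⟩ := hN θ
  refine ⟨N, hN, fun ε hε hθ F u v c hu hv => ?_⟩
  set w := c • S.unit + ((ε : ℂ) * c) • N + v - u with hw
  have h1 : ‖w.fst‖ ^ 2 ≤ (A * ‖F‖ * ε) ^ 2 * (2 + S.ν⁻¹) := by
    -- The estimate holds for every slack δ with the same constant A, so δ can be sent to zero.
    refine le_of_forall_pos_le_add_mul (c := 2 * (A * ‖F‖)) (by positivity) fun δ hδ => ?_
    exact sq_le_of_energy_le hε hν (hA' ε hε θ hθ F u v N c hN hNC hu hv w hw δ hδ)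
  have h2 : ‖w.fst‖ ≤ A * ‖F‖ * ε * √(2 + S.ν⁻¹) := by
    refine abs_le_of_sq_le_sq' ?_ (by positivity) |>.2
    rwa [mul_pow, Real.sq_sqrt (by positivity)]
  have h3 : ‖c‖ * ‖θ‖ ≤ √(S.γ⁻¹) * ‖F‖ := by
    refine abs_le_of_sq_le_sq' ?_ (by positivity) |>.2
    rw [mul_pow, mul_pow, Real.sq_sqrt (by positivity), inv_mul_eq_div, le_div_iff₀ hγ]
    have h4 := mul_le_mul_of_nonneg_right hN.le_homCoeff (sq_nonneg ‖c‖)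
    have hα : 0 ≤ S.homCoeff θ N := S.nonneg₁ _
    linarith [(hv.norm_le hα).2.1]
  -- The corrector enters only the ansatz: it contributes ε|c|‖N‖ ≲ ε|c||θ| ≲ ε‖F‖ to the error and
  -- need not appear in the final approximation.
  have h4 : u.fst - (c • S.one + v.fst) = ((ε : ℂ) * c) • N.fst - w.fst := by
    have : w.fst = c • S.one + ((ε : ℂ) * c) • N.fst + v.fst - u.fst := by rw [hw]; rfl
    rw [this]; abel
  rw [h4]
  have h5 : ‖((ε : ℂ) * c) • N.fst‖ ≤ C * √(S.γ⁻¹) * ε * ‖F‖ := by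
    rw [norm_smul, norm_mul, Complex.norm_real, Real.norm_of_nonneg hε.le]
    calc ε * ‖c‖ * ‖N.fst‖ ≤ ε * ‖c‖ * (C * ‖θ‖) := by
          gcongr; exact (WithLp.norm_fst_le _ N).trans hNC
      _ = C * ε * (‖c‖ * ‖θ‖) := by ring
      _ ≤ C * ε * (√(S.γ⁻¹) * ‖F‖) := by gcongr
      _ = _ := by ring
  have h6 : 0 ≤ ε * ‖F‖ := by positivity
  calc _ ≤ ‖((ε : ℂ) * c) • N.fst‖ + ‖w.fst‖ := norm_sub_le _ _
    _ ≤ (A * √(2 + S.ν⁻¹) + C * √(S.γ⁻¹)) * (ε * ‖F‖) + ε * ‖F‖ := by linarith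
    _ = _ := by ring

end FibreModel

/-! ### Plane waves -/

/-- The plane wave `x ↦ exp(iκ·x)`. -/
def wave (κ x : Space d) : ℂ := Complex.exp (Complex.I * (inner ℝ κ x : ℝ))

theorem norm_wave (κ x : Space d) : ‖wave κ x‖ = 1 := by
  rw [wave, mul_comm]; exact Complex.norm_exp_ofReal_mul_I _

theorem enorm_wave (κ x : Space d) : ‖wave κ x‖ₑ = 1 := by
  rw [← ofReal_norm, norm_wave, ENNReal.ofReal_one]

theorem wave_add (κ x y : Space d) : wave κ (x + y) = wave κ x * wave κ y := by
  rw [wave, wave, wave, ← Complex.exp_add, inner_add_right]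
  push_cast; ring_nf

theorem wave_neg_mul_wave (κ x : Space d) : wave (-κ) x * wave κ x = 1 := by
  rw [wave, wave, ← Complex.exp_add, inner_neg_left]
  push_cast
  rw [← mul_add, neg_add_cancel, mul_zero, Complex.exp_zero]

theorem wave_single (κ : Space d) (j : Fin d) :
    wave κ (EuclideanSpace.single j 1) = Complex.exp (Complex.I * (κ j : ℝ)) := by
  rw [wave, EuclideanSpace.inner_single_right]
  simp

theorem contDiff_wave (κ : Space d) : ContDiff ℝ ∞ (wave κ) := by
  have : ContDiff ℝ ∞ fun x : Space d => Complex.I * ((inner ℝ κ x : ℝ) : ℂ) :=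
    contDiff_const.mul (Complex.ofRealCLM.contDiff.comp (contDiff_const.inner ℝ contDiff_id))
  exact this.cexp

/-- The real linear functional `v ↦ κ·v` with complex values. -/
def waveForm (κ : Space d) : Space d →L[ℝ] ℂ := Complex.ofRealCLM.comp (innerSL ℝ κ)

theorem waveForm_apply (κ v : Space d) : waveForm κ v = ((inner ℝ κ v : ℝ) : ℂ) := rfl

theorem waveForm_single (κ : Space d) (j : Fin d) :
    waveForm κ (EuclideanSpace.single j 1) = (κ j : ℂ) := by
  rw [waveForm_apply, EuclideanSpace.inner_single_right]
  simp

theorem hasFDerivAt_wave (κ x : Space d) :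
    HasFDerivAt (wave κ) (wave κ x • (Complex.I • waveForm κ)) x :=
  ((waveForm κ).hasFDerivAt (x := x) |>.const_mul Complex.I).cexp

theorem fderiv_wave_mul (κ : Space d) {w : Space d → ℂ} {x : Space d}
    (hw : DifferentiableAt ℝ w x) :
    fderiv ℝ (fun y => wave κ y * w y) x =
      wave κ x • (fderiv ℝ w x + (Complex.I * w x) • waveForm κ) := by
  rw [((hasFDerivAt_wave κ x).fun_mul hw.hasFDerivAt).fderiv]
  ext v
  simp only [add_apply, smul_apply, smul_eq_mul]
  ring

theorem exists_lipschitzWith_wave (κ : Space d) : ∃ K, LipschitzWith K (wave κ) := by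
  refine ⟨‖waveForm κ‖₊, lipschitzWith_of_nnnorm_fderiv_le (𝕜 := ℝ)
    ((contDiff_wave κ).differentiable (by simp)) fun x => ?_⟩
  rw [(hasFDerivAt_wave κ x).fderiv, ← NNReal.coe_le_coe, coe_nnnorm, coe_nnnorm, norm_smul,
    norm_smul, norm_wave, Complex.norm_I, one_mul, one_mul]

/-- The shifted gradient of `w` as a vector field. -/
def gradVec (κ : Space d) (w : Space d → ℂ) (x : Space d) : EuclideanSpace ℂ (Fin d) :=
  WithLp.toLp 2 (shiftGrad κ w (fun y j => pderiv j w y) x)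

theorem gradVec_apply (κ : Space d) (w : Space d → ℂ) (x : Space d) (j : Fin d) :
    gradVec κ w x j = pderiv j w x + Complex.I * (κ j : ℂ) * w x := rfl

/-- Multiplication by a plane wave turns the shifted gradient into the plain one without changing
its modulus, at the price of making the function quasi-periodic. -/
theorem gradVec_zero_wave_mul (κ : Space d) {w : Space d → ℂ} {x : Space d}
    (hw : DifferentiableAt ℝ w x) :
    gradVec 0 (fun y => wave κ y * w y) x = wave κ x • gradVec κ w x := by
  ext j
  rw [PiLp.smul_apply, gradVec_apply, gradVec_apply, pderiv, fderiv_wave_mul κ hw]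
  simp only [add_apply, smul_apply, smul_eq_mul,
    waveForm_single, pderiv, PiLp.zero_apply, Complex.ofReal_zero]
  ring

theorem enorm_sq_eq_sum {𝕜 ι : Type*} [RCLike 𝕜] [Fintype ι] (x : EuclideanSpace 𝕜 ι) :
    ‖x‖ₑ ^ 2 = ∑ i, ‖x i‖ₑ ^ 2 := by
  simp only [← ofReal_norm]
  rw [← ENNReal.ofReal_pow (norm_nonneg _), EuclideanSpace.norm_sq_eq,
    ENNReal.ofReal_sum_of_nonneg fun i _ => by positivity]
  exact Finset.sum_congr rfl fun i _ => ENNReal.ofReal_pow (norm_nonneg _) 2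

theorem enorm_gradVec_zero_sq_le (w : Space d → ℂ) (x : Space d) :
    ‖gradVec 0 w x‖ₑ ^ 2 ≤ d * ‖fderiv ℝ w x‖ₑ ^ 2 := by
  rw [enorm_sq_eq_sum]
  calc ∑ j, ‖gradVec 0 w x j‖ₑ ^ 2 ≤ ∑ _j : Fin d, ‖fderiv ℝ w x‖ₑ ^ 2 := by
        gcongr with j
        rw [gradVec_apply]
        simp only [PiLp.zero_apply, Complex.ofReal_zero, mul_zero, zero_mul, add_zero, pderiv]
        simp only [enorm_eq_nnnorm]
        have : ‖EuclideanSpace.single j (1 : ℝ)‖₊ = 1 := by simp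
        exact_mod_cast ((fderiv ℝ w x).le_opNNNorm _).trans_eq (by rw [this, mul_one])
    _ = d * ‖fderiv ℝ w x‖ₑ ^ 2 := by simp

theorem enorm_fderiv_le (w : Space d → ℂ) (x : Space d) : ‖fderiv ℝ w x‖ₑ ≤ ‖gradVec 0 w x‖ₑ := by
  simp only [enorm_eq_nnnorm, ENNReal.coe_le_coe]
  refine (fderiv ℝ w x).opNNNorm_le_bound _ fun v => ?_
  rw [← NNReal.coe_le_coe, NNReal.coe_mul]
  simp only [coe_nnnorm]
  have hv : fderiv ℝ w x v = inner ℂ (WithLp.toLp 2 fun j => ((v j : ℝ) : ℂ)) (gradVec 0 w x) := by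
    conv_lhs => rw [← (EuclideanSpace.basisFun (Fin d) ℝ).sum_repr v]
    rw [map_sum, PiLp.inner_apply]
    refine Finset.sum_congr rfl fun j _ => ?_
    rw [map_smul, gradVec_apply]
    simp [pderiv, mul_comm]
  rw [hv]
  refine (norm_inner_le_norm _ _).trans_eq ?_
  rw [mul_comm]
  congr 1
  rw [EuclideanSpace.norm_eq, EuclideanSpace.norm_eq]
  simp

theorem IsPeriodic.exists_norm_le {E : Type*} [SeminormedAddCommGroup E] {f : Space d → E}
    (hf : IsPeriodic f) (hc : Continuous f) : ∃ M, ∀ x, ‖f x‖ ≤ M := by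
  obtain ⟨M, hM⟩ := (isBounded_cell (d := d)).isCompact_closure.exists_bound_of_continuousOn
    hc.continuousOn
  refine ⟨M, fun x => ?_⟩
  rw [← hf.sub (floorVec x)]
  exact hM _ (subset_closure (sub_floorVec_mem_cell x))

theorem isPeriodic_twisted_fderiv {w : Space d → ℂ} (hwp : IsPeriodic w) (κ : Space d) :
    IsPeriodic fun x => fderiv ℝ w x + (Complex.I * w x) • waveForm κ := fun n x => by
  simp only [hwp.fderiv n x, hwp n x]

theorem exists_lipschitzWith_wave_mul {w : Space d → ℂ} (hw : ContDiff ℝ ∞ w)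
    (hwp : IsPeriodic w) (κ : Space d) : ∃ K, LipschitzWith K fun x => wave κ x * w x := by
  obtain ⟨M, hM⟩ := (isPeriodic_twisted_fderiv hwp κ).exists_norm_le
    ((hw.continuous_fderiv (by simp)).add
      ((continuous_const.mul hw.continuous).smul continuous_const))
  refine ⟨M.toNNReal, lipschitzWith_of_nnnorm_fderiv_le (𝕜 := ℝ)
    (((contDiff_wave κ).mul hw).differentiable (by simp)) fun x => ?_⟩
  rw [fderiv_wave_mul κ (hw.differentiable (by simp) x), ← NNReal.coe_le_coe, coe_nnnorm,
    norm_smul, norm_wave, one_mul]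
  exact (hM x).trans (Real.le_coe_toNNReal _)

theorem hasPeriodicGradNorm_wave_mul {w : Space d → ℂ} (hw : ContDiff ℝ ∞ w)
    (hwp : IsPeriodic w) (κ : Space d) : HasPeriodicGradNorm fun x => wave κ x * w x := by
  refine ⟨((contDiff_wave κ).mul hw).of_le (by simp), ?_⟩
  have : (fun x => ‖fderiv ℝ (fun y => wave κ y * w y) x‖ₑ) =
      fun x => ‖fderiv ℝ w x + (Complex.I * w x) • waveForm κ‖ₑ := by
    ext x
    rw [fderiv_wave_mul κ (hw.differentiable (by simp) x), enorm_smul, enorm_wave, one_mul]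
  rw [this]
  exact (isPeriodic_twisted_fderiv hwp κ).comp _

/-- An affine function plus a periodic one is not periodic, but its gradient is, which is all that
the Poincaré inequality asks for. -/
theorem hasPeriodicGradNorm_add {w : Space d → ℂ} (hw : ContDiff ℝ ∞ w)
    (hwp : IsPeriodic w) (κ : Space d) :
    HasPeriodicGradNorm fun x => Complex.I * waveForm κ x + w x := by
  refine ⟨((contDiff_const.mul (waveForm κ).contDiff).add hw).of_le (by simp), ?_⟩
  have : (fun x => ‖fderiv ℝ (fun y => Complex.I * waveForm κ y + w y) x‖ₑ) =
      fun x => ‖Complex.I • waveForm κ + fderiv ℝ w x‖ₑ := by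
    ext x
    rw [fderiv_fun_add ((waveForm κ).differentiableAt.const_mul _)
      (hw.differentiable (by simp) x), fderiv_const_mul (waveForm κ).differentiableAt,
      ContinuousLinearMap.fderiv]
  rw [this]
  exact hwp.fderiv.comp fun L => ‖Complex.I • waveForm κ + L‖ₑ

/-- Jordan's inequality for the sine. The restriction to [-π, π] excludes the other zeros of exp(it)
- 1, which is why quasimomenta are confined to the dual cell. -/
theorem abs_le_norm_exp_sub_one {t : ℝ} (ht : |t| ≤ Real.pi) :
    |t| ≤ Real.pi / 2 * ‖Complex.exp (Complex.I * (t : ℝ)) - 1‖ := by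
  have hπ := Real.pi_pos
  have h := Real.mul_abs_le_abs_sin (x := t / 2) (by
    rw [abs_div, abs_two]; linarith)
  rw [Complex.norm_exp_I_mul_ofReal_sub_one, norm_mul, Real.norm_eq_abs, Real.norm_eq_abs, abs_two]
  rw [abs_div, abs_two] at h
  calc |t| = Real.pi / 2 * (2 * (2 / Real.pi * (|t| / 2))) := by field_simp
    _ ≤ _ := by gcongr


/-! ### Approximation by constants and soft functions, uniformly in the quasimomentum -/

theorem gradVec_zero_sub {f g : Space d → ℂ} {x : Space d} (hf : DifferentiableAt ℝ f x)
    (hg : DifferentiableAt ℝ g x) :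
    gradVec 0 (fun y => f y - g y) x = gradVec 0 f x - gradVec 0 g x := by
  ext j
  rw [PiLp.sub_apply, gradVec_apply, gradVec_apply, gradVec_apply, pderiv, pderiv, pderiv,
    fderiv_fun_sub hf hg]
  simp

theorem IsStiffPart.lintegral_cell_eq (hQ : IsStiffPart Q₁) (f : Space d → ℝ≥0∞) :
    ∫⁻ x, f x ∂cellMeasure d = (∫⁻ x in Q₁, f x) + ∫⁻ x in softPart Q₁, f x := by
  have h1 : ∫⁻ x, f x ∂cellMeasure d = ∫⁻ x in Q₁ ∪ softPart Q₁, f x := by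
    refine setLIntegral_congr ?_
    refine Filter.EventuallyEq.symm (eventuallyEq_set.2 ?_)
    filter_upwards [(ae_restrict_iff' (measurableSet_cell d)).1 hQ.ae_mem] with x hx
    exact ⟨fun h => h.elim (fun h => hQ.subset_cell h) fun h => softPart_subset_cell h, hx⟩
  rw [h1, lintegral_union isOpen_softPart.measurableSet]
  exact Set.disjoint_left.2 fun x h1 h2 => hQ.notMem_of_mem_softPart h2 (mem_periodization_of_mem h1)

/-- Let W = exp(iκ·x)w. Poincaré provides b with W close to b on Q₁, and the extension result
applied to W - b provides Φ supported in the soft part. The function sought is φ = exp(-iκ·x)Φ. The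
bound on w - φ - b moreover needs |κ||b| to be small. -/
theorem IsStiffPart.exists_soft_approx (hQ : IsStiffPart Q₁) :
    ∃ C : ℝ≥0∞, C ≠ ⊤ ∧ ∀ κ ∈ dualCell d, ∀ w : Space d → ℂ, ContDiff ℝ ∞ w → IsPeriodic w →
      ∃ (b : ℂ) (φ : Space d → ℂ), (∃ K, LipschitzWith K φ) ∧ (∀ x ∉ softPart Q₁, φ x = 0) ∧
        ∫⁻ x, ‖w x - φ x - b‖ₑ ^ 2 ∂cellMeasure d ≤ C * ∫⁻ x in Q₁, ‖gradVec κ w x‖ₑ ^ 2 ∧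
        ∫⁻ x, ‖gradVec κ w x - gradVec κ φ x‖ₑ ^ 2 ∂cellMeasure d ≤
          C * ∫⁻ x in Q₁, ‖gradVec κ w x‖ₑ ^ 2 := by
  obtain ⟨C₁, hC₁, hP⟩ := hQ.exists_poincare
  obtain ⟨C₂, hC₂, hE⟩ := hQ.exists_extension
  obtain ⟨R, hR⟩ := (isBounded_cell (d := d)).exists_norm_le
  set B := ENNReal.ofReal (Real.pi / 2)
  set C₃ := ‖R‖ₑ ^ 2 * (d * (B ^ 2 * C₁)) * cellMeasure d Set.univ
  have hC₃ : C₃ ≠ ⊤ := by finiteness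
  refine ⟨2 * (C₃ + (C₁ + C₂ * (C₁ + 1))) + (1 + d * (C₂ * (C₁ + 1))), by finiteness, ?_⟩
  intro κ hκ w hw hwp
  have hWp := hasPeriodicGradNorm_wave_mul hw hwp κ
  obtain ⟨K, hK⟩ := exists_lipschitzWith_wave_mul hw hwp κ
  have hWs : ContDiff ℝ ∞ fun x => wave κ x * w x := (contDiff_wave κ).mul hw
  have hwd := hw.differentiable (by simp)
  have hg : ∀ x, gradVec 0 (fun y => wave κ y * w y) x = wave κ x • gradVec κ w x :=
    fun x => gradVec_zero_wave_mul κ (hwd x)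
  set W : Space d → ℂ := fun x => wave κ x * w x with hW
  set J := ∫⁻ x in Q₁, ‖gradVec κ w x‖ₑ ^ 2 with hJ
  have hIJ : ∫⁻ x in Q₁, ‖fderiv ℝ W x‖ₑ ^ 2 ≤ J := by
    refine lintegral_mono fun x => ?_
    refine pow_le_pow_left₀ zero_le ((enorm_fderiv_le W x).trans_eq ?_) 2
    rw [hg, enorm_smul, enorm_wave, one_mul]
  obtain ⟨b, hb1, hb2⟩ := hP W hWp
  have hb1' : ∫⁻ x in Q₁, ‖W x - b‖ₑ ^ 2 ≤ C₁ * J := hb1.trans (by gcongr)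
  -- W is multiplied by exp(iκ_j) under a unit shift, so the increment estimate controls (exp(iκ_j)
  -- - 1)b, and hence κ_j b.
  have hb3 : ∀ j, ‖(κ j : ℂ) * b‖ₑ ^ 2 ≤ B ^ 2 * (C₁ * J) := by
    intro j
    have h1 := hb2 j (wave κ (EuclideanSpace.single j 1)) 0 (norm_wave _ _) fun x => by
      have h2 : w (x + EuclideanSpace.single j 1) = w x := by
        rw [← latticeVec_single]; exact hwp _ x
      simp only [hW, wave_add, h2, add_zero]
      ring
    rw [zero_add] at h1
    have h3 : ‖(κ j : ℂ)‖ₑ ≤ B * ‖wave κ (EuclideanSpace.single j 1) - 1‖ₑ := by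
      rw [wave_single, ← ofReal_norm, ← ofReal_norm, ← ENNReal.ofReal_mul (by positivity)]
      refine ENNReal.ofReal_le_ofReal ?_
      rw [Complex.norm_real, Real.norm_eq_abs]
      exact abs_le_norm_exp_sub_one (abs_le.2 ⟨(hκ j).1, (hκ j).2.le⟩)
    calc ‖(κ j : ℂ) * b‖ₑ ^ 2 ≤ (B * ‖wave κ (EuclideanSpace.single j 1) - 1‖ₑ * ‖b‖ₑ) ^ 2 := by
          rw [enorm_mul]; gcongr
      _ = B ^ 2 * ‖(wave κ (EuclideanSpace.single j 1) - 1) * b‖ₑ ^ 2 := by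
          rw [enorm_mul]; ring
      _ ≤ B ^ 2 * (C₁ * J) := by
          gcongr
          exact h1.trans (by gcongr)
  have hb4 : ‖κ‖ₑ ^ 2 * ‖b‖ₑ ^ 2 ≤ d * (B ^ 2 * (C₁ * J)) := by
    rw [enorm_sq_eq_sum, Finset.sum_mul]
    calc _ ≤ ∑ _j : Fin d, B ^ 2 * (C₁ * J) := by
          refine Finset.sum_le_sum fun j _ => ?_
          refine le_trans (le_of_eq ?_) (hb3 j)
          rw [enorm_mul, mul_pow]
          congr 2
          rw [← ofReal_norm, ← ofReal_norm, Complex.norm_real]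
      _ = _ := by simp
  -- Replacing exp(-iκ·x)b by b costs at most |κ||x||b|, where |x| is bounded on the cell.
  have hb5 : ∀ x ∈ cell d, ‖wave (-κ) x * b - b‖ₑ ^ 2 ≤ ‖R‖ₑ ^ 2 * (d * (B ^ 2 * C₁)) * J := by
    intro x hx
    have h1 : ‖wave (-κ) x - 1‖ₑ ≤ ‖κ‖ₑ * ‖R‖ₑ := by
      rw [← ofReal_norm, ← ofReal_norm, ← ofReal_norm, ← ENNReal.ofReal_mul (norm_nonneg _)]
      refine ENNReal.ofReal_le_ofReal ?_
      refine Real.norm_exp_I_mul_ofReal_sub_one_le.trans ((norm_inner_le_norm _ _).trans ?_)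
      rw [norm_neg]
      gcongr
      exact (hR x hx).trans (le_abs_self R)
    calc ‖wave (-κ) x * b - b‖ₑ ^ 2 = (‖wave (-κ) x - 1‖ₑ * ‖b‖ₑ) ^ 2 := by
          rw [← enorm_mul, sub_mul, one_mul]
      _ ≤ (‖κ‖ₑ * ‖R‖ₑ * ‖b‖ₑ) ^ 2 := by gcongr
      _ = ‖R‖ₑ ^ 2 * (‖κ‖ₑ ^ 2 * ‖b‖ₑ ^ 2) := by ring
      _ ≤ ‖R‖ₑ ^ 2 * (d * (B ^ 2 * (C₁ * J))) := by gcongr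
      _ = _ := by ring
  obtain ⟨Φ, ⟨L, hL⟩, hΦ0, hΦ⟩ := hE (fun x => W x - b) (hWs.sub contDiff_const)
    ⟨K, fun x y => by rw [edist_sub_right]; exact hK x y⟩
  have hE1 : energy Q₁ (fun x => W x - b) ≤ (C₁ + 1) * J := by
    have hm : Measurable fun x => ‖W x - b‖ₑ ^ 2 :=
      ((hWs.continuous.sub continuous_const).measurable.enorm).pow_const 2
    rw [energy, lintegral_add_left hm, add_mul, one_mul]
    refine add_le_add hb1' (le_trans (le_of_eq ?_) hIJ)
    simp only [fderiv_sub_const]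
  have hΦ' := hΦ.trans (mul_le_mul_right hE1 C₂)
  rw [← mul_assoc] at hΦ'
  obtain ⟨L', hL'⟩ := exists_lipschitzWith_wave (-κ)
  have hΦc : HasCompactSupport Φ := HasCompactSupport.intro isBounded_softPart.isCompact_closure
    fun x hx => hΦ0 x fun h => hx (subset_closure h)
  obtain ⟨L'', hL''⟩ := exists_lipschitzWith_mul hL hΦc hL'
  set φ : Space d → ℂ := fun x => Φ x * wave (-κ) x with hφ
  have hΦφ : Φ = fun x => wave κ x * φ x := by
    ext x
    have := wave_neg_mul_wave κ x
    simp only [hφ]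
    linear_combination -Φ x * this
  -- The vanishing holds in a whole neighbourhood, since the periodic stiff set is open, so that the
  -- gradient of φ vanishes on Q₁ too.
  have hφQ : ∀ x ∈ Q₁, Φ x = 0 ∧ φ =ᶠ[𝓝 x] 0 := by
    intro x hx
    have h1 : ∀ y ∈ periodization Q₁, Φ y = 0 := fun y hy =>
      hΦ0 y fun h => hQ.notMem_of_mem_softPart h hy
    refine ⟨h1 x (mem_periodization_of_mem hx), ?_⟩
    filter_upwards [hQ.isOpen.mem_nhds (mem_periodization_of_mem hx)] with y hy
    simp [hφ, h1 y hy]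
  refine ⟨b, φ, ⟨L'', hL''⟩, fun x hx => by simp [hφ, hΦ0 x hx], ?_, ?_⟩
  · have h1 : ∀ x ∈ cell d, ‖w x - φ x - b‖ₑ ^ 2 ≤
        2 * (‖R‖ₑ ^ 2 * (d * (B ^ 2 * C₁)) * J + ‖W x - b - Φ x‖ₑ ^ 2) := by
      intro x hx
      have h2 : w x - φ x - b = (wave (-κ) x * b - b) + wave (-κ) x * (W x - b - Φ x) := by
        have := wave_neg_mul_wave κ x
        simp only [hφ, hW]
        linear_combination -w x * this
      rw [h2]
      refine (pow_le_pow_left₀ zero_le (enorm_add_le_add _ _) 2).trans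
        ((sq_add_le_two_mul _ _).trans ?_)
      gcongr
      · exact hb5 x hx
      · rw [enorm_mul, enorm_wave, one_mul]
    have h3 : ∫⁻ x, ‖W x - b - Φ x‖ₑ ^ 2 ∂cellMeasure d ≤ (C₁ + C₂ * (C₁ + 1)) * J := by
      rw [hQ.lintegral_cell_eq, add_mul]
      refine add_le_add ?_ (le_trans ?_ hΦ')
      · refine le_trans (setLIntegral_mono' hQ.measurableSet fun x hx => ?_) hb1'
        rw [(hφQ x hx).1, sub_zero]
      · exact lintegral_mono fun x => le_self_add
    calc _ ≤ ∫⁻ x, 2 * (‖R‖ₑ ^ 2 * (d * (B ^ 2 * C₁)) * J + ‖W x - b - Φ x‖ₑ ^ 2)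
          ∂cellMeasure d := setLIntegral_mono' (measurableSet_cell d) h1
      _ = 2 * (C₃ * J + ∫⁻ x, ‖W x - b - Φ x‖ₑ ^ 2 ∂cellMeasure d) := by
          rw [lintegral_const_mul' _ _ (by finiteness), lintegral_add_left measurable_const,
            lintegral_const]
          ring
      _ ≤ 2 * (C₃ * J + (C₁ + C₂ * (C₁ + 1)) * J) := by gcongr
      _ ≤ _ := by rw [← add_mul, ← mul_assoc]; gcongr; exact le_self_add
  · have h1 : ∫⁻ x in Q₁, ‖gradVec κ w x - gradVec κ φ x‖ₑ ^ 2 ≤ J := by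
      refine setLIntegral_mono' hQ.measurableSet fun x hx => ?_
      have h2 : gradVec κ φ x = 0 := by
        ext j
        rw [gradVec_apply, (hφQ x hx).2.eq_of_nhds, pderiv, (hφQ x hx).2.fderiv_eq]
        simp
      rw [h2, sub_zero]
    have h3 : ∫⁻ x in softPart Q₁, ‖gradVec κ w x - gradVec κ φ x‖ₑ ^ 2 ≤
        d * (C₂ * (C₁ + 1)) * J := by
      calc _ ≤ ∫⁻ x in softPart Q₁, d * (‖W x - b - Φ x‖ₑ ^ 2 +
            ‖fderiv ℝ (fun y => W y - b - Φ y) x‖ₑ ^ 2) := by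
            refine lintegral_mono_ae (ae_restrict_of_ae ?_)
            filter_upwards [hL.ae_differentiableAt (μ := volume),
              hL''.ae_differentiableAt (μ := volume)] with x hx1 hx2
            have h4 : gradVec 0 (fun y => W y - b - Φ y) x =
                wave κ x • (gradVec κ w x - gradVec κ φ x) := by
              rw [gradVec_zero_sub ((hWs.differentiable (by simp) x).sub_const b) hx1, smul_sub,
                ← hg x, ← gradVec_zero_wave_mul κ hx2, ← hΦφ]
              congr 1
              ext j
              simp only [gradVec_apply, pderiv, fderiv_sub_const]
              simp
            have h5 : ‖gradVec κ w x - gradVec κ φ x‖ₑ =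
                ‖gradVec 0 (fun y => W y - b - Φ y) x‖ₑ := by
              rw [h4, enorm_smul, enorm_wave, one_mul]
            rw [h5]
            refine (enorm_gradVec_zero_sq_le _ x).trans ?_
            gcongr
            exact le_add_self
        _ = d * energy (softPart Q₁) (fun x => W x - b - Φ x) := by
            rw [lintegral_const_mul' _ _ (by finiteness)]; rfl
        _ ≤ d * (C₂ * (C₁ + 1) * J) := by gcongr
        _ = _ := by ring
    rw [hQ.lintegral_cell_eq]
    calc _ ≤ J + d * (C₂ * (C₁ + 1)) * J := add_le_add h1 h3
      _ = (1 + d * (C₂ * (C₁ + 1))) * J := by ring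
      _ ≤ _ := mul_le_mul' le_add_self le_rfl

/-- The function iξ·x + w grows by exactly iξ_j over one period. Taking z = 1 in the increment
estimate makes the unknown constant b disappear. -/
theorem IsStiffPart.exists_cell_coercive (hQ : IsStiffPart Q₁) :
    ∃ C : ℝ≥0∞, C ≠ ⊤ ∧ ∀ (ξ : Space d) (w : Space d → ℂ), ContDiff ℝ ∞ w → IsPeriodic w →
      ‖ξ‖ₑ ^ 2 ≤ C * ∫⁻ x in Q₁, ‖gradVec ξ (fun _ => 1) x + gradVec 0 w x‖ₑ ^ 2 := by
  obtain ⟨C, hC, hP⟩ := hQ.exists_poincare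
  refine ⟨d * C, by finiteness, fun ξ w hw hwp => ?_⟩
  obtain ⟨b, -, hb⟩ := hP _ (hasPeriodicGradNorm_add hw hwp ξ)
  set W : Space d → ℂ := fun x => Complex.I * waveForm ξ x + w x with hW
  have hg : ∀ x, gradVec 0 W x = gradVec ξ (fun _ => 1) x + gradVec 0 w x := by
    intro x
    ext j
    rw [PiLp.add_apply, gradVec_apply, gradVec_apply, gradVec_apply, pderiv, pderiv, pderiv,
      hW, fderiv_fun_add ((waveForm ξ).differentiableAt.const_mul _)
      (hw.differentiable (by simp) x), fderiv_const_mul (waveForm ξ).differentiableAt,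
      ContinuousLinearMap.fderiv]
    simp [waveForm_single]
  have hI : ∫⁻ x in Q₁, ‖fderiv ℝ W x‖ₑ ^ 2 ≤
      ∫⁻ x in Q₁, ‖gradVec ξ (fun _ => 1) x + gradVec 0 w x‖ₑ ^ 2 := by
    refine lintegral_mono fun x => ?_
    rw [← hg]
    exact pow_le_pow_left₀ zero_le (enorm_fderiv_le W x) 2
  rw [enorm_sq_eq_sum, mul_assoc]
  calc ∑ j, ‖ξ j‖ₑ ^ 2 ≤ ∑ _j : Fin d,
        C * ∫⁻ x in Q₁, ‖gradVec ξ (fun _ => 1) x + gradVec 0 w x‖ₑ ^ 2 := by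
        gcongr with j
        have h1 := hb j 1 (Complex.I * (ξ j : ℂ)) norm_one fun x => by
          have h2 : w (x + EuclideanSpace.single j 1) = w x := by
            rw [← latticeVec_single]; exact hwp _ x
          simp only [map_add, waveForm_single, h2]
          ring
        rw [sub_self, zero_mul, add_zero, enorm_mul] at h1
        refine le_trans (le_of_eq ?_) (h1.trans (mul_le_mul_right hI C))
        rw [← ofReal_norm, ← ofReal_norm, ← ofReal_norm, Complex.norm_real, Complex.norm_I,
          ENNReal.ofReal_one, one_mul]
    _ = _ := by simp

/-! ### Multiplication operators on `L²(Q)` -/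

/-- The space of values of gradients. -/
abbrev CVec (d : ℕ) : Type := EuclideanSpace ℂ (Fin d)

/-- The space of square integrable vector fields on `Q`. -/
abbrev L2Vec (d : ℕ) : Type := Lp (CVec d) 2 (cellMeasure d)

theorem enorm_sq_eq_lintegral {α E : Type*} [MeasurableSpace α] {μ : Measure α}
    [NormedAddCommGroup E] (f : Lp E 2 μ) : ‖f‖ₑ ^ 2 = ∫⁻ x, ‖f x‖ₑ ^ 2 ∂μ := by
  rw [Lp.enorm_def]
  have h := eLpNorm_nnreal_pow_eq_lintegral (p := 2) (f := f) (μ := μ) two_ne_zero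
  simpa only [NNReal.coe_ofNat, ENNReal.rpow_ofNat, ENNReal.coe_ofNat] using h

theorem norm_sq_eq_integral {α E : Type*} [MeasurableSpace α] {μ : Measure α}
    [NormedAddCommGroup E] [InnerProductSpace ℂ E] (f : Lp E 2 μ) :
    ‖f‖ ^ 2 = ∫ x, ‖f x‖ ^ 2 ∂μ := by
  rw [← FibreModel.re_inner_self_eq, L2.inner_def, ← RCLike.re_eq_complex_re,
    ← integral_re (L2.integrable_inner f f)]
  exact integral_congr_ae (.of_forall fun x => FibreModel.re_inner_self_eq _)

/-- The action of a real matrix on complex vectors. -/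
def coeffMap (M : Matrix (Fin d) (Fin d) ℝ) : CVec d →L[ℂ] CVec d :=
  ∑ i, ∑ j, (M i j : ℂ) •
    (EuclideanSpace.proj j : CVec d →L[ℂ] ℂ).smulRight (EuclideanSpace.single i (1 : ℂ))

theorem coeffMap_apply (M : Matrix (Fin d) (Fin d) ℝ) (p : CVec d) (i : Fin d) :
    coeffMap M p i = ∑ j, (M i j : ℂ) * p j := by
  simp [coeffMap, Pi.single_apply]

theorem inner_coeffMap (M : Matrix (Fin d) (Fin d) ℝ) (p q : CVec d) :
    inner ℂ q (coeffMap M p) = matForm M p q := by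
  simp only [PiLp.inner_apply, coeffMap_apply, matForm, RCLike.inner_apply, Finset.sum_mul]

theorem re_matForm_self (M : Matrix (Fin d) (Fin d) ℝ) (p : Fin d → ℂ) :
    (matForm M p p).re = (fun i => (p i).re) ⬝ᵥ M.mulVec (fun i => (p i).re) +
      (fun i => (p i).im) ⬝ᵥ M.mulVec (fun i => (p i).im) := by
  simp only [matForm, dotProduct, Matrix.mulVec, Complex.re_sum, Finset.mul_sum,
    ← Finset.sum_add_distrib]
  refine Finset.sum_congr rfl fun i _ => Finset.sum_congr rfl fun j _ => ?_
  simp [Complex.mul_re, Complex.mul_im]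
  ring

theorem conj_matForm {M : Matrix (Fin d) (Fin d) ℝ} (hM : M.IsSymm) (p q : Fin d → ℂ) :
    conj (matForm M p q) = matForm M q p := by
  simp only [matForm, map_sum]
  rw [Finset.sum_comm]
  refine Finset.sum_congr rfl fun i _ => Finset.sum_congr rfl fun j _ => ?_
  rw [map_mul, map_mul, Complex.conj_conj, Complex.conj_ofReal, hM.apply]
  ring

theorem le_re_matForm {M : Matrix (Fin d) (Fin d) ℝ} {ν : ℝ}
    (hM : ∀ ξ : Fin d → ℝ, ν * (ξ ⬝ᵥ ξ) ≤ ξ ⬝ᵥ M.mulVec ξ) (p : CVec d) :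
    ν * ‖p‖ ^ 2 ≤ (matForm M p p).re := by
  rw [re_matForm_self]
  refine le_trans (le_of_eq ?_) (add_le_add (hM _) (hM _))
  rw [← mul_add, EuclideanSpace.norm_sq_eq, dotProduct, dotProduct, ← Finset.sum_add_distrib]
  congr 1
  refine Finset.sum_congr rfl fun i _ => ?_
  rw [← Complex.normSq_eq_norm_sq, Complex.normSq_apply]

theorem memLp_sum_sum {α E ι κ : Type*} [MeasurableSpace α] {μ : Measure α}
    [NormedAddCommGroup E] [Fintype ι] [Fintype κ] {p : ℝ≥0∞} {F : ι → κ → α → E}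
    (h : ∀ i j, MemLp (F i j) p μ) : MemLp (fun x => ∑ i, ∑ j, F i j x) p μ :=
  memLp_finsetSum _ fun i _ => memLp_finsetSum _ fun j _ => h i j

namespace IsCoefficient

variable {A : Space d → Matrix (Fin d) (Fin d) ℝ} (hA : IsCoefficient A)

theorem memLp_coeffMap (hA : IsCoefficient A) :
    MemLp (fun x => coeffMap (A x)) ∞ (cellMeasure d) := by
  have h (i j : Fin d) (E : CVec d →L[ℂ] CVec d) :
      MemLp (fun x => (A x i j : ℂ) • E) ∞ (cellMeasure d) := by
    have h1 : MemLp (fun x => (A x i j : ℂ)) ∞ (cellMeasure d) := (hA.bounded i j).ofReal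
    have h2 := (ContinuousLinearMap.toSpanSingleton ℂ E).comp_memLp' h1
    exact h2
  simp only [coeffMap]
  exact memLp_sum_sum fun i j => h i j _

/-- Multiplication by a coefficient matrix. -/
def op : L2Vec d →L[ℂ] L2Vec d :=
  (ContinuousLinearMap.id ℂ (CVec d →L[ℂ] CVec d)).holderL (cellMeasure d) ∞ 2 2
    (hA.memLp_coeffMap.toLp _)

theorem coeFn_op (y : L2Vec d) : hA.op y =ᵐ[cellMeasure d] fun x => coeffMap (A x) (y x) := by
  have h1 : hA.op y =ᵐ[cellMeasure d] fun x => hA.memLp_coeffMap.toLp _ x (y x) :=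
    ContinuousLinearMap.coeFn_holder (r := 2)
      (ContinuousLinearMap.id ℂ (CVec d →L[ℂ] CVec d)) (hA.memLp_coeffMap.toLp _) y
  filter_upwards [h1, hA.memLp_coeffMap.coeFn_toLp] with x h1 h2
  rw [h1, h2]

theorem inner_op_eq_ae (y z : L2Vec d) :
    (fun x => inner ℂ (z x) (hA.op y x)) =ᵐ[cellMeasure d] fun x => matForm (A x) (y x) (z x) := by
  filter_upwards [hA.coeFn_op y] with x hx
  rw [hx, inner_coeffMap]

theorem inner_op (y z : L2Vec d) :
    inner ℂ z (hA.op y) = ∫ x, matForm (A x) (y x) (z x) ∂cellMeasure d := by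
  rw [L2.inner_def]
  exact integral_congr_ae (hA.inner_op_eq_ae y z)

theorem integrable_matForm (hA : IsCoefficient A) (y z : L2Vec d) :
    Integrable (fun x => matForm (A x) (y x) (z x)) (cellMeasure d) :=
  (L2.integrable_inner z (hA.op y)).congr (hA.inner_op_eq_ae y z)

theorem re_inner_op (y : L2Vec d) :
    (inner ℂ y (hA.op y)).re = ∫ x, (matForm (A x) (y x) (y x)).re ∂cellMeasure d := by
  rw [inner_op, ← RCLike.re_eq_complex_re, ← integral_re (hA.integrable_matForm y y)]

theorem inner_op_left (y z : L2Vec d) : inner ℂ (hA.op y) z = inner ℂ y (hA.op z) := by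
  rw [← inner_conj_symm, inner_op, inner_op, ← integral_conj]
  refine integral_congr_ae ?_
  filter_upwards [hA.symm] with x hx
  exact conj_matForm hx _ _

theorem exists_norm_coeffMap_le (hA : IsCoefficient A) :
    ∃ m : ℝ, 0 ≤ m ∧ ∀ᵐ x ∂cellMeasure d, ‖coeffMap (A x)‖ ≤ m := by
  have h := hA.memLp_coeffMap
  refine ⟨(eLpNormEssSup (fun x => coeffMap (A x)) (cellMeasure d)).toReal,
    ENNReal.toReal_nonneg, ?_⟩
  have hfin : eLpNormEssSup (fun x => coeffMap (A x)) (cellMeasure d) ≠ ⊤ := by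
    rw [← eLpNorm_exponent_top]; exact h.2.ne
  filter_upwards [ae_le_eLpNormEssSup (f := fun x => coeffMap (A x)) (μ := cellMeasure d)]
    with x hx
  rw [← ofReal_norm] at hx
  exact (ENNReal.ofReal_le_iff_le_toReal hfin).1 hx

theorem le_re_inner_op {ν : ℝ} (hν : IsEllipticOn A ν (cell d)) (y : L2Vec d) :
    ν * ‖y‖ ^ 2 ≤ (inner ℂ y (hA.op y)).re := by
  rw [re_inner_op, norm_sq_eq_integral, ← integral_const_mul]
  refine integral_mono_ae ((Lp.memLp y).norm.integrable_sq.const_mul ν)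
    (hA.integrable_matForm y y).re ?_
  filter_upwards [hν] with x hx
  exact le_re_matForm hx _

theorem norm_op_sq_le {c : ℝ} (hc : ∀ᵐ x ∂cellMeasure d, ∀ p : CVec d,
    ‖coeffMap (A x) p‖ ^ 2 ≤ c * (matForm (A x) p p).re) (y : L2Vec d) :
    ‖hA.op y‖ ^ 2 ≤ c * (inner ℂ y (hA.op y)).re := by
  rw [re_inner_op, norm_sq_eq_integral, ← integral_const_mul]
  refine integral_mono_ae (Lp.memLp _).norm.integrable_sq
    ((hA.integrable_matForm y y).re.const_mul c) ?_
  filter_upwards [hc, hA.coeFn_op y] with x hx h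
  simp only [h]
  exact hx _

theorem lintegral_le_inner_op {ν : ℝ} {S : Set (Space d)}
    (hSc : S ⊆ cell d) (hν : IsEllipticOn A ν S) (hν0 : 0 ≤ ν)
    (hnn : ∀ᵐ x ∂cellMeasure d, ∀ p : CVec d, 0 ≤ (matForm (A x) p p).re) (y : L2Vec d) :
    ENNReal.ofReal ν * ∫⁻ x in S, ‖y x‖ₑ ^ 2 ≤ ENNReal.ofReal (inner ℂ y (hA.op y)).re := by
  have h1 : Integrable (fun x => (matForm (A x) (y x) (y x)).re) (cellMeasure d) :=
    (hA.integrable_matForm y y).re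
  rw [re_inner_op, ofReal_integral_eq_lintegral_ofReal h1 (hnn.mono fun x hx => hx _), ← lintegral_const_mul' _ _ (by finiteness)]
  calc ∫⁻ x in S, ENNReal.ofReal ν * ‖y x‖ₑ ^ 2
      ≤ ∫⁻ x in S, ENNReal.ofReal (matForm (A x) (y x) (y x)).re := by
        refine lintegral_mono_ae ?_
        filter_upwards [hν] with x hx
        rw [← ofReal_norm, ← ENNReal.ofReal_pow (norm_nonneg _), ← ENNReal.ofReal_mul hν0]
        exact ENNReal.ofReal_le_ofReal (le_re_matForm hx _)
    _ ≤ _ := lintegral_mono_set hSc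

end IsCoefficient

/-- Stiff coefficients: elliptic on `Q₁` and zero on the soft part. -/
theorem IsStiffPart.ae_stiff {Q₁ : Set (Space d)} (hQ : IsStiffPart Q₁)
    {A : Space d → Matrix (Fin d) (Fin d) ℝ} (hA : IsCoefficient A) {ν : ℝ} (hν : 0 < ν)
    (hell : IsEllipticOn A ν Q₁) (h0 : ∀ᵐ x ∂volume.restrict (softPart Q₁), A x = 0) :
    ∃ c : ℝ, 0 ≤ c ∧ ∀ᵐ x ∂cellMeasure d, ∀ p : CVec d, 0 ≤ (matForm (A x) p p).re ∧
      ‖coeffMap (A x) p‖ ^ 2 ≤ c * (matForm (A x) p p).re := by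
  obtain ⟨m, hm0, hm⟩ := hA.exists_norm_coeffMap_le
  -- On Q₁ the chain |Ap|² ≤ m²|p|² ≤ (m²/ν) Ap·p holds, and on the soft part both sides vanish.
  refine ⟨m ^ 2 / ν, by positivity, ?_⟩
  filter_upwards [hm, hQ.ae_mem, ae_restrict_of_ae ((ae_restrict_iff' hQ.measurableSet).1 hell),
    ae_restrict_of_ae ((ae_restrict_iff' isOpen_softPart.measurableSet).1 h0)] with x h1 h2 h3 h4 p
  rcases h2 with h2 | h2
  · have h5 := le_re_matForm (h3 h2) p
    have h6 : 0 ≤ ν * ‖p‖ ^ 2 := by positivity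
    refine ⟨h6.trans h5, ?_⟩
    calc ‖coeffMap (A x) p‖ ^ 2 ≤ (m * ‖p‖) ^ 2 := by
          gcongr
          exact ((coeffMap (A x)).le_opNorm p).trans (by gcongr)
      _ = m ^ 2 / ν * (ν * ‖p‖ ^ 2) := by field_simp
      _ ≤ _ := by gcongr
  · have h5 : coeffMap (A x) p = 0 := by
      ext i
      rw [coeffMap_apply, h4 h2]
      simp
    have h6 : matForm (A x) p p = 0 := by rw [← inner_coeffMap, h5, inner_zero_right]
    rw [h5, h6]
    simp

/-! ### The shift operators -/

/-- A real vector as a complex vector. -/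
def toCVec (κ : Space d) : CVec d := WithLp.toLp 2 fun j => (κ j : ℂ)

theorem norm_toCVec (κ : Space d) : ‖toCVec κ‖ = ‖κ‖ := by
  rw [EuclideanSpace.norm_eq, EuclideanSpace.norm_eq]
  simp [toCVec]

/-- Multiplication by `iκ`. -/
def shiftOp (κ : Space d) : L2Cell d →L[ℂ] L2Vec d :=
  (ContinuousLinearMap.toSpanSingleton ℂ (Complex.I • toCVec κ)).compLpL 2 (cellMeasure d)

theorem coeFn_shiftOp (κ : Space d) (f : L2Cell d) :
    shiftOp κ f =ᵐ[cellMeasure d] fun x => f x • (Complex.I • toCVec κ) :=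
  ContinuousLinearMap.coeFn_compLpL _ f

theorem shiftOp_smul (a : ℝ) (κ : Space d) (f : L2Cell d) :
    shiftOp (a • κ) f = (a : ℂ) • shiftOp κ f := by
  apply Lp.ext
  filter_upwards [coeFn_shiftOp (a • κ) f, coeFn_shiftOp κ f,
    Lp.coeFn_smul (a : ℂ) (shiftOp κ f)] with x h1 h2 h3
  rw [h1, h3, Pi.smul_apply, h2]
  ext j
  simp [toCVec]
  ring

theorem norm_shiftOp_le (κ : Space d) (f : L2Cell d) : ‖shiftOp κ f‖ ≤ ‖κ‖ * ‖f‖ := by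
  refine (ContinuousLinearMap.norm_compLp_le _ f).trans ?_
  gcongr
  rw [ContinuousLinearMap.norm_toSpanSingleton, norm_smul, Complex.norm_I, one_mul, norm_toCVec]

/-! ### Graphs of the gradient -/

/-- Pairs of a function and a vector field in `L²(Q)`. -/
abbrev Graph (d : ℕ) : Type := WithLp 2 (L2Cell d × L2Vec d)

/-- The element `p` is represented by the functions `u` and `g`. -/
structure IsPair (p : Graph d) (u : Space d → ℂ) (g : Space d → Fin d → ℂ) : Prop where
  fst : p.fst =ᵐ[cellMeasure d] u
  snd : p.snd =ᵐ[cellMeasure d] fun x => WithLp.toLp 2 (g x)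

/-- The gradient of `w` as a tuple of partial derivatives. -/
def pgrad (w : Space d → ℂ) : Space d → Fin d → ℂ := fun x j => pderiv j w x

theorem exists_isPair {u : Space d → ℂ} {g : Space d → Fin d → ℂ}
    (hu : MemLp u 2 (cellMeasure d)) (hg : ∀ j, MemLp (fun x => g x j) 2 (cellMeasure d)) :
    ∃ p, IsPair p u g := by
  have hg' : MemLp (fun x => (WithLp.toLp 2 (g x) : CVec d)) 2 (cellMeasure d) :=
    memLp_piLp_iff.2 hg
  exact ⟨WithLp.toLp 2 (hu.toLp u, hg'.toLp _), hu.coeFn_toLp, hg'.coeFn_toLp⟩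

namespace IsPair

variable {p q : Graph d} {u v : Space d → ℂ} {g h : Space d → Fin d → ℂ}

theorem add (hp : IsPair p u g) (hq : IsPair q v h) :
    IsPair (p + q) (fun x => u x + v x) (fun x j => g x j + h x j) := by
  constructor
  · filter_upwards [hp.fst, hq.fst, Lp.coeFn_add p.fst q.fst] with x h1 h2 h3
    rw [WithLp.add_fst, h3, Pi.add_apply, h1, h2]
  · filter_upwards [hp.snd, hq.snd, Lp.coeFn_add p.snd q.snd] with x h1 h2 h3
    rw [WithLp.add_snd, h3, Pi.add_apply, h1, h2]
    rfl

theorem smul (c : ℂ) (hp : IsPair p u g) :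
    IsPair (c • p) (fun x => c * u x) (fun x j => c * g x j) := by
  constructor
  · filter_upwards [hp.fst, Lp.coeFn_smul c p.fst] with x h1 h3
    rw [WithLp.smul_fst, h3, Pi.smul_apply, h1, smul_eq_mul]
  · filter_upwards [hp.snd, Lp.coeFn_smul c p.snd] with x h1 h3
    rw [WithLp.smul_snd, h3, Pi.smul_apply, h1]
    rfl

theorem sub (hp : IsPair p u g) (hq : IsPair q v h) :
    IsPair (p - q) (fun x => u x - v x) (fun x j => g x j - h x j) := by
  have := hp.add (hq.smul (-1))
  simpa [sub_eq_add_neg] using this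

theorem congr (hp : IsPair p u g) (hu : u =ᵐ[cellMeasure d] v)
    (hg : ∀ᵐ x ∂cellMeasure d, g x = h x) : IsPair p v h :=
  ⟨hp.fst.trans hu, hp.snd.trans (hg.mono fun x hx => by simp only [hx])⟩

theorem enorm_fst (hp : IsPair p u g) : ‖p.fst‖ₑ = eLpNorm u 2 (cellMeasure d) := by
  rw [Lp.enorm_def]; exact eLpNorm_congr_ae hp.fst

theorem memLp_snd (hp : IsPair p u g) (j : Fin d) : MemLp (fun x => g x j) 2 (cellMeasure d) :=
  memLp_piLp_iff.1 ((Lp.memLp p.snd).ae_eq hp.snd) j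

theorem eLpNorm_snd_le (hp : IsPair p u g) (j : Fin d) :
    eLpNorm (fun x => g x j) 2 (cellMeasure d) ≤ ‖p.snd‖ₑ := by
  rw [Lp.enorm_def]
  refine eLpNorm_mono_ae ?_
  filter_upwards [hp.snd] with x hx
  rw [hx]
  exact PiLp.norm_apply_le (WithLp.toLp 2 (g x) : CVec d) j

theorem enorm_snd_le (hp : IsPair p u g) :
    ‖p.snd‖ₑ ≤ ∑ j, eLpNorm (fun x => g x j) 2 (cellMeasure d) := by
  rw [Lp.enorm_def, eLpNorm_congr_ae hp.snd]
  have h1 : (fun x => (WithLp.toLp 2 (g x) : CVec d)) =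
      ∑ j, fun x => EuclideanSpace.single j (g x j) := by
    ext x i
    simp [Pi.single_apply]
  rw [h1]
  refine (eLpNorm_sum_le (fun j _ => ?_) (by norm_num)).trans (Finset.sum_le_sum fun j _ => ?_)
  · have : Continuous fun c : ℂ => (EuclideanSpace.single j c : CVec d) :=
      (LinearMap.toSpanSingleton ℂ (CVec d) (EuclideanSpace.single j 1)).continuous_of_finiteDimensional.congr
        fun c => by ext i; simp
    exact this.comp_aestronglyMeasurable (hp.memLp_snd j).1
  · exact eLpNorm_mono fun x => by simp

end IsPair

theorem enorm_le_fst_add_snd (p : Graph d) : ‖p‖ₑ ≤ ‖p.fst‖ₑ + ‖p.snd‖ₑ := by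
  have : ‖p‖ ≤ ‖p.fst‖ + ‖p.snd‖ := by
    refine abs_le_of_sq_le_sq' ?_ (by positivity) |>.2
    rw [WithLp.prod_norm_sq_eq_of_L2]
    nlinarith [mul_nonneg (norm_nonneg p.fst) (norm_nonneg p.snd)]
  simp only [← ofReal_norm]
  rw [← ENNReal.ofReal_add (norm_nonneg _) (norm_nonneg _)]
  exact ENNReal.ofReal_le_ofReal this

theorem enorm_fst_le (p : Graph d) : ‖p.fst‖ₑ ≤ ‖p‖ₑ := by
  simp only [← ofReal_norm]
  exact ENNReal.ofReal_le_ofReal (WithLp.norm_fst_le _ p)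

theorem enorm_snd_le (p : Graph d) : ‖p.snd‖ₑ ≤ ‖p‖ₑ := by
  simp only [← ofReal_norm]
  exact ENNReal.ofReal_le_ofReal (WithLp.norm_snd_le _ p)

theorem tendsto_of_isPair {p : ℕ → Graph d} {q : Graph d} {u : ℕ → Space d → ℂ} {v : Space d → ℂ}
    {g : ℕ → Space d → Fin d → ℂ} {h : Space d → Fin d → ℂ} (hp : ∀ n, IsPair (p n) (u n) (g n))
    (hq : IsPair q v h)
    (h1 : Tendsto (fun n => eLpNorm (fun x => u n x - v x) 2 (cellMeasure d)) atTop (𝓝 0))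
    (h2 : ∀ j, Tendsto (fun n => eLpNorm (fun x => g n x j - h x j) 2 (cellMeasure d))
      atTop (𝓝 0)) : Tendsto p atTop (𝓝 q) := by
  rw [tendsto_iff_edist_tendsto_0]
  have h3 : Tendsto (fun n => eLpNorm (fun x => u n x - v x) 2 (cellMeasure d) +
      ∑ j, eLpNorm (fun x => g n x j - h x j) 2 (cellMeasure d)) atTop (𝓝 0) := by
    simpa using h1.add (tendsto_finsetSum Finset.univ fun j _ => h2 j)
  refine tendsto_of_tendsto_of_tendsto_of_le_of_le tendsto_const_nhds h3 (fun _ => zero_le)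
    fun n => ?_
  have h4 := (hp n).sub hq
  rw [edist_eq_enorm_sub]
  refine (enorm_le_fst_add_snd _).trans ?_
  rw [h4.enorm_fst]
  gcongr
  exact h4.enorm_snd_le

theorem tendsto_eLpNorm_of_isPair {p : ℕ → Graph d} {q : Graph d} {u : ℕ → Space d → ℂ}
    {v : Space d → ℂ} {g : ℕ → Space d → Fin d → ℂ} {h : Space d → Fin d → ℂ}
    (hp : ∀ n, IsPair (p n) (u n) (g n)) (hq : IsPair q v h) (hlim : Tendsto p atTop (𝓝 q)) :
    Tendsto (fun n => eLpNorm (fun x => u n x - v x) 2 (cellMeasure d)) atTop (𝓝 0) ∧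
    ∀ j, Tendsto (fun n => eLpNorm (fun x => g n x j - h x j) 2 (cellMeasure d)) atTop (𝓝 0) := by
  rw [tendsto_iff_edist_tendsto_0] at hlim
  refine ⟨tendsto_of_tendsto_of_tendsto_of_le_of_le tendsto_const_nhds hlim (fun _ => zero_le)
    fun n => ?_, fun j => tendsto_of_tendsto_of_tendsto_of_le_of_le tendsto_const_nhds hlim
    (fun _ => zero_le) fun n => ?_⟩
  · rw [edist_eq_enorm_sub, ← ((hp n).sub hq).enorm_fst]
    exact enorm_fst_le _
  · rw [edist_eq_enorm_sub]
    exact (((hp n).sub hq).eLpNorm_snd_le j).trans (enorm_snd_le _)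

theorem memLp_cell_of_continuous {f : Space d → ℂ} (hf : Continuous f) :
    MemLp f 2 (cellMeasure d) := by
  obtain ⟨M, hM⟩ := (isBounded_cell (d := d)).isCompact_closure.exists_bound_of_continuousOn
    hf.continuousOn
  refine MemLp.of_bound hf.aestronglyMeasurable M ?_
  filter_upwards [ae_restrict_mem (measurableSet_cell d)] with x hx
  exact hM x (subset_closure hx)

theorem continuous_pderiv {w : Space d → ℂ} (hw : ContDiff ℝ ∞ w) (j : Fin d) :
    Continuous (pderiv j w) :=
  (hw.continuous_fderiv (by simp)).clm_apply continuous_const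

theorem exists_isPair_of_contDiff {w : Space d → ℂ} (hw : ContDiff ℝ ∞ w) :
    ∃ p, IsPair p w (pgrad w) :=
  exists_isPair (memLp_cell_of_continuous hw.continuous) fun j =>
    memLp_cell_of_continuous (continuous_pderiv hw j)

theorem isPair_add_pgrad {p q : Graph d} {u v : Space d → ℂ} (hu : ContDiff ℝ ∞ u)
    (hv : ContDiff ℝ ∞ v) (hp : IsPair p u (pgrad u)) (hq : IsPair q v (pgrad v)) :
    IsPair (p + q) (u + v) (pgrad (u + v)) :=
  (hp.add hq).congr .rfl (.of_forall fun x => by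
    ext j
    simp only [pgrad, pderiv]
    rw [fderiv_add (hu.differentiable (by simp) x) (hv.differentiable (by simp) x)]
    rfl)

theorem isPair_smul_pgrad {p : Graph d} {u : Space d → ℂ} (c : ℂ) (hu : ContDiff ℝ ∞ u)
    (hp : IsPair p u (pgrad u)) : IsPair (c • p) (c • u) (pgrad (c • u)) :=
  (hp.smul c).congr .rfl (.of_forall fun x => by
    ext j
    simp only [pgrad, pderiv]
    rw [fderiv_const_smul (hu.differentiable (by simp) x)]
    rfl)

theorem isPair_zero : IsPair (0 : Graph d) 0 (pgrad 0) := by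
  constructor
  · exact Lp.coeFn_zero ℂ 2 (cellMeasure d)
  · filter_upwards [Lp.coeFn_zero (CVec d) 2 (cellMeasure d)] with x hx
    rw [WithLp.zero_snd, hx]
    ext j
    simp [pgrad, pderiv]

/-- The smooth periodic functions, as a subspace of `Graph d`. -/
def smoothPeriodic (d : ℕ) : Submodule ℂ (Graph d) where
  carrier := {p | ∃ w, ContDiff ℝ ∞ w ∧ IsPeriodic w ∧ IsPair p w (pgrad w)}
  add_mem' := by
    rintro p q ⟨u, hu, hup, hp⟩ ⟨v, hv, hvp, hq⟩
    exact ⟨u + v, hu.add hv, fun n x => by simp only [Pi.add_apply, hup n x, hvp n x],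
      isPair_add_pgrad hu hv hp hq⟩
  zero_mem' := ⟨0, contDiff_const, fun _ _ => rfl, isPair_zero⟩
  smul_mem' := by
    rintro c p ⟨u, hu, hup, hp⟩
    exact ⟨c • u, hu.const_smul c, fun n x => by simp only [Pi.smul_apply, hup n x],
      isPair_smul_pgrad c hu hp⟩

/-- The test functions in `O`, as a subspace of `Graph d`. -/
def testGraph (O : Set (Space d)) : Submodule ℂ (Graph d) where
  carrier := {p | ∃ φ, (ContDiff ℝ ∞ φ ∧ HasCompactSupport φ ∧ tsupport φ ⊆ O) ∧
    IsPair p φ (pgrad φ)}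
  add_mem' := by
    rintro p q ⟨u, ⟨hu, huc, hus⟩, hp⟩ ⟨v, ⟨hv, hvc, hvs⟩, hq⟩
    exact ⟨u + v, ⟨hu.add hv, huc.add hvc, (tsupport_add u v).trans (Set.union_subset hus hvs)⟩,
      isPair_add_pgrad hu hv hp hq⟩
  zero_mem' := ⟨0, ⟨contDiff_const, HasCompactSupport.zero, by
    rw [tsupport_eq_empty_iff.2 rfl]; exact Set.empty_subset O⟩, isPair_zero⟩
  smul_mem' := by
    rintro c p ⟨u, ⟨hu, huc, hus⟩, hp⟩
    exact ⟨c • u, ⟨hu.const_smul c, huc.mono (Function.support_const_smul_subset c u),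
      (closure_mono (Function.support_const_smul_subset c u)).trans hus⟩,
      isPair_smul_pgrad c hu hp⟩

/-- The graph of the gradient on `H¹_#(Q)`. -/
def periodicGraph (d : ℕ) : Submodule ℂ (Graph d) := (smoothPeriodic d).topologicalClosure

/-- The graph of the gradient on `H¹₀(O)`. -/
def zeroGraph (O : Set (Space d)) : Submodule ℂ (Graph d) := (testGraph O).topologicalClosure

theorem exists_mem_zeroGraph {O : Set (Space d)} {v : Space d → ℂ} {g : Space d → Fin d → ℂ}
    (h : MemH10 O v g) : ∃ p ∈ zeroGraph O, IsPair p v g := by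
  obtain ⟨q, hq⟩ := exists_isPair (h.memLp.restrict (cell d)) fun j =>
    (h.grad_memLp j).restrict (cell d)
  obtain ⟨φ, hφ, h1, h2⟩ := h.approx
  choose p hp using fun n => exists_isPair_of_contDiff (hφ n).1
  refine ⟨q, mem_closure_of_tendsto (tendsto_of_isPair hp hq ?_ fun j => ?_)
    (.of_forall fun n => ⟨φ n, hφ n, hp n⟩), hq⟩
  · exact tendsto_of_tendsto_of_tendsto_of_le_of_le tendsto_const_nhds h1 (fun _ => zero_le)
      fun n => eLpNorm_restrict_le _ _ _ _
  · exact tendsto_of_tendsto_of_tendsto_of_le_of_le tendsto_const_nhds (h2 j) (fun _ => zero_le)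
      fun n => eLpNorm_restrict_le _ _ _ _

/-- Extend by zero outside the cell. The approximating test functions vanish there as well, so
convergence on the cell is convergence on the whole space. -/
theorem exists_memH10 {O : Set (Space d)} (hO : O ⊆ cell d) {p : Graph d} (hp : p ∈ zeroGraph O) :
    ∃ v g, MemH10 O v g ∧ IsPair p v g := by
  obtain ⟨q, hq, hlim⟩ := mem_closure_iff_seq_limit.1 hp
  choose φ hφ hqφ using hq
  have hind : ∀ x ∈ cell d, ∀ f : Space d → ℂ, (cell d).indicator f x = f x :=
    fun x hx f => Set.indicator_of_mem hx f
  set v : Space d → ℂ := (cell d).indicator p.fst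
  set g : Space d → Fin d → ℂ := fun x j => (cell d).indicator (fun y => p.snd y j) x
  have hpv : IsPair p v g := by
    constructor
    · filter_upwards [ae_restrict_mem (measurableSet_cell d)] with x hx
      exact (hind x hx _).symm
    · filter_upwards [ae_restrict_mem (measurableSet_cell d)] with x hx
      ext j
      exact (hind x hx fun y => p.snd y j).symm
  have hm : ∀ f : Space d → ℂ, MemLp f 2 (cellMeasure d) → MemLp ((cell d).indicator f) 2 volume :=
    fun f hf => (memLp_indicator_iff_restrict (measurableSet_cell d)).2 hf
  have key : ∀ ψ f : Space d → ℂ, (∀ x ∉ cell d, ψ x = 0) →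
      eLpNorm (fun x => ψ x - (cell d).indicator f x) 2 volume =
        eLpNorm (fun x => ψ x - (cell d).indicator f x) 2 (cellMeasure d) := by
    intro ψ f hψ
    rw [← eLpNorm_indicator_eq_eLpNorm_restrict (measurableSet_cell d)]
    congr 1
    ext x
    by_cases hx : x ∈ cell d
    · rw [Set.indicator_of_mem hx, Set.indicator_of_mem hx, Set.indicator_of_mem hx]
    · rw [Set.indicator_of_notMem hx, Set.indicator_of_notMem hx, hψ x hx, sub_zero]
  have hs : ∀ n, ∀ x ∉ cell d, x ∉ tsupport (φ n) := fun n x hx h => hx (hO ((hφ n).2.2 h))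
  obtain ⟨h1, h2⟩ := tendsto_eLpNorm_of_isPair hqφ hpv hlim
  refine ⟨v, g, ⟨hm _ (Lp.memLp p.fst), fun j => hm _ (memLp_piLp_iff.1 (Lp.memLp p.snd) j),
    φ, hφ, ?_, fun j => ?_⟩, hpv⟩
  · refine h1.congr fun n => (key (φ n) p.fst fun x hx => ?_).symm
    exact image_eq_zero_of_notMem_tsupport (hs n x hx)
  · refine (h2 j).congr fun n => (key (pderiv j (φ n)) (fun y => p.snd y j) fun x hx => ?_).symm
    exact pderiv_eq_zero_of_notMem_tsupport (hs n x hx) j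

theorem ae_eq_zero_of_tendsto {O : Set (Space d)} (hO : MeasurableSet O) {f : ℕ → Space d → ℂ}
    {v : Space d → ℂ} (hv : MemLp v 2 volume) (hf : ∀ n, ∀ x ∉ O, f n x = 0)
    (h : Tendsto (fun n => eLpNorm (fun x => f n x - v x) 2 volume) atTop (𝓝 0)) :
    ∀ᵐ x, x ∉ O → v x = 0 := by
  refine (ae_restrict_iff' hO.compl).1 ?_
  have h2 : eLpNorm v 2 (volume.restrict Oᶜ) = 0 := by
    refine le_antisymm (ge_of_tendsto' h fun n => ?_) zero_le
    refine le_trans (le_of_eq ?_) (eLpNorm_restrict_le _ _ _ Oᶜ)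
    rw [← eLpNorm_neg]
    refine eLpNorm_congr_ae ?_
    filter_upwards [ae_restrict_mem hO.compl] with x hx
    rw [hf n x hx, zero_sub]
    rfl
  exact (eLpNorm_eq_zero_iff (hv.restrict Oᶜ).1 two_ne_zero).1 h2

theorem MemH10.ae_eq_zero {O : Set (Space d)} {v : Space d → ℂ} {g : Space d → Fin d → ℂ}
    (h : MemH10 O v g) (hO : MeasurableSet O) : ∀ᵐ x, x ∉ O → v x = 0 := by
  obtain ⟨φ, hφ, h1, -⟩ := h.approx
  exact ae_eq_zero_of_tendsto hO h.memLp
    (fun n x hx => image_eq_zero_of_notMem_tsupport fun h => hx ((hφ n).2.2 h)) h1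

theorem MemH10.ae_grad_eq_zero {O : Set (Space d)} {v : Space d → ℂ} {g : Space d → Fin d → ℂ}
    (h : MemH10 O v g) (hO : MeasurableSet O) : ∀ᵐ x, x ∉ O → g x = 0 := by
  obtain ⟨φ, hφ, -, h2⟩ := h.approx
  have h3 : ∀ᵐ x, ∀ j, x ∉ O → g x j = 0 := ae_all_iff.2 fun j =>
    ae_eq_zero_of_tendsto hO (f := fun n => pderiv j (φ n)) (h.grad_memLp j)
      (fun n x hx => pderiv_eq_zero_of_notMem_tsupport (fun h => hx ((hφ n).2.2 h)) j) (h2 j)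
  filter_upwards [h3] with x hx hxO
  ext j
  exact hx j hxO

/-! ### Mollification in `L²` -/

theorem eLpNorm_two_sq {α E : Type*} [MeasurableSpace α] [NormedAddCommGroup E] (f : α → E)
    (μ : Measure α) : eLpNorm f 2 μ ^ 2 = ∫⁻ x, ‖f x‖ₑ ^ 2 ∂μ := by
  have h := eLpNorm_nnreal_pow_eq_lintegral (p := 2) (f := f) (μ := μ) two_ne_zero
  simpa only [NNReal.coe_ofNat, ENNReal.rpow_ofNat, ENNReal.coe_ofNat] using h

theorem mollify_congr_ae (ρ : ContDiffBump (0 : Space d)) {f g : Space d → ℂ}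
    (h : f =ᵐ[volume] g) : mollify ρ f = mollify ρ g := by
  ext x
  rw [mollify_apply', mollify_apply']
  refine integral_congr_ae ?_
  filter_upwards [h] with t ht
  rw [ht]

theorem mollify_congr_of_ball {r : ℝ} (hr : 0 < r) {f g : Space d → ℂ} {x : Space d}
    (h : ∀ y ∈ Metric.ball x r, f y = g y) :
    mollify (bump d r hr) f x = mollify (bump d r hr) g x := by
  rw [mollify_apply, mollify_apply]
  refine integral_congr_ae (.of_forall fun t => ?_)
  by_cases ht : t ∈ Metric.ball (0 : Space d) r
  · have : x - t ∈ Metric.ball x r := by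
      rw [mem_ball_iff_norm, sub_sub_cancel_left, norm_neg]
      exact mem_ball_zero_iff.1 ht
    simp only [h _ this]
  · have : (bump d r hr).normed volume t = 0 := by
      rw [← Function.notMem_support, (bump d r hr).support_normed_eq]
      exact ht
    simp only [this, zero_smul]

theorem integrable_mollify (ρ : ContDiffBump (0 : Space d)) {u : Space d → ℂ}
    (hu : LocallyIntegrable u) (x : Space d) :
    Integrable fun t => ρ.normed volume t • u (x - t) :=
  ρ.hasCompactSupport_normed.convolutionExists_left (ContinuousLinearMap.lsmul ℝ ℝ)
    ρ.continuous_normed hu x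

theorem mollify_sub (ρ : ContDiffBump (0 : Space d)) {u v : Space d → ℂ}
    (hu : LocallyIntegrable u) (hv : LocallyIntegrable v) (x : Space d) :
    mollify ρ (fun y => u y - v y) x = mollify ρ u x - mollify ρ v x := by
  rw [mollify_apply, mollify_apply, mollify_apply,
    ← integral_sub (integrable_mollify ρ hu x) (integrable_mollify ρ hv x)]
  simp only [smul_sub]

theorem IsPeriodic.mollify {u : Space d → ℂ} (hu : IsPeriodic u)
    (ρ : ContDiffBump (0 : Space d)) : IsPeriodic (mollify ρ u) := fun n x => by
  rw [mollify_apply, mollify_apply]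
  refine integral_congr_ae (.of_forall fun t => ?_)
  simp only [add_sub_right_comm x _ t, hu n (x - t)]

/-- The normalised bump is the density of a probability measure, so Jensen's inequality, Tonelli and
translation invariance give the bound. -/
theorem lintegral_mollify_sq_le_of_measurable (ρ : ContDiffBump (0 : Space d)) {f : Space d → ℂ}
    (hf : Measurable f) : ∫⁻ x, ‖mollify ρ f x‖ₑ ^ 2 ≤ ∫⁻ x, ‖f x‖ₑ ^ 2 := by
  set w : Space d → ℝ≥0∞ := fun t => ENNReal.ofReal (ρ.normed volume t) with hw
  have hwm : Measurable w := ρ.continuous_normed.measurable.ennreal_ofReal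
  set κ := (volume : Measure (Space d)).withDensity w with hκ
  have hprob : IsProbabilityMeasure κ := by
    refine ⟨?_⟩
    rw [hκ, withDensity_apply _ MeasurableSet.univ, Measure.restrict_univ,
      ← ofReal_integral_eq_lintegral_ofReal ρ.integrable_normed
        (.of_forall ρ.nonneg_normed), ρ.integral_normed, ENNReal.ofReal_one]
  have hm : Measurable fun p : Space d × Space d => ‖f (p.1 - p.2)‖ₑ ^ 2 :=
    ((hf.comp (measurable_fst.sub measurable_snd)).enorm).pow_const 2
  have h1 : ∀ x, ‖mollify ρ f x‖ₑ ^ 2 ≤ ∫⁻ t, ‖f (x - t)‖ₑ ^ 2 ∂κ := by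
    intro x
    have hmx : Measurable fun t => ‖f (x - t)‖ₑ :=
      (hf.comp (measurable_const.sub measurable_id)).enorm
    refine le_trans (pow_le_pow_left₀ zero_le ?_ 2) (sq_lintegral_le κ hmx.aemeasurable)
    rw [hκ, lintegral_withDensity_eq_lintegral_mul _ hwm hmx, mollify_apply]
    refine (enorm_integral_le_lintegral_enorm _).trans (lintegral_mono fun t => ?_)
    rw [enorm_smul, Pi.mul_apply, hw, ← ofReal_norm, Real.norm_of_nonneg (ρ.nonneg_normed t)]
  calc ∫⁻ x, ‖mollify ρ f x‖ₑ ^ 2 ≤ ∫⁻ x, ∫⁻ t, ‖f (x - t)‖ₑ ^ 2 ∂κ := lintegral_mono h1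
    _ = ∫⁻ t, (∫⁻ x, ‖f (x - t)‖ₑ ^ 2) ∂κ := lintegral_lintegral_swap hm.aemeasurable
    _ = ∫⁻ _t, (∫⁻ x, ‖f x‖ₑ ^ 2) ∂κ := by
        refine lintegral_congr fun t => ?_
        exact lintegral_sub_right_eq_self (fun x => ‖f x‖ₑ ^ 2) t
    _ = ∫⁻ x, ‖f x‖ₑ ^ 2 := by rw [lintegral_const, measure_univ, mul_one]

/-- Mollification is a contraction of `L²`. -/
theorem eLpNorm_mollify_le (ρ : ContDiffBump (0 : Space d)) {f : Space d → ℂ}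
    (hf : AEStronglyMeasurable f volume) :
    eLpNorm (mollify ρ f) 2 volume ≤ eLpNorm f 2 volume := by
  rw [mollify_congr_ae ρ hf.ae_eq_mk, eLpNorm_congr_ae hf.ae_eq_mk,
    ← ENNReal.pow_le_pow_left_iff two_ne_zero, eLpNorm_two_sq, eLpNorm_two_sq]
  exact lintegral_mollify_sq_le_of_measurable ρ hf.stronglyMeasurable_mk.measurable

theorem tendsto_eLpNorm_mollify_of_continuous {r : ℕ → ℝ} (hr : ∀ n, 0 < r n)
    (hr0 : Tendsto r atTop (𝓝 0)) (hr1 : ∀ n, r n ≤ 1) {f : Space d → ℂ} (hf : Continuous f)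
    (hfc : HasCompactSupport f) :
    Tendsto (fun n => eLpNorm (fun x => mollify (bump d (r n) (hr n)) f x - f x) 2 volume)
      atTop (𝓝 0) := by
  obtain ⟨M, hM⟩ := hfc.exists_bound_of_continuous hf
  have hB : IsCompact (Metric.cthickening 1 (tsupport f)) := hfc.isCompact.cthickening
  refine tendsto_eLpNorm_two_zero hB.measurableSet hB.measure_lt_top.ne (M := M + M)
    (fun n => ?_) (fun n => .of_forall fun x => ?_) (fun n => .of_forall fun x hx => ?_) ?_
  · exact ((contDiff_mollify _ hf.locallyIntegrable).continuous.sub hf).aestronglyMeasurable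
  · exact (norm_sub_le _ _).trans (add_le_add (norm_mollify_le _ hM x) (hM x))
  · rw [mollify_eq_zero (hr n) fun h => hx (Metric.cthickening_mono (hr1 n) _ h),
      image_eq_zero_of_notMem_tsupport fun h => hx (Metric.self_subset_cthickening _ h), sub_zero]
  · filter_upwards [ae_tendsto_mollify hr hr0 hf.locallyIntegrable] with x hx
    simpa using hx.sub_const (f x)

/-- By density of compactly supported continuous functions and the contraction property, the error
splits into three pieces of size ε/3. -/
theorem tendsto_eLpNorm_mollify {r : ℕ → ℝ} (hr : ∀ n, 0 < r n)
    (hr0 : Tendsto r atTop (𝓝 0)) (hr1 : ∀ n, r n ≤ 1) {f : Space d → ℂ}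
    (hf : MemLp f 2 volume) :
    Tendsto (fun n => eLpNorm (fun x => mollify (bump d (r n) (hr n)) f x - f x) 2 volume)
      atTop (𝓝 0) := by
  rw [ENNReal.tendsto_nhds_zero]
  intro ε hε
  have hε3 : ε / 3 ≠ 0 := (ENNReal.div_pos hε.ne' (by norm_num)).ne'
  obtain ⟨g, hgc, hfg, hg, hgL⟩ := hf.exists_hasCompactSupport_eLpNorm_sub_le (by norm_num) hε3
  have h := ENNReal.tendsto_nhds_zero.1 (tendsto_eLpNorm_mollify_of_continuous hr hr0 hr1 hg hgc)
    (ε / 3) (pos_iff_ne_zero.2 hε3)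
  have hfl : LocallyIntegrable f := hf.locallyIntegrable (by norm_num)
  filter_upwards [h] with n hn
  set ρ := bump d (r n) (hr n)
  have hm : AEStronglyMeasurable (mollify ρ (f - g)) volume :=
    (contDiff_mollify ρ (hfl.sub hg.locallyIntegrable)).continuous.aestronglyMeasurable
  have hm' : AEStronglyMeasurable (fun x => mollify ρ g x - g x) volume :=
    ((contDiff_mollify ρ hg.locallyIntegrable).continuous.sub hg).aestronglyMeasurable
  have h1 : (fun x => mollify ρ f x - f x) =
      (mollify ρ (f - g) + fun x => mollify ρ g x - g x) - (f - g) := by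
    ext x
    simp only [Pi.sub_apply, Pi.add_apply]
    rw [show f - g = fun y => f y - g y from rfl, mollify_sub ρ hfl hg.locallyIntegrable]
    ring
  rw [h1]
  calc _ ≤ eLpNorm (mollify ρ (f - g)) 2 volume +
        eLpNorm (fun x => mollify ρ g x - g x) 2 volume + eLpNorm (f - g) 2 volume :=
      (eLpNorm_sub_le (hm.add hm') (hf.1.sub hgL.1) (by norm_num)).trans
        (add_le_add_left (eLpNorm_add_le hm hm' (by norm_num)) _)
    _ ≤ ε / 3 + ε / 3 + ε / 3 := by
        gcongr
        exact (eLpNorm_mollify_le ρ (hf.1.sub hgL.1)).trans hfg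
    _ = ε := ENNReal.add_thirds ε

/-! ### Functions in `H¹_#(Q)` and the closure of the smooth periodic functions -/

theorem MemL2loc.locallyIntegrable {f : Space d → ℂ} (hf : MemL2loc f) : LocallyIntegrable f := by
  rw [locallyIntegrable_iff]
  intro K hK
  have : IsFiniteMeasure (volume.restrict K) := ⟨by simpa using hK.measure_lt_top⟩
  exact (hf K hK).integrable (by norm_num)

theorem MemL2loc.memLp_cell {f : Space d → ℂ} (hf : MemL2loc f) : MemLp f 2 (cellMeasure d) :=
  (hf _ isBounded_cell.isCompact_closure).mono_measure
    (Measure.restrict_mono subset_closure le_rfl)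

/-- On the cell, mollification at scale at most 1 only sees f on the unit neighbourhood, so f may be
truncated there to become globally square integrable. -/
theorem MemL2loc.tendsto_mollify {r : ℕ → ℝ} (hr : ∀ n, 0 < r n)
    (hr0 : Tendsto r atTop (𝓝 0)) (hr1 : ∀ n, r n ≤ 1) {f : Space d → ℂ} (hf : MemL2loc f) :
    Tendsto (fun n => eLpNorm (fun x => mollify (bump d (r n) (hr n)) f x - f x) 2
      (cellMeasure d)) atTop (𝓝 0) := by
  set B := Metric.cthickening 1 (closure (cell d))
  have hB : IsCompact B := isBounded_cell.isCompact_closure.cthickening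
  have hL : MemLp (B.indicator f) 2 volume :=
    (memLp_indicator_iff_restrict hB.measurableSet).2 (hf B hB)
  refine tendsto_of_tendsto_of_tendsto_of_le_of_le tendsto_const_nhds
    (tendsto_eLpNorm_mollify hr hr0 hr1 hL) (fun _ => zero_le) fun n => ?_
  refine le_trans (le_of_eq ?_) (eLpNorm_restrict_le _ _ _ (cell d))
  refine eLpNorm_congr_ae ?_
  filter_upwards [ae_restrict_mem (measurableSet_cell d)] with x hx
  have hxB : ∀ y ∈ Metric.ball x (r n), f y = B.indicator f y := fun y hy =>
    (Set.indicator_of_mem (Metric.mem_cthickening_of_dist_le y x 1 _ (subset_closure hx)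
      ((Metric.mem_ball.1 hy).le.trans (hr1 n))) f).symm
  rw [mollify_congr_of_ball (hr n) hxB, ← hxB x (Metric.mem_ball_self (hr n))]

/-- Mollification preserves periodicity and commutes with the weak gradient, so the mollified
functions approximate both components of the pair. -/
theorem exists_mem_periodicGraph {u : Space d → ℂ} {g : Space d → Fin d → ℂ} (h : MemH1Per u g) :
    ∃ p ∈ periodicGraph d, IsPair p u g := by
  obtain ⟨q, hq⟩ := exists_isPair h.memL2loc.memLp_cell fun j => (h.grad_memL2loc j).memLp_cell
  set r : ℕ → ℝ := fun n => 1 / ((n : ℝ) + 1)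
  have hr : ∀ n, 0 < r n := fun n => by positivity
  have hr0 : Tendsto r atTop (𝓝 0) := tendsto_one_div_add_atTop_nhds_zero_nat
  have hr1 : ∀ n, r n ≤ 1 := fun n => by
    rw [div_le_one (by positivity)]; linarith [(Nat.cast_nonneg n : (0 : ℝ) ≤ n)]
  have hloc := h.memL2loc.locallyIntegrable
  have hw := fun n => contDiff_mollify (bump d (r n) (hr n)) hloc
  choose p hp using fun n => exists_isPair_of_contDiff (hw n)
  refine ⟨q, mem_closure_of_tendsto (tendsto_of_isPair hp hq
    (h.memL2loc.tendsto_mollify hr hr0 hr1) fun j => ?_)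
    (.of_forall fun n => ⟨_, hw n, h.periodic.mollify _, hp n⟩), hq⟩
  refine ((h.grad_memL2loc j).tendsto_mollify hr hr0 hr1).congr fun n => ?_
  congr 1
  ext x
  rw [← fderiv_mollify _ hloc h.isWeakGradient]
  rfl

/-- The representative of `x` modulo the lattice in the cell. -/
def cellRep (x : Space d) : Space d := x - latticeVec (floorVec x)

theorem cellRep_of_mem {x : Space d} (hx : x ∈ cell d) : cellRep x = x := by
  have h0 : latticeVec (0 : Fin d → ℤ) = 0 := by ext j; simp
  have h := eq_floorVec (x := x) (n := 0) (by rwa [h0, sub_zero])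
  rw [cellRep, ← h, h0, sub_zero]

theorem isPeriodic_cellRep : IsPeriodic (cellRep (d := d)) := fun n x => by
  have h : floorVec x + n = floorVec (x + latticeVec n) := eq_floorVec (by
    rw [latticeVec_add, add_sub_add_right_eq_sub]
    exact sub_floorVec_mem_cell x)
  rw [cellRep, ← h, latticeVec_add, add_sub_add_right_eq_sub]
  rfl

theorem measurable_cellRep : Measurable (cellRep (d := d)) := by
  have : Measurable fun x : Space d => latticeVec (floorVec x) := by
    refine (WithLp.measurable_toLp 2 _).comp (measurable_pi_lambda _ fun j => ?_)
    exact (measurable_from_top (f := fun n : ℤ => (n : ℝ))).comp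
      (Measurable.floor (by fun_prop))
  exact measurable_id.sub this

theorem memL2loc_comp_cellRep {f : Space d → ℂ} (hf : Measurable f)
    (hfL : MemLp f 2 (cellMeasure d)) : MemL2loc fun x => f (cellRep x) := by
  intro K hK
  refine ⟨(hf.comp measurable_cellRep).aestronglyMeasurable, ?_⟩
  obtain ⟨m, hm⟩ := exists_lintegral_le_of_isBounded hK.isBounded
  have h1 := hm (cell d) subset_rfl (fun x => ‖f (cellRep x)‖ₑ ^ 2)
    (isPeriodic_cellRep.comp fun x => ‖f x‖ₑ ^ 2)
  rw [periodization_cell, Set.inter_univ] at h1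
  have h2 : ∫⁻ x in cell d, ‖f (cellRep x)‖ₑ ^ 2 = eLpNorm f 2 (cellMeasure d) ^ 2 := by
    rw [eLpNorm_two_sq]
    exact setLIntegral_congr_fun (measurableSet_cell d) fun x hx => by
      simp only [cellRep_of_mem hx]
  rw [h2, ← eLpNorm_two_sq] at h1
  have h3 : eLpNorm (fun x => f (cellRep x)) 2 (volume.restrict K) ^ 2 < ⊤ :=
    h1.trans_lt (ENNReal.mul_lt_top (by simp) (ENNReal.pow_lt_top hfL.2))
  exact ENNReal.pow_lt_top_iff.1 h3 |>.resolve_right two_ne_zero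

/-- The support of the test function meets finitely many cells. For periodic functions, L²
convergence on one cell therefore suffices to pass to the limit in the weak gradient identity. -/
theorem tendsto_integral_smul_of_periodic {ψ : Space d → ℝ} (hψ : Continuous ψ)
    (hψc : HasCompactSupport ψ) {u : ℕ → Space d → ℂ} {v : Space d → ℂ}
    (hu : ∀ n, LocallyIntegrable (u n)) (hv : LocallyIntegrable v) (hup : ∀ n, IsPeriodic (u n))
    (hvp : IsPeriodic v)
    (h : Tendsto (fun n => eLpNorm (fun x => u n x - v x) 2 (cellMeasure d)) atTop (𝓝 0)) :
    Tendsto (fun n => ∫ x, ψ x • u n x) atTop (𝓝 (∫ x, ψ x • v x)) := by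
  obtain ⟨M, hM⟩ := hψc.exists_bound_of_continuous hψ
  obtain ⟨m, hm⟩ := exists_lintegral_le_of_isBounded hψc.isCompact.isBounded
  rw [tendsto_iff_edist_tendsto_0]
  set V := (cellMeasure d) Set.univ ^ (1 / (1 : ℝ≥0∞).toReal - 1 / (2 : ℝ≥0∞).toReal)
  have hV : V ≠ ⊤ := ENNReal.rpow_ne_top_of_nonneg (by norm_num) (measure_ne_top _ _)
  have hlim : Tendsto (fun n => ENNReal.ofReal M * m * V *
      eLpNorm (fun x => u n x - v x) 2 (cellMeasure d)) atTop (𝓝 0) := by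
    have := ENNReal.Tendsto.const_mul (a := ENNReal.ofReal M * m * V) h
      (Or.inr (by finiteness))
    rwa [mul_zero] at this
  refine tendsto_of_tendsto_of_tendsto_of_le_of_le tendsto_const_nhds hlim (fun _ => zero_le)
    fun n => ?_
  have hi : ∀ f : Space d → ℂ, LocallyIntegrable f → Integrable fun x => ψ x • f x :=
    fun f hf => hf.integrable_smul_left_of_hasCompactSupport hψ hψc
  rw [edist_eq_enorm_sub, ← integral_sub (hi _ (hu n)) (hi _ hv)]
  calc ‖∫ x, (ψ x • u n x - ψ x • v x)‖ₑ
      ≤ ∫⁻ x, ‖ψ x • u n x - ψ x • v x‖ₑ := enorm_integral_le_lintegral_enorm _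
    _ ≤ ∫⁻ x in tsupport ψ, ENNReal.ofReal M * ‖u n x - v x‖ₑ := by
        rw [← lintegral_indicator (isClosed_tsupport ψ).measurableSet]
        refine lintegral_mono fun x => ?_
        rw [← smul_sub, enorm_smul]
        by_cases hx : x ∈ tsupport ψ
        · rw [Set.indicator_of_mem hx]
          gcongr
          rw [← ofReal_norm]
          exact ENNReal.ofReal_le_ofReal (hM x)
        · rw [image_eq_zero_of_notMem_tsupport hx, enorm_zero_eq, zero_mul]
          exact zero_le
    _ = ENNReal.ofReal M * ∫⁻ x in tsupport ψ, ‖u n x - v x‖ₑ :=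
        lintegral_const_mul' _ _ (by finiteness)
    _ ≤ ENNReal.ofReal M * (m * ∫⁻ x in cell d, ‖u n x - v x‖ₑ) := by
        gcongr
        have := hm (cell d) subset_rfl (fun x => ‖u n x - v x‖ₑ) fun k x => by
          simp only [hup n k x, hvp k x]
        rwa [periodization_cell, Set.inter_univ] at this
    _ = ENNReal.ofReal M * (m * eLpNorm (fun x => u n x - v x) 1 (cellMeasure d)) := by
        rw [eLpNorm_one_eq_lintegral_enorm]
    _ ≤ ENNReal.ofReal M *
          (m * (eLpNorm (fun x => u n x - v x) 2 (cellMeasure d) * V)) := by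
        gcongr
        exact eLpNorm_le_eLpNorm_mul_rpow_measure_univ (by norm_num)
          ((hu n).aestronglyMeasurable.sub hv.aestronglyMeasurable).restrict
    _ = _ := by ring

theorem exists_lipschitzWith_of_isPeriodic {w : Space d → ℂ} (hw : ContDiff ℝ ∞ w)
    (hwp : IsPeriodic w) : ∃ K, LipschitzWith K w := by
  obtain ⟨K, hK⟩ := exists_lipschitzWith_wave_mul hw hwp 0
  refine ⟨K, ?_⟩
  have : (fun x => wave 0 x * w x) = w := by ext x; simp [wave]
  rwa [this] at hK

/-- A limit of smooth periodic functions is known only on the cell. It is extended periodically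
through `cellRep`, and the weak gradient identity, in which integrals run over the whole space,
passes to the limit. -/
theorem exists_memH1Per {p : Graph d} (hp : p ∈ periodicGraph d) :
    ∃ u g, MemH1Per u g ∧ IsPair p u g := by
  obtain ⟨q, hq, hlim⟩ := mem_closure_iff_seq_limit.1 hp
  choose w hw hwp hqw using hq
  have hsm : Measurable p.snd := (Lp.stronglyMeasurable p.snd).measurable
  set u : Space d → ℂ := fun x => p.fst (cellRep x)
  set g : Space d → Fin d → ℂ := fun x j => p.snd (cellRep x) j
  have hpu : IsPair p u g := by
    constructor
    · filter_upwards [ae_restrict_mem (measurableSet_cell d)] with x hx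
      simp only [u, cellRep_of_mem hx]
    · filter_upwards [ae_restrict_mem (measurableSet_cell d)] with x hx
      simp only [g, cellRep_of_mem hx]
  have hu2 : MemL2loc u :=
    memL2loc_comp_cellRep (Lp.stronglyMeasurable p.fst).measurable (Lp.memLp p.fst)
  have hg2 : ∀ j, MemL2loc fun x => g x j := fun j =>
    memL2loc_comp_cellRep (f := fun x => p.snd x j) (by fun_prop)
      (memLp_piLp_iff.1 (Lp.memLp p.snd) j)
  obtain ⟨h1, h2⟩ := tendsto_eLpNorm_of_isPair hqw hpu hlim
  have hup : IsPeriodic u := isPeriodic_cellRep.comp _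
  have hgp : ∀ j, IsPeriodic fun x => g x j := fun j =>
    isPeriodic_cellRep.comp fun x => p.snd x j
  refine ⟨u, g, ⟨hup, hu2, hg2, fun φ hφ hφc j => ?_⟩, hpu⟩
  have hD : Continuous fun x => fderiv ℝ φ x (EuclideanSpace.single j 1) :=
    (hφ.continuous_fderiv (by simp)).clm_apply continuous_const
  have t1 := tendsto_integral_smul_of_periodic hD (hφc.fderiv_apply (𝕜 := ℝ) _)
    (fun n => (hw n).continuous.locallyIntegrable) hu2.locallyIntegrable hwp hup h1
  have t2 := tendsto_integral_smul_of_periodic hφ.continuous hφc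
    (fun n => (continuous_pderiv (hw n) j).locallyIntegrable) (hg2 j).locallyIntegrable
    (fun n => (hwp n).fderiv.comp fun L => L (EuclideanSpace.single j 1)) (hgp j) (h2 j)
  refine tendsto_nhds_unique t1 (t2.neg.congr fun n => ?_)
  obtain ⟨K, hK⟩ := exists_lipschitzWith_of_isPeriodic (hw n) (hwp n)
  exact (isWeakGradient_of_lipschitzWith hK φ hφ hφc j).symm

/-! ### Periodisation of test functions -/

/-- Near any point the periodised function is a finite sum of translates of φ; at each point only
the translate by the integer part can be nonzero. No gluing at the faces of the cell is needed. -/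
theorem contDiff_comp_cellRep {φ : Space d → ℂ} (hφ : ContDiff ℝ ∞ φ)
    (hs : ∀ x ∉ cell d, φ x = 0) : ContDiff ℝ ∞ fun x => φ (cellRep x) := by
  rw [contDiff_iff_contDiffAt]
  intro x₀
  obtain ⟨s, hs'⟩ := exists_finset_floorVec (Metric.isBounded_ball (x := x₀) (r := 1))
  have h1 : ContDiff ℝ ∞ fun x => ∑ n ∈ s, φ (x - latticeVec n) :=
    ContDiff.sum fun n _ => hφ.comp (contDiff_id.sub contDiff_const)
  refine h1.contDiffAt.congr_of_eventuallyEq ?_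
  filter_upwards [Metric.ball_mem_nhds x₀ one_pos] with x hx
  rw [Finset.sum_eq_single_of_mem (floorVec x) (hs' x hx)]
  · rfl
  · intro n _ hn
    exact hs _ fun h => hn (eq_floorVec h)

theorem testGraph_le_smoothPeriodic {O : Set (Space d)} (hO : O ⊆ openCube d) :
    testGraph O ≤ smoothPeriodic d := by
  rintro p ⟨φ, ⟨hφ, -, hs⟩, hp⟩
  have hs' : ∀ x ∉ cell d, φ x = 0 := fun x hx =>
    image_eq_zero_of_notMem_tsupport fun h => hx (openCube_subset_cell (hO (hs h)))
  refine ⟨fun x => φ (cellRep x), contDiff_comp_cellRep hφ hs',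
    isPeriodic_cellRep.comp φ, hp.congr ?_ ?_⟩
  · filter_upwards [ae_restrict_mem (measurableSet_cell d)] with x hx
    rw [cellRep_of_mem hx]
  · have h1 : ∀ᵐ x ∂cellMeasure d, x ∈ openCube d := by
      refine (ae_restrict_iff' (measurableSet_cell d)).2 ?_
      have := measure_eq_zero_iff_ae_notMem.1 (volume_cell_diff_openCube (d := d))
      filter_upwards [this] with x hx hxc
      by_contra h
      exact hx ⟨hxc, h⟩
    filter_upwards [h1] with x hx
    ext j
    have : φ =ᶠ[𝓝 x] fun y => φ (cellRep y) := by
      filter_upwards [isOpen_openCube.mem_nhds hx] with y hy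
      rw [cellRep_of_mem (openCube_subset_cell hy)]
    simp only [pgrad, pderiv, this.fderiv_eq]

theorem zeroGraph_le_periodicGraph {O : Set (Space d)} (hO : O ⊆ openCube d) :
    zeroGraph O ≤ periodicGraph d :=
  Submodule.topologicalClosure_mono (testGraph_le_smoothPeriodic hO)

variable {d : ℕ} {Q₁ : Set (Space d)} {A : Space d → Matrix (Fin d) (Fin d) ℝ}

/-! ### The fibre problems as a `FibreModel` -/

theorem volume_cell_le_one : volume (cell d) ≤ 1 := by
  have h := (PiLp.volume_preserving_toLp (Fin d)).measure_preimage
    (measurableSet_cell d).nullMeasurableSet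
  have h1 : (@WithLp.toLp 2 (Fin d → ℝ)) ⁻¹' cell d = Set.univ.pi fun _ => Set.Ico (0 : ℝ) 1 := by
    ext x
    simp [cell]
  rw [← h, h1, Real.volume_pi_Ico]
  simp

theorem zero_mem_dualCell : (0 : Space d) ∈ dualCell d := fun j => by
  have := Real.pi_pos
  simp only [PiLp.zero_apply]
  exact ⟨by linarith, this⟩

theorem norm_le_of_mem_dualCell {κ : Space d} (hκ : κ ∈ dualCell d) :
    ‖κ‖ ≤ √(d * Real.pi ^ 2) := by
  rw [EuclideanSpace.norm_eq]
  refine Real.sqrt_le_sqrt ?_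
  calc ∑ j, ‖κ j‖ ^ 2 ≤ ∑ _j : Fin d, Real.pi ^ 2 := by
        refine Finset.sum_le_sum fun j _ => ?_
        have := hκ j
        rw [Real.norm_eq_abs, sq_abs]
        nlinarith [this.1, this.2]
    _ = d * Real.pi ^ 2 := by simp

/-- The constant function `1` in `L²(Q)`. -/
def oneCell (d : ℕ) : L2Cell d := (memLp_const (1 : ℂ)).toLp _

theorem coeFn_oneCell : oneCell d =ᵐ[cellMeasure d] fun _ => (1 : ℂ) := MemLp.coeFn_toLp _

theorem coeFn_smul_oneCell_add (c : ℂ) {f : L2Cell d} {v : Space d → ℂ}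
    (hf : f =ᵐ[cellMeasure d] v) :
    (c • oneCell d + f : L2Cell d) =ᵐ[cellMeasure d] fun x => c + v x := by
  filter_upwards [Lp.coeFn_add (c • oneCell d) f, Lp.coeFn_smul c (oneCell d), coeFn_oneCell, hf]
    with x h1 h2 h3 h4
  rw [h1, Pi.add_apply, h2, Pi.smul_apply, h3, h4, smul_eq_mul, mul_one]

theorem norm_oneCell_le : ‖oneCell d‖ ≤ 1 := by
  have h : ‖oneCell d‖ₑ ^ 2 ≤ 1 ^ 2 := by
    rw [enorm_sq_eq_lintegral]
    calc ∫⁻ x, ‖oneCell d x‖ₑ ^ 2 ∂cellMeasure d = ∫⁻ _x, 1 ∂cellMeasure d := by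
          refine lintegral_congr_ae ?_
          filter_upwards [coeFn_oneCell (d := d)] with x hx
          rw [hx, ← ofReal_norm, norm_one]
          simp
      _ ≤ 1 ^ 2 := by
          rw [lintegral_const, Measure.restrict_apply_univ, one_mul, one_pow]
          exact volume_cell_le_one
  have h2 := (ENNReal.pow_le_pow_left_iff two_ne_zero).1 h
  rwa [← ofReal_norm, ENNReal.ofReal_le_one] at h2

theorem toLp_one_mem_periodicGraph :
    WithLp.toLp 2 (oneCell d, (0 : L2Vec d)) ∈ periodicGraph d := by
  refine Submodule.le_topologicalClosure _ ⟨fun _ => 1, contDiff_const, fun _ _ => rfl,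
    coeFn_oneCell, ?_⟩
  filter_upwards [Lp.coeFn_zero (CVec d) 2 (cellMeasure d)] with x hx
  refine Eq.trans hx ?_
  ext j
  simp [pgrad, pderiv]

/-- The shifted gradient `∇ + iκ` on graphs. -/
theorem IsPair.snd_add_shiftOp {p : Graph d} {u : Space d → ℂ} {g : Space d → Fin d → ℂ}
    (hp : IsPair p u g) (κ : Space d) :
    (p.snd + shiftOp κ p.fst : L2Vec d) =ᵐ[cellMeasure d]
      fun x => WithLp.toLp 2 (shiftGrad κ u g x) := by
  filter_upwards [Lp.coeFn_add p.snd (shiftOp κ p.fst), coeFn_shiftOp κ p.fst, hp.fst, hp.snd]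
    with x h1 h2 h3 h4
  rw [h1, Pi.add_apply, h2, h3, h4]
  ext j
  simp [toCVec, shiftGrad]
  ring

theorem IsStiffPart.ae_mem_imp {P : Space d → Prop} (hQ : IsStiffPart Q₁)
    (h : ∀ᵐ x ∂volume.restrict (softPart Q₁), P x) :
    ∀ᵐ x ∂cellMeasure d, x ∈ Q₁ ∨ P x := by
  filter_upwards [hQ.ae_mem,
    ae_restrict_of_ae ((ae_restrict_iff' isOpen_softPart.measurableSet).1 h)] with x h1 h2
  exact h1.imp id h2

/-- A stiff coefficient annihilates the vector fields supported in the soft part. -/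
theorem IsCoefficient.op_eq_zero (hA : IsCoefficient A) (hQ : IsStiffPart Q₁)
    (h0 : ∀ᵐ x ∂volume.restrict (softPart Q₁), A x = 0) {y : L2Vec d}
    (hy : ∀ᵐ x ∂cellMeasure d, x ∉ softPart Q₁ → y x = 0) : hA.op y = 0 := by
  apply Lp.ext
  filter_upwards [hA.coeFn_op y, hQ.ae_mem_imp h0, hy, Lp.coeFn_zero (CVec d) 2 (cellMeasure d)]
    with x h1 h2 h3 h4
  rw [h1, h4]
  by_cases hx : x ∈ softPart Q₁
  · rcases h2 with h2 | h2
    · exact absurd (mem_periodization_of_mem h2) (hQ.notMem_of_mem_softPart hx)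
    · ext i
      rw [coeffMap_apply, h2]
      simp
  · rw [h3 hx, map_zero]
    rfl

theorem IsCoefficient.op_snd_eq_zero (hA : IsCoefficient A) (hQ : IsStiffPart Q₁)
    (h0 : ∀ᵐ x ∂volume.restrict (softPart Q₁), A x = 0) {φ : Graph d}
    (hφ : φ ∈ zeroGraph (softPart Q₁)) : hA.op φ.snd = 0 := by
  obtain ⟨v, g, hv, hp⟩ := exists_memH10 softPart_subset_cell hφ
  refine hA.op_eq_zero hQ h0 ?_
  filter_upwards [hp.snd, ae_restrict_of_ae (hv.ae_grad_eq_zero isOpen_softPart.measurableSet)]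
    with x h1 h2 hx
  rw [h1, h2 hx]
  rfl

theorem IsCoefficient.op_shiftOp_eq_zero (hA : IsCoefficient A) (hQ : IsStiffPart Q₁)
    (h0 : ∀ᵐ x ∂volume.restrict (softPart Q₁), A x = 0) (κ : Space d) {φ : Graph d}
    (hφ : φ ∈ zeroGraph (softPart Q₁)) : hA.op (shiftOp κ φ.fst) = 0 := by
  obtain ⟨v, g, hv, hp⟩ := exists_memH10 softPart_subset_cell hφ
  refine hA.op_eq_zero hQ h0 ?_
  filter_upwards [hp.fst, coeFn_shiftOp κ φ.fst,
    ae_restrict_of_ae (hv.ae_eq_zero isOpen_softPart.measurableSet)] with x h1 h2 h3 hx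
  rw [h2, h1, h3 hx, zero_smul]

/-- On Q₁ the second summand vanishes, so the constant is seen there in full. -/
theorem IsStiffPart.le_norm_const_add (hQ : IsStiffPart Q₁) (c : ℂ) {φ : Graph d}
    (hφ : φ ∈ zeroGraph (softPart Q₁)) :
    (volume Q₁).toReal * ‖c‖ ^ 2 ≤ ‖c • oneCell d + φ.fst‖ ^ 2 := by
  obtain ⟨v, g, hv, hp⟩ := exists_memH10 softPart_subset_cell hφ
  have hae := coeFn_smul_oneCell_add c hp.fst
  have h1 : volume Q₁ * ‖c‖ₑ ^ 2 ≤ ‖c • oneCell d + φ.fst‖ₑ ^ 2 := by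
    rw [enorm_sq_eq_lintegral]
    calc volume Q₁ * ‖c‖ₑ ^ 2 = ∫⁻ _x in Q₁, ‖c‖ₑ ^ 2 := by
          rw [lintegral_const, Measure.restrict_apply_univ, mul_comm]
      _ = ∫⁻ x in Q₁, ‖(c • oneCell d + φ.fst : L2Cell d) x‖ₑ ^ 2 := by
          refine lintegral_congr_ae ?_
          filter_upwards [ae_mono (Measure.restrict_mono hQ.subset_cell le_rfl) hae,
            ae_restrict_of_ae (hv.ae_eq_zero isOpen_softPart.measurableSet),
            ae_restrict_mem hQ.measurableSet] with x h1 h2 h3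
          rw [h1, h2 fun h => hQ.notMem_of_mem_softPart h (mem_periodization_of_mem h3), add_zero]
      _ ≤ _ := lintegral_mono_set hQ.subset_cell
  rw [← ofReal_norm, ← ofReal_norm, ← ENNReal.ofReal_pow (norm_nonneg _),
    ← ENNReal.ofReal_pow (norm_nonneg _), ← ENNReal.ofReal_toReal hQ.volume_lt_top.ne,
    ← ENNReal.ofReal_mul ENNReal.toReal_nonneg] at h1
  exact (ENNReal.ofReal_le_ofReal_iff (by positivity)).1 h1

theorem sq_le_of_enorm_sq_le {E : Type*} [SeminormedAddCommGroup E] {x : E} {C J : ℝ≥0∞}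
    {ν t : ℝ} (hC : C ≠ ⊤) (hν : 0 < ν) (ht : 0 ≤ t) (h1 : ‖x‖ₑ ^ 2 ≤ C * J)
    (h2 : ENNReal.ofReal ν * J ≤ ENNReal.ofReal t) : ‖x‖ ^ 2 ≤ C.toReal / ν * t := by
  have h3 : J ≤ ENNReal.ofReal (t / ν) := by
    rw [ENNReal.ofReal_div_of_pos hν, ENNReal.le_div_iff_mul_le (by simp [hν]) (by simp), mul_comm]
    exact h2
  have h4 : ‖x‖ₑ ^ 2 ≤ ENNReal.ofReal (C.toReal / ν * t) := by
    refine (h1.trans (mul_le_mul_right h3 C)).trans_eq ?_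
    conv_lhs => rw [← ENNReal.ofReal_toReal hC]
    rw [← ENNReal.ofReal_mul ENNReal.toReal_nonneg]
    congr 1
    ring
  rw [← ofReal_norm, ← ENNReal.ofReal_pow (norm_nonneg _)] at h4
  exact (ENNReal.ofReal_le_ofReal_iff (by positivity)).1 h4

theorem isPair_pgrad_snd_add_shiftOp {p : Graph d} {w : Space d → ℂ} (hp : IsPair p w (pgrad w))
    (κ : Space d) : (p.snd + shiftOp κ p.fst : L2Vec d) =ᵐ[cellMeasure d] gradVec κ w :=
  hp.snd_add_shiftOp κ

theorem setLIntegral_enorm_sq_congr {S : Set (Space d)} (hS : S ⊆ cell d) {f g : Space d → CVec d}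
    (h : f =ᵐ[cellMeasure d] g) : ∫⁻ x in S, ‖f x‖ₑ ^ 2 = ∫⁻ x in S, ‖g x‖ₑ ^ 2 :=
  lintegral_congr_ae (by
    filter_upwards [ae_mono (Measure.restrict_mono hS le_rfl) h] with x hx
    rw [hx])

/-- Operator form of `exists_soft_approx`: by ellipticity on Q₁, the integral of the squared shifted
gradient over Q₁ is at most ν⁻¹ times the stiff form. -/
theorem IsStiffPart.exists_smooth_approx (hQ : IsStiffPart Q₁) (hsoft : (softPart Q₁)ᶜ.Nonempty)
    (hA : IsCoefficient A) {ν : ℝ} (hν : 0 < ν) (hell : IsEllipticOn A ν Q₁)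
    (hnn : ∀ᵐ x ∂cellMeasure d, ∀ p : CVec d, 0 ≤ (matForm (A x) p p).re) :
    ∃ K : ℝ, 0 ≤ K ∧ ∀ κ ∈ dualCell d, ∀ p ∈ smoothPeriodic d, ∃ b : ℂ,
      ∃ φ ∈ zeroGraph (softPart Q₁),
        ‖p.fst - φ.fst - b • oneCell d‖ ≤
          K * √((inner ℂ (p.snd + shiftOp κ p.fst) (hA.op (p.snd + shiftOp κ p.fst))).re) ∧
        ‖(p.snd + shiftOp κ p.fst) - (φ.snd + shiftOp κ φ.fst)‖ ≤
          K * √((inner ℂ (p.snd + shiftOp κ p.fst) (hA.op (p.snd + shiftOp κ p.fst))).re) := by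
  obtain ⟨C, hC, h⟩ := hQ.exists_soft_approx
  refine ⟨√(C.toReal / ν), Real.sqrt_nonneg _, fun κ hκ p hp => ?_⟩
  obtain ⟨w, hw, hwp, hpw⟩ := hp
  obtain ⟨b, φ, ⟨L, hL⟩, hφ0, h1, h2⟩ := h κ hκ w hw hwp
  have hφ := memH10_of_lipschitzWith isOpen_softPart isBounded_softPart hsoft
    hQ.volume_frontier_softPart hL hφ0
  obtain ⟨q, hq, hqφ⟩ := exists_mem_zeroGraph hφ
  have hD := isPair_pgrad_snd_add_shiftOp hpw κ
  have hDφ : (q.snd + shiftOp κ q.fst : L2Vec d) =ᵐ[cellMeasure d] gradVec κ φ :=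
    hqφ.snd_add_shiftOp κ
  set y : L2Vec d := p.snd + shiftOp κ p.fst
  set z : L2Vec d := q.snd + shiftOp κ q.fst
  have ht : 0 ≤ (inner ℂ y (hA.op y)).re := by
    rw [hA.re_inner_op]
    exact integral_nonneg_of_ae (hnn.mono fun x hx => hx _)
  have hJ := hA.lintegral_le_inner_op hQ.subset_cell hell hν.le hnn y
  rw [setLIntegral_enorm_sq_congr hQ.subset_cell hD] at hJ
  refine ⟨b, q, hq, ?_, ?_⟩
  all_goals
    rw [← Real.sqrt_mul (by positivity)]
    refine Real.le_sqrt_of_sq_le (sq_le_of_enorm_sq_le hC hν ht ?_ hJ)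
    rw [enorm_sq_eq_lintegral]
  · refine le_trans (le_of_eq (lintegral_congr_ae ?_)) h1
    filter_upwards [Lp.coeFn_sub (p.fst - q.fst) (b • oneCell d), Lp.coeFn_sub p.fst q.fst,
      Lp.coeFn_smul b (oneCell d), coeFn_oneCell, hpw.fst, hqφ.fst] with x e1 e2 e3 e4 e5 e6
    rw [e1, Pi.sub_apply, e2, Pi.sub_apply, e3, Pi.smul_apply, e4, e5, e6, smul_eq_mul, mul_one]
  · refine le_trans (le_of_eq (lintegral_congr_ae ?_)) h2
    filter_upwards [Lp.coeFn_sub y z, hD, hDφ] with x e1 e2 e3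
    rw [e1, Pi.sub_apply, e2, e3]

theorem IsStiffPart.exists_smooth_coercive (hQ : IsStiffPart Q₁)
    (hA : IsCoefficient A) {ν : ℝ} (hν : 0 < ν) (hell : IsEllipticOn A ν Q₁)
    (hnn : ∀ᵐ x ∂cellMeasure d, ∀ p : CVec d, 0 ≤ (matForm (A x) p p).re) :
    ∃ γ : ℝ, 0 < γ ∧ ∀ ξ, ∀ p ∈ smoothPeriodic d, γ * ‖ξ‖ ^ 2 ≤
      (inner ℂ (shiftOp ξ (oneCell d) + p.snd) (hA.op (shiftOp ξ (oneCell d) + p.snd))).re := by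
  obtain ⟨C, hC, h⟩ := hQ.exists_cell_coercive
  refine ⟨(C.toReal / ν + 1)⁻¹, by positivity, fun ξ p hp => ?_⟩
  obtain ⟨w, hw, hwp, hpw⟩ := hp
  have h1 := h ξ w hw hwp
  set y : L2Vec d := shiftOp ξ (oneCell d) + p.snd
  have hD : y =ᵐ[cellMeasure d] fun x => gradVec ξ (fun _ => 1) x + gradVec 0 w x := by
    filter_upwards [Lp.coeFn_add (shiftOp ξ (oneCell d)) p.snd, coeFn_shiftOp ξ (oneCell d),
      coeFn_oneCell, hpw.snd] with x h1 h2 h3 h4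
    rw [h1, Pi.add_apply, h2, h3, h4]
    ext j
    simp [gradVec_apply, toCVec, pgrad, pderiv]
  have ht : 0 ≤ (inner ℂ y (hA.op y)).re := by
    rw [hA.re_inner_op]
    exact integral_nonneg_of_ae (hnn.mono fun x hx => hx _)
  have hJ := hA.lintegral_le_inner_op hQ.subset_cell hell hν.le hnn y
  rw [setLIntegral_enorm_sq_congr hQ.subset_cell hD] at hJ
  have h2 := sq_le_of_enorm_sq_le hC hν ht h1 hJ
  rw [inv_mul_le_iff₀ (by positivity)]
  linarith

theorem IsStiffPart.exists_fibreModel (hQ : IsStiffPart Q₁) (hsoft : (softPart Q₁)ᶜ.Nonempty)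
    {A₀ A₁ : Space d → Matrix (Fin d) (Fin d) ℝ} (hA₀ : IsCoefficient A₀) (hA₁ : IsCoefficient A₁)
    {ν : ℝ} (hν : 0 < ν) (hell₀ : IsEllipticOn A₀ ν (cell d)) (hell₁ : IsEllipticOn A₁ ν Q₁)
    (h0 : ∀ᵐ x ∂volume.restrict (softPart Q₁), A₁ x = 0) :
    ∃ S : FibreModel d (L2Cell d) (L2Vec d), S.one = oneCell d ∧ S.H = periodicGraph d ∧
      S.H₀ = zeroGraph (softPart Q₁) ∧ S.shift = shiftOp ∧ S.M₀ = hA₀.op ∧ S.M₁ = hA₁.op ∧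
      S.dual = dualCell d := by
  obtain ⟨μ, hμ, hstiff⟩ := hQ.ae_stiff hA₁ hν hell₁ h0
  have hnn : ∀ᵐ x ∂cellMeasure d, ∀ p : CVec d, 0 ≤ (matForm (A₁ x) p p).re :=
    hstiff.mono fun x hx p => (hx p).1
  obtain ⟨K, hK, hKa⟩ := hQ.exists_smooth_approx hsoft hA₁ hν hell₁ hnn
  obtain ⟨γ, hγ, hγa⟩ := hQ.exists_smooth_coercive hA₁ hν hell₁ hnn
  have hOc : softPart Q₁ ⊆ openCube d := subset_closure.trans hQ.closure_softPart
  refine ⟨{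
    one := oneCell d
    H := periodicGraph d
    H₀ := zeroGraph (softPart Q₁)
    shift := shiftOp
    M₀ := hA₀.op
    M₁ := hA₁.op
    dual := dualCell d
    ν := ν
    μ := μ
    β := (volume Q₁).toReal
    K := K
    R := √(d * Real.pi ^ 2)
    γ := γ
    ν_pos := hν
    β_pos := ENNReal.toReal_pos hQ.volume_pos.ne' hQ.volume_lt_top.ne
    γ_pos := hγ
    K_nonneg := hK
    μ_nonneg := hμ
    norm_one_le := norm_oneCell_le
    isClosed_H := Submodule.isClosed_topologicalClosure _
    isClosed_H₀ := Submodule.isClosed_topologicalClosure _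
    le := zeroGraph_le_periodicGraph hOc
    one_mem := toLp_one_mem_periodicGraph
    shift_smul := shiftOp_smul
    norm_shift_le := norm_shiftOp_le
    zero_mem_dual := zero_mem_dualCell
    norm_le_of_mem_dual := fun κ hκ => norm_le_of_mem_dualCell hκ
    coercive₀ := hA₀.le_re_inner_op hell₀
    symm₁ := hA₁.inner_op_left
    bound₁ := hA₁.norm_op_sq_le (hstiff.mono fun x hx p => (hx p).2)
    nonneg₁ := fun y => ?_
    M₁_grad := fun φ hφ => hA₁.op_snd_eq_zero hQ h0 hφ
    M₁_shift := fun κ φ hφ => hA₁.op_shiftOp_eq_zero hQ h0 κ hφ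
    const_le := fun c φ hφ => hQ.le_norm_const_add c hφ
    approx := fun κ hκ p hp δ hδ => ?_
    cell_coercive := fun ξ p hp => ?_ }, rfl, rfl, rfl, rfl, rfl, rfl, rfl⟩
  · rw [hA₁.re_inner_op]
    exact integral_nonneg_of_ae (hnn.mono fun x hx => hx _)
  · set D : Graph d →L[ℂ] L2Vec d :=
      WithLp.sndL 2 ℂ (L2Cell d) (L2Vec d) + (shiftOp κ).comp (WithLp.fstL 2 ℂ (L2Cell d) (L2Vec d))
    have hDp : ∀ q : Graph d, D q = q.snd + shiftOp κ q.fst := fun _ => rfl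
    set Ψ : Graph d → ℝ := fun q => K * √((inner ℂ (D q) (hA₁.op (D q))).re)
    have hΨ : Continuous Ψ := by
      have hc : Continuous fun q : Graph d => (inner ℂ (D q) (hA₁.op (D q)) : ℂ) :=
        D.continuous.inner (hA₁.op.continuous.comp D.continuous)
      exact continuous_const.mul (Complex.continuous_re.comp hc).sqrt
    have hfst : Continuous fun q : Graph d => q.fst :=
      (WithLp.fstL 2 ℂ (L2Cell d) (L2Vec d)).continuous
    -- The slack δ turns closeness to p into an open condition, so a smooth q meets it. The pair (b,
    -- φ) found for q then serves p.
    have hU : IsOpen {q : Graph d | ‖p.fst - q.fst‖ + Ψ q < Ψ p + δ ∧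
        ‖D p - D q‖ + Ψ q < Ψ p + δ} :=
      (isOpen_lt ((continuous_const.sub hfst).norm.add hΨ) continuous_const).inter
        (isOpen_lt ((continuous_const.sub D.continuous).norm.add hΨ) continuous_const)
    obtain ⟨q, ⟨hq1, hq2⟩, hq⟩ := mem_closure_iff.1 hp _ hU (by
      simp only [Set.mem_ofPred_eq, sub_self, norm_zero, zero_add, and_self]
      linarith)
    obtain ⟨b, φ, hφ, e1, e2⟩ := hKa κ hκ q hq
    refine ⟨b, φ, hφ, ?_, ?_⟩
    · refine le_trans ?_ hq1.le
      calc ‖p.fst - φ.fst - b • oneCell d‖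
          = ‖(p.fst - q.fst) + (q.fst - φ.fst - b • oneCell d)‖ := by congr 1; abel
        _ ≤ _ := (norm_add_le _ _).trans (add_le_add_right e1 _)
    · refine le_trans ?_ hq2.le
      calc ‖(p.snd + shiftOp κ p.fst) - (φ.snd + shiftOp κ φ.fst)‖
          = ‖(D p - D q) + ((q.snd + shiftOp κ q.fst) - (φ.snd + shiftOp κ φ.fst))‖ := by
            rw [hDp, hDp]; congr 1; abel
        _ ≤ _ := (norm_add_le _ _).trans (add_le_add_right e2 _)
  · have hsnd : Continuous fun q : Graph d => shiftOp ξ (oneCell d) + q.snd :=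
      continuous_const.add (WithLp.sndL 2 ℂ (L2Cell d) (L2Vec d)).continuous
    have hc : Continuous fun q : Graph d => (inner ℂ (shiftOp ξ (oneCell d) + q.snd)
        (hA₁.op (shiftOp ξ (oneCell d) + q.snd)) : ℂ) :=
      hsnd.inner (hA₁.op.continuous.comp hsnd)
    -- Coercivity is a closed condition and passes to the closure without slack.
    exact closure_minimal (fun q hq => hγa ξ q hq)
      (isClosed_le continuous_const (Complex.continuous_re.comp hc)) hp

variable {d : ℕ} {Q₁ : Set (Space d)} {A A₀ A₁ : Space d → Matrix (Fin d) (Fin d) ℝ}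

/-! ### The weak formulations in terms of graphs -/

theorem IsCoefficient.inner_op_eq_of_ae (hA : IsCoefficient A) {y z : L2Vec d}
    {f h : Space d → Fin d → ℂ} (hy : y =ᵐ[cellMeasure d] fun x => WithLp.toLp 2 (f x))
    (hz : z =ᵐ[cellMeasure d] fun x => WithLp.toLp 2 (h x)) :
    Integrable (fun x => matForm (A x) (f x) (h x)) (cellMeasure d) ∧
      inner ℂ z (hA.op y) = ∫ x, matForm (A x) (f x) (h x) ∂cellMeasure d := by
  have h1 : (fun x => matForm (A x) (y x) (z x)) =ᵐ[cellMeasure d]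
      fun x => matForm (A x) (f x) (h x) := by
    filter_upwards [hy, hz] with x h1 h2
    rw [h1, h2]
  exact ⟨(hA.integrable_matForm y z).congr h1, by rw [hA.inner_op]; exact integral_congr_ae h1⟩

theorem inner_eq_integral_of_ae {y z : L2Cell d} {u w : Space d → ℂ}
    (hy : y =ᵐ[cellMeasure d] u) (hz : z =ᵐ[cellMeasure d] w) :
    inner ℂ z y = ∫ x, u x * conj (w x) ∂cellMeasure d := by
  rw [L2.inner_def]
  refine integral_congr_ae ?_
  filter_upwards [hy, hz] with x h1 h2
  rw [h1, h2]
  exact RCLike.inner_apply _ _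

theorem fibreForm_eq (hA₀ : IsCoefficient A₀) (hA₁ : IsCoefficient A₁) (ε : ℝ) (θ : Space d)
    {p q : Graph d} {u w : Space d → ℂ} {g h : Space d → Fin d → ℂ} (hp : IsPair p u g)
    (hq : IsPair q w h) : fibreForm A₀ A₁ ε θ u g w h =
      ((ε ^ 2)⁻¹ : ℝ) * inner ℂ (q.snd + shiftOp (ε • θ) q.fst)
          (hA₁.op (p.snd + shiftOp (ε • θ) p.fst)) +
        inner ℂ (q.snd + shiftOp (ε • θ) q.fst) (hA₀.op (p.snd + shiftOp (ε • θ) p.fst)) := by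
  have h1 := hp.snd_add_shiftOp (ε • θ)
  have h2 := hq.snd_add_shiftOp (ε • θ)
  obtain ⟨i1, e1⟩ := hA₁.inner_op_eq_of_ae h1 h2
  obtain ⟨i0, e0⟩ := hA₀.inner_op_eq_of_ae h1 h2
  rw [e1, e0, ← integral_const_mul, ← integral_add (i1.const_mul _) i0, fibreForm]
  refine integral_congr_ae (.of_forall fun x => ?_)
  simp only [matForm, Matrix.add_apply, Matrix.smul_apply, smul_eq_mul, Finset.mul_sum,
    ← Finset.sum_add_distrib]
  refine Finset.sum_congr rfl fun i _ => Finset.sum_congr rfl fun j _ => ?_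
  push_cast
  ring

/-- The correspondence between a `FibreModel` and the concrete problem. -/
structure Represents (S : FibreModel d (L2Cell d) (L2Vec d)) (Q₁ : Set (Space d))
    (hA₀ : IsCoefficient A₀) (hA₁ : IsCoefficient A₁) : Prop where
  one : S.one = oneCell d
  H : S.H = periodicGraph d
  H₀ : S.H₀ = zeroGraph (softPart Q₁)
  shift : S.shift = shiftOp
  M₀ : S.M₀ = hA₀.op
  M₁ : S.M₁ = hA₁.op

namespace Represents

variable {S : FibreModel d (L2Cell d) (L2Vec d)} {hA₀ : IsCoefficient A₀}
  {hA₁ : IsCoefficient A₁}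

theorem grad_apply (R : Represents S Q₁ hA₀ hA₁) (κ : Space d) (p : Graph d) :
    S.grad κ p = p.snd + shiftOp κ p.fst := by
  rw [FibreModel.grad_apply, R.shift]

theorem isFibre_iff (R : Represents S Q₁ hA₀ hA₁) {ε : ℝ} {θ : Space d} {F : L2Cell d}
    {p : Graph d} {u : Space d → ℂ} {g : Space d → Fin d → ℂ} (hp : IsPair p u g)
    (hpH : p ∈ periodicGraph d) : S.IsFibre ε θ F p ↔ ∀ w h, MemH1Per w h →
      fibreForm A₀ A₁ ε θ u g w h + ∫ x, u x * conj (w x) ∂(cellMeasure d) =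
        ∫ x, F x * conj (w x) ∂(cellMeasure d) := by
  have key : ∀ (q : Graph d) (w : Space d → ℂ) (h : Space d → Fin d → ℂ), IsPair q w h →
      ((((ε ^ 2)⁻¹ : ℝ) * inner ℂ (S.grad (ε • θ) q) (S.M₁ (S.grad (ε • θ) p)) +
        inner ℂ (S.grad (ε • θ) q) (S.M₀ (S.grad (ε • θ) p)) + inner ℂ q.fst p.fst =
          inner ℂ q.fst F) ↔
      fibreForm A₀ A₁ ε θ u g w h + ∫ x, u x * conj (w x) ∂(cellMeasure d) =
        ∫ x, F x * conj (w x) ∂(cellMeasure d)) := by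
    intro q w h hq
    rw [R.grad_apply, R.grad_apply, R.M₀, R.M₁, ← fibreForm_eq hA₀ hA₁ ε θ hp hq,
      inner_eq_integral_of_ae hp.fst hq.fst, inner_eq_integral_of_ae .rfl hq.fst]
  constructor
  · rintro ⟨-, h⟩ w k hw
    obtain ⟨q, hq, hqw⟩ := exists_mem_periodicGraph hw
    exact (key q w k hqw).1 (h q (by rwa [R.H]))
  · refine fun h => ⟨by rwa [R.H], fun q hq => ?_⟩
    rw [R.H] at hq
    obtain ⟨w, k, hw, hqw⟩ := exists_memH1Per hq
    exact (key q w k hqw).2 (h w k hw)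

theorem exists_isFibre (R : Represents S Q₁ hA₀ hA₁) {ε : ℝ} {θ : Space d} {F : L2Cell d}
    {u : Space d → ℂ} (hu : IsFibreSolution A₀ A₁ ε θ F u) :
    ∃ p, S.IsFibre ε θ F p ∧ p.fst =ᵐ[cellMeasure d] u := by
  obtain ⟨g, hg, h⟩ := hu
  obtain ⟨p, hp, hpu⟩ := exists_mem_periodicGraph hg
  exact ⟨p, (R.isFibre_iff hpu hp).2 h, hpu.fst⟩

theorem exists_isFibreSolution (R : Represents S Q₁ hA₀ hA₁) {ε : ℝ} {θ : Space d} {F : L2Cell d}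
    {p : Graph d} (hp : S.IsFibre ε θ F p) : ∃ u, IsFibreSolution A₀ A₁ ε θ F u := by
  have hpH : p ∈ periodicGraph d := R.H ▸ hp.1
  obtain ⟨u, g, hu, hpu⟩ := exists_memH1Per hpH
  exact ⟨u, g, hu, (R.isFibre_iff hpu hpH).1 hp⟩

/-- In the abstract model the direction enters through multiplication by iξ, while A^hom is defined
with ξ itself. Multiplying competitors by i matches the two, since the form is unchanged by a factor
of modulus one. -/
theorem homQuad_eq (R : Represents S Q₁ hA₀ hA₁) {ξ : Space d} {N : Graph d}
    (hN : S.IsCorrector ξ N) : homQuad A₁ ξ = S.homCoeff ξ N := by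
  have key : ∀ (p : Graph d) (u : Space d → ℂ) (g : Space d → Fin d → ℂ), IsPair p u g →
      (∫ x, matForm (A₁ x) (fun j => (ξ j : ℂ) + g x j) (fun j => (ξ j : ℂ) + g x j)
        ∂(cellMeasure d)).re = S.homCoeff ξ (Complex.I • p) := by
    intro p u g hp
    have hae : (shiftOp ξ (oneCell d) + (Complex.I • p).snd : L2Vec d) =ᵐ[cellMeasure d]
        fun x => WithLp.toLp 2 fun j => Complex.I * ((ξ j : ℂ) + g x j) := by
      filter_upwards [Lp.coeFn_add (shiftOp ξ (oneCell d)) (Complex.I • p).snd,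
        coeFn_shiftOp ξ (oneCell d), coeFn_oneCell, (hp.smul Complex.I).snd] with x h1 h2 h3 h4
      rw [h1, Pi.add_apply, h2, h3, h4]
      ext j
      simp [toCVec]
      ring
    rw [FibreModel.homCoeff, R.one, R.shift, R.M₁, (hA₁.inner_op_eq_of_ae hae hae).2]
    congr 1
    refine integral_congr_ae (.of_forall fun x => ?_)
    refine Finset.sum_congr rfl fun i _ => Finset.sum_congr rfl fun j _ => ?_
    rw [map_mul, Complex.conj_I]
    linear_combination ((A₁ x i j : ℂ) * ((ξ j : ℂ) + g x j) * conj ((ξ i : ℂ) + g x i)) *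
      Complex.I_mul_I
  refine IsLeast.csInf_eq ⟨?_, ?_⟩
  -- The minimum is attained at the function represented by -iN.
  · have hm : (-Complex.I) • N ∈ periodicGraph d := Submodule.smul_mem _ _ (R.H ▸ hN.1)
    obtain ⟨u, g, hu, hp⟩ := exists_memH1Per hm
    refine ⟨u, g, hu, ?_⟩
    rw [key _ u g hp, smul_smul, mul_neg, Complex.I_mul_I, neg_neg, one_smul]
  · rintro r ⟨u, g, hu, rfl⟩
    obtain ⟨p, hp, hpu⟩ := exists_mem_periodicGraph hu
    rw [key p u g hpu]
    exact hN.homCoeff_le (by rw [R.H]; exact Submodule.smul_mem _ _ hp)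

/-- Test functions b + φ are constant on Q₁, hence belong to ℒ, and the projection on the right-hand
side can be dropped. -/
theorem inner_fibreProj {b : ℂ} {φ f : L2Cell d} (F : L2Cell d)
    (hφ : ∀ᵐ x ∂(cellMeasure d).restrict Q₁, φ x = 0) (hf : f = b • oneCell d + φ) :
    inner ℂ f (fibreProj Q₁ F) = inner ℂ f F := by
  have hm : f ∈ limitSpace Q₁ := by
    refine ⟨b, ?_⟩
    filter_upwards [hφ, ae_restrict_of_ae (coeFn_smul_oneCell_add b
      (f := φ) (v := φ) .rfl)] with x h1 h2
    rw [hf, h2, h1, add_zero]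
  have h := Submodule.starProjection_inner_eq_zero (K := limitSpace Q₁) F f hm
  rw [inner_sub_left, sub_eq_zero] at h
  rw [fibreProj, ← inner_conj_symm, ← h, inner_conj_symm]

theorem isHom_iff (R : Represents S Q₁ hA₀ hA₁) (hQ : IsStiffPart Q₁) {ε : ℝ} {θ : Space d}
    {N : Graph d} (hN : S.IsCorrector θ N) {F : L2Cell d} {c : ℂ} {p : Graph d}
    {v : Space d → ℂ} {g : Space d → Fin d → ℂ} (hp : IsPair p v g)
    (hpH : p ∈ zeroGraph (softPart Q₁)) :
    S.IsHom (S.homCoeff θ N) (ε • θ) F c p ↔ ∀ (b : ℂ) φ h, MemH10 (softPart Q₁) φ h →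
      homForm A₀ A₁ ε θ c v g b φ h + ∫ x, (c + v x) * conj (b + φ x) ∂(cellMeasure d) =
        ∫ x, fibreProj Q₁ F x * conj (b + φ x) ∂(cellMeasure d) := by
  have key : ∀ (b : ℂ) (q : Graph d) (φ : Space d → ℂ) (h : Space d → Fin d → ℂ),
      IsPair q φ h → MemH10 (softPart Q₁) φ h →
      (((S.homCoeff θ N : ℂ) * c * conj b + inner ℂ (S.grad (ε • θ) q) (S.M₀ (S.grad (ε • θ) p)) +
        inner ℂ (b • S.one + q.fst) (c • S.one + p.fst) = inner ℂ (b • S.one + q.fst) F) ↔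
      homForm A₀ A₁ ε θ c v g b φ h + ∫ x, (c + v x) * conj (b + φ x) ∂(cellMeasure d) =
        ∫ x, fibreProj Q₁ F x * conj (b + φ x) ∂(cellMeasure d)) := by
    intro b q φ h hq hφ
    have hq0 : ∀ᵐ x ∂(cellMeasure d).restrict Q₁, q.fst x = 0 := by
      filter_upwards [ae_restrict_of_ae hq.fst, ae_restrict_of_ae (ae_restrict_of_ae
        (hφ.ae_eq_zero isOpen_softPart.measurableSet)), ae_restrict_mem hQ.measurableSet]
        with x h1 h2 h3
      rw [h1, h2 fun h => hQ.notMem_of_mem_softPart h (mem_periodization_of_mem h3)]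
    have hb := coeFn_smul_oneCell_add b hq.fst
    rw [homForm, R.homQuad_eq hN, R.grad_apply, R.grad_apply, R.M₀, R.one,
      (hA₀.inner_op_eq_of_ae (hp.snd_add_shiftOp _) (hq.snd_add_shiftOp _)).2,
      inner_eq_integral_of_ae (coeFn_smul_oneCell_add c hp.fst) hb, ← inner_fibreProj F hq0 rfl,
      inner_eq_integral_of_ae .rfl hb]
  constructor
  · rintro ⟨-, h⟩ b φ k hφ
    obtain ⟨q, hq, hqφ⟩ := exists_mem_zeroGraph hφ
    exact (key b q φ k hqφ hφ).1 (h b q (by rwa [R.H₀]))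
  · refine fun h => ⟨by rwa [R.H₀], fun b q hq => ?_⟩
    rw [R.H₀] at hq
    obtain ⟨φ, k, hφ, hqφ⟩ := exists_memH10 softPart_subset_cell hq
    exact (key b q φ k hqφ hφ).2 (h b φ k hφ)

theorem exists_isHom (R : Represents S Q₁ hA₀ hA₁) (hQ : IsStiffPart Q₁) {ε : ℝ} {θ : Space d}
    {N : Graph d} (hN : S.IsCorrector θ N) {F : L2Cell d} {c : ℂ} {v : Space d → ℂ}
    (hv : IsHomSolution A₀ A₁ Q₁ ε θ F c v) :
    ∃ p, S.IsHom (S.homCoeff θ N) (ε • θ) F c p ∧ p.fst =ᵐ[cellMeasure d] v := by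
  obtain ⟨g, hg, h⟩ := hv
  obtain ⟨p, hp, hpv⟩ := exists_mem_zeroGraph hg
  exact ⟨p, (R.isHom_iff hQ hN hpv hp).2 h, hpv.fst⟩

theorem exists_isHomSolution (R : Represents S Q₁ hA₀ hA₁) (hQ : IsStiffPart Q₁) {ε : ℝ}
    {θ : Space d} {N : Graph d} (hN : S.IsCorrector θ N) {F : L2Cell d} {c : ℂ} {p : Graph d}
    (hp : S.IsHom (S.homCoeff θ N) (ε • θ) F c p) :
    ∃ v, IsHomSolution A₀ A₁ Q₁ ε θ F c v := by
  have hpH : p ∈ zeroGraph (softPart Q₁) := R.H₀ ▸ hp.1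
  obtain ⟨v, g, hv, hpv⟩ := exists_memH10 softPart_subset_cell hpH
  exact ⟨v, g, hv, (R.isHom_iff hQ hN hpv hpH).1 hp⟩

end Represents

/-- Makes the distance to the complement meaningful in the cutoff near the boundary of Q₀. -/
theorem nonempty_compl_softPart (hd : 1 ≤ d) : (softPart Q₁)ᶜ.Nonempty := by
  refine ⟨EuclideanSpace.single ⟨0, hd⟩ 2, fun h => ?_⟩
  have := (softPart_subset_cell h ⟨0, hd⟩).2
  simp at this

end HighContrast

end

/-! ### The main theorem -/

theorem theorem7p1 {d : ℕ} (hd : 1 ≤ d)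
    (A₀ A₁ : HighContrast.Space d → Matrix (Fin d) (Fin d) ℝ)
    (Q₁ : Set (HighContrast.Space d)) (ν : ℝ) (hν : 0 < ν)
    (hQ₁ : HighContrast.IsStiffPart Q₁)
    (hA₀ : HighContrast.IsCoefficient A₀) (hA₁ : HighContrast.IsCoefficient A₁)
    (hA₀_ell : HighContrast.IsEllipticOn A₀ ν (HighContrast.cell d))
    (hA₁_ell : HighContrast.IsEllipticOn A₁ ν Q₁)
    (hA₁_zero : ∀ᵐ x ∂(volume.restrict (HighContrast.softPart Q₁)), A₁ x = 0) :
    ∃ C : ℝ, 0 < C ∧ ∀ (ε : ℝ), 0 < ε → ∀ θ : HighContrast.Space d,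
      ε • θ ∈ HighContrast.dualCell d → ∀ F : HighContrast.L2Cell d,
        -- the fibre problem has a solution, unique up to null sets
        (∃ u, HighContrast.IsFibreSolution A₀ A₁ ε θ F u) ∧
        (∀ u u', HighContrast.IsFibreSolution A₀ A₁ ε θ F u →
          HighContrast.IsFibreSolution A₀ A₁ ε θ F u' →
          u =ᵐ[HighContrast.cellMeasure d] u') ∧
        -- the homogenised fibre problem has a solution, unique up to null sets
        (∃ c v, HighContrast.IsHomSolution A₀ A₁ Q₁ ε θ F c v) ∧
        (∀ c v c' v', HighContrast.IsHomSolution A₀ A₁ Q₁ ε θ F c v →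
          HighContrast.IsHomSolution A₀ A₁ Q₁ ε θ F c' v' → c = c' ∧ v =ᵐ[volume] v') ∧
        -- the error estimate
        (∀ u c v, HighContrast.IsFibreSolution A₀ A₁ ε θ F u →
          HighContrast.IsHomSolution A₀ A₁ Q₁ ε θ F c v →
          eLpNorm (fun x => u x - (c + v x)) 2 (HighContrast.cellMeasure d) ≤
            ENNReal.ofReal (C * ε * ‖F‖)) := by
  obtain ⟨S, h1, h2, h3, h4, h5, h6, h7⟩ := hQ₁.exists_fibreModel
    (HighContrast.nonempty_compl_softPart hd) hA₀ hA₁ hν hA₀_ell hA₁_ell hA₁_zero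
  have R : HighContrast.Represents S Q₁ hA₀ hA₁ := ⟨h1, h2, h3, h4, h5, h6⟩
  obtain ⟨C, hC, h⟩ := S.exists_norm_sub_le
  refine ⟨C, hC, fun ε hε θ hθ F => ?_⟩
  obtain ⟨N, hN, hest⟩ := h θ
  have hα : 0 ≤ S.homCoeff θ N := S.nonneg₁ _
  refine ⟨?_, ?_, ?_, ?_, ?_⟩
  · obtain ⟨p, hp⟩ := S.exists_isFibre hε θ F
    exact R.exists_isFibreSolution hp
  · intro u u' hu hu'
    obtain ⟨p, hp, hpu⟩ := R.exists_isFibre hu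
    obtain ⟨p', hp', hpu'⟩ := R.exists_isFibre hu'
    rw [hp.fst_unique hp'] at hpu
    exact hpu.symm.trans hpu'
  · obtain ⟨c, p, hp⟩ := S.exists_isHom hα (ε • θ) F
    exact ⟨c, R.exists_isHomSolution hQ₁ hN hp⟩
  · intro c v c' v' hv hv'
    obtain ⟨p, hp, hpv⟩ := R.exists_isHom hQ₁ hN hv
    obtain ⟨p', hp', hpv'⟩ := R.exists_isHom hQ₁ hN hv'
    obtain ⟨hc, hpp⟩ := hp.unique hα hp'
    rw [hpp] at hpv
    refine ⟨hc, ?_⟩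
    obtain ⟨g, hg, -⟩ := hv
    obtain ⟨g', hg', -⟩ := hv'
    have hO := (HighContrast.isOpen_softPart (Q₁ := Q₁)).measurableSet
    -- Uniqueness in L²(Q) covers only the cell. Outside the soft part both functions vanish almost
    -- everywhere, so the equality extends to the whole space.
    filter_upwards [hg.ae_eq_zero hO, hg'.ae_eq_zero hO,
      (ae_restrict_iff' (HighContrast.measurableSet_cell d)).1 (hpv.symm.trans hpv')]
      with x e1 e2 e3
    by_cases hx : x ∈ HighContrast.softPart Q₁
    · exact e3 (HighContrast.softPart_subset_cell hx)
    · rw [e1 hx, e2 hx]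
  · intro u c v hu hv
    obtain ⟨p, hp, hpu⟩ := R.exists_isFibre hu
    obtain ⟨q, hq, hqv⟩ := R.exists_isHom hQ₁ hN hv
    have hle := hest ε hε (by rwa [h7]) F p q c hp hq
    rw [h1] at hle
    have hae : (p.fst - (c • HighContrast.oneCell d + q.fst) : HighContrast.L2Cell d)
        =ᵐ[HighContrast.cellMeasure d] fun x => u x - (c + v x) := by
      filter_upwards [Lp.coeFn_sub p.fst (c • HighContrast.oneCell d + q.fst), hpu,
        HighContrast.coeFn_smul_oneCell_add c hqv] with x e1 e2 e3
      rw [e1, Pi.sub_apply, e2, e3]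
    rw [← eLpNorm_congr_ae hae, ← Lp.enorm_def, ← ofReal_norm]
    exact ENNReal.ofReal_le_ofReal hle
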